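/- Let $a>0$ and let $S^1$ be the circle of radius $a$ with coordinate $0\le x\le 2\pi a$. Let $Q$ be a smooth $2\pi a$-periodic function with values in the Hermitian $N\times N$ matrices, let $D=\partial_x$ act on smooth $2\pi a$-periodic functions, let $\lambda<0$, and for real $\varepsilon$ put $L_\varepsilon=-D^2+\varepsilon Q$, acting on smooth $2\pi a$-periodic functions with values in $\mathbb C^N$. Whenever all eigenvalues $\lambda_n$ of $L_\varepsilon$ (counted with multiplicity) are $>\lambda$, put $\zeta(s,\lambda)=\sum_n(\lambda_n-\lambda)^{-s}$ for $\operatorname{Re}s$ large, continued meromorphically in $s$, and $\log\mathrm{Det}(L_\varepsilon-\lambda)=-\partial_s\zeta(0,\lambda)$. With $$f_q(z)=\int_0^1\Bigl(1+\tfrac{1-\xi^2}{4}z\Bigr)^q d\xi ,$$ define $$\gamma_Q(\lambda)=\frac1{2(-\lambda)^{1/2}}\int_{S^1}dx\,\mathrm{tr}\,Q-\frac1{8(-\lambda)^{3/2}}\int_{S^1}dx\,\mathrm{tr}\,Q\,f_{-3/2}\!\left(\frac{D^2}{\lambda}\right)Q ,$$ where $g(D^2)$ acts on $e^{inx/a}$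 as multiplication by $g(-n^2/a^2)$. (i) $f_{-3/2}(z)=\dfrac{4}{z+4}$ for all $z>-4$. (ii) For every such $a,\lambda,Q$ the equation $-P''-4\lambda P=Q$ has exactly one smooth $2\pi a$-periodic solution $P=(-D^2-4\lambda)^{-1}Q$, and $$\gamma_Q(\lambda)=\frac1{2(-\lambda)^{1/2}}\int_{S^1}dx\,\mathrm{tr}\,Q-\frac1{2(-\lambda)^{1/2}}\int_{S^1}dx\,\mathrm{tr}\,Q\,(-D^2-4\lambda)^{-1}Q .$$ (iii) As $a(-\lambda)^{1/2}\to\infty$ and $\varepsilon\to0$, where $\varepsilon$ measures the size of the potential relative to $-\lambda$, $$\log\mathrm{Det}(L_\varepsilon-\lambda)=2\pi aN(-\lambda)^{1/2}+\gamma_{\varepsilon Q}(\lambda)+O(\varepsilon^3),$$ up to exponentially small corrections to the coefficients of $\varepsilon^0,\varepsilon^1,\varepsilon^2$, the cubic remainder being measured relative to $aN(-\lambda)^{1/2}$. Precisely: there is an absolute constant $C>0$ such that for all $N$, $a>0$, $\lambda<0$ with $R:=a(-\lambda)^{1/2}\ge1$ and all $Q$ as above with operator norm $\|Q(x)\|\le-\lambda$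 for all $x$, there are real numbers $d_0,d_1,d_2$ (independent of $\varepsilon$) with $$|d_j|\le C\,N\,R^{j}e^{-2\pi R}\qquad(j=0,1,2),$$ such that for every real $\varepsilon$ with $|\varepsilon|\le\frac12$ all eigenvalues of $L_\varepsilon$ are greater than $\lambda$, $\zeta(s,\lambda)$ continues meromorphically to $\mathbb C$ and is analytic at $s=0$, and $$\Bigl|\log\mathrm{Det}(L_\varepsilon-\lambda)-2\pi aN(-\lambda)^{1/2}-\gamma_{\varepsilon Q}(\lambda)-\bigl(d_0+d_1\varepsilon+d_2\varepsilon^2\bigr)\Bigr|\le C\,N\,R\,|\varepsilon|^3 .$$ -/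

import Mathlib

open scoped ContDiff Matrix

noncomputable section

namespace CircleDet

/-- Smooth matrix-valued functions on the circle of radius `a`, written as smooth functions of the
coordinate `x` which are periodic with period `2 π a`. -/
def SmoothPeriodic {N : ℕ} (a : ℝ) (P : ℝ → Matrix (Fin N) (Fin N) ℂ) : Prop :=
  (∀ i j, ContDiff ℝ ∞ (fun x => P x i j)) ∧ Function.Periodic P (2 * Real.pi * a)

/-- A smooth Hermitian potential on the circle of radius `a`. -/
def IsPotential {N : ℕ} (a : ℝ) (Q : ℝ → Matrix (Fin N) (Fin N) ℂ) : Prop :=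
  SmoothPeriodic a Q ∧ ∀ x, (Q x).IsHermitian

/-- The differential expression `L φ = - φ'' + Q φ`. -/
def schrodinger {N : ℕ} (Q : ℝ → Matrix (Fin N) (Fin N) ℂ) (φ : ℝ → Fin N → ℂ) :
    ℝ → Fin N → ℂ :=
  fun x => -(deriv (deriv φ) x) + Q x *ᵥ φ x

/-- The eigenspace of `L = - D² + Q` on the circle of radius `a`: all smooth `2 π a`-periodic
functions `φ` with values in `ℂ^N` such that `L φ = μ φ`. -/
def eigenspace {N : ℕ} (a : ℝ) (Q : ℝ → Matrix (Fin N) (Fin N) ℂ) (μ : ℝ) :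
    Submodule ℂ (ℝ → Fin N → ℂ) where
  carrier := {φ | ContDiff ℝ ∞ φ ∧ Function.Periodic φ (2 * Real.pi * a) ∧
    ∀ x, schrodinger Q φ x = (μ : ℂ) • φ x}
  zero_mem' := by
    refine ⟨contDiff_const, fun x => rfl, fun x => ?_⟩
    have h : deriv (0 : ℝ → Fin N → ℂ) = 0 := by
      funext y
      exact deriv_const y (0 : Fin N → ℂ)
    simp [schrodinger, h]
  add_mem' := by
    rintro φ ψ ⟨h1, h2, h3⟩ ⟨k1, k2, k3⟩
    refine ⟨h1.add k1, h2.add k2, fun x => ?_⟩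
    have d1 : deriv (φ + ψ) = deriv φ + deriv ψ := by
      funext y
      exact deriv_add (h1.differentiable (by simp) y) (k1.differentiable (by simp) y)
    have h1' : ContDiff ℝ ∞ (deriv φ) := (contDiff_infty_iff_deriv.1 h1).2
    have k1' : ContDiff ℝ ∞ (deriv ψ) := (contDiff_infty_iff_deriv.1 k1).2
    have d2 : deriv (deriv φ + deriv ψ) x = deriv (deriv φ) x + deriv (deriv ψ) x :=
      deriv_add (h1'.differentiable (by simp) x) (k1'.differentiable (by simp) x)
    have e1 := h3 x
    have e2 := k3 x
    simp only [schrodinger] at e1 e2 ⊢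
    rw [d1, d2, Pi.add_apply, Matrix.mulVec_add, smul_add, ← e1, ← e2]
    abel
  smul_mem' := by
    rintro c φ ⟨h1, h2, h3⟩
    refine ⟨h1.const_smul c, fun x => by simp [h2 x], fun x => ?_⟩
    have d1 : deriv (c • φ) = c • deriv φ := by
      funext y
      exact deriv_const_smul c (h1.differentiable (by simp) y)
    have h1' : ContDiff ℝ ∞ (deriv φ) := (contDiff_infty_iff_deriv.1 h1).2
    have d2 : deriv (c • deriv φ) x = c • deriv (deriv φ) x :=
      deriv_const_smul c (h1'.differentiable (by simp) x)
    have e1 := h3 x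
    simp only [schrodinger] at e1 ⊢
    rw [d1, d2, Pi.smul_apply, Matrix.mulVec_smul, smul_comm, ← e1, smul_add, smul_neg]

/-- The multiplicity of `μ` as an eigenvalue of `L = - D² + Q` (zero if `μ` is not an eigenvalue).
The eigenspaces consist of solutions of a linear second-order differential equation in `ℂ^N`,
so their dimension is at most `2 N`. -/
def multiplicity {N : ℕ} (a : ℝ) (Q : ℝ → Matrix (Fin N) (Fin N) ℂ) (μ : ℝ) : ℕ :=
  Module.finrank ℂ (eigenspace a Q μ)

/-- `Z` is the zeta function `s ↦ ζ(s, λ) = Tr (L - λ)^(-s)`: it is the sum over the eigenvalues,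
taken with multiplicity, of `(μ - λ)^(-s)` when the real part of `s` is sufficiently large, it is
meromorphic on the complex plane, and it is analytic at `s = 0`. By the identity theorem its germ
at `0` is determined by these properties. -/
structure IsSpectralZeta {N : ℕ} (a : ℝ) (Q : ℝ → Matrix (Fin N) (Fin N) ℂ) (lam : ℝ)
    (Z : ℂ → ℂ) : Prop where
  series : ∃ σ : ℝ, ∀ s : ℂ, σ < s.re →
    HasSum (fun μ : ℝ => (multiplicity a Q μ : ℂ) * ((μ - lam : ℝ) : ℂ) ^ (-s)) (Z s)
  meromorphic : MeromorphicOn Z Set.univ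
  analyticAt_zero : AnalyticAt ℂ Z 0

/-- The zeta function of `L - λ`, analytically continued. -/
def spectralZeta {N : ℕ} (a : ℝ) (Q : ℝ → Matrix (Fin N) (Fin N) ℂ) (lam : ℝ) : ℂ → ℂ :=
  Classical.epsilon (IsSpectralZeta a Q lam)

/-- The zeta-regularized determinant: `log Det (L - λ) = - ζ'(0, λ)`. -/
def logDet {N : ℕ} (a : ℝ) (Q : ℝ → Matrix (Fin N) (Fin N) ℂ) (lam : ℝ) : ℂ :=
  -deriv (spectralZeta a Q lam) 0

/-- The function `f_q(z) = ∫₀¹ (1 + (1 - ξ²) z / 4)^q dξ`. -/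
def fFun (q z : ℝ) : ℝ := ∫ ξ in (0 : ℝ)..1, (1 + (1 - ξ ^ 2) / 4 * z) ^ q

/-- The Fourier coefficient `q_n = (2 π a)⁻¹ ∫ e^{-inx/a} Q(x) dx`. -/
def fourierCoef {N : ℕ} (a : ℝ) (Q : ℝ → Matrix (Fin N) (Fin N) ℂ) (n : ℤ) :
    Matrix (Fin N) (Fin N) ℂ :=
  Matrix.of fun i j => 1 / (2 * Real.pi * a : ℂ) *
    ∫ x in (0 : ℝ)..(2 * Real.pi * a), Complex.exp (-(Complex.I * n * x / a)) * Q x i j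

/-- The function `g(D²)` of the operator `D² = ∂²/∂x²` on the circle of radius `a`, applied to `Q`:
since `D² e^{inx/a} = - (n/a)² e^{inx/a}`, it is the sum over all integers `n` of
`g(- (n/a)²) q_n e^{inx/a}`. -/
def funLaplacian {N : ℕ} (a : ℝ) (g : ℝ → ℝ) (Q : ℝ → Matrix (Fin N) (Fin N) ℂ) :
    ℝ → Matrix (Fin N) (Fin N) ℂ :=
  fun x => ∑' n : ℤ,
    ((g (-((n : ℝ) / a) ^ 2) : ℂ) * Complex.exp (Complex.I * n * x / a)) • fourierCoef a Q n

/-- `γ(λ) = (2 (-λ)^{1/2})⁻¹ ∫ tr Q - (8 (-λ)^{3/2})⁻¹ ∫ tr Q f_{-3/2}(D²/λ) Q`. -/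
def gammaFun {N : ℕ} (a : ℝ) (Q : ℝ → Matrix (Fin N) (Fin N) ℂ) (lam : ℝ) : ℂ :=
  1 / (2 * ((-lam) ^ (1 / 2 : ℝ) : ℝ) : ℂ) *
      (∫ x in (0 : ℝ)..(2 * Real.pi * a), (Q x).trace)
    - 1 / (8 * ((-lam) ^ (3 / 2 : ℝ) : ℝ) : ℂ) *
      (∫ x in (0 : ℝ)..(2 * Real.pi * a),
        (Q x * funLaplacian a (fun y => fFun (-3 / 2) (y / lam)) Q x).trace)

/-- `P = (- D² - 4 λ)⁻¹ Q` on the circle of radius `a`: the function `P` is smooth and periodic and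
satisfies `- P'' - 4 λ P = Q`. -/
def IsFreeResolvent {N : ℕ} (a : ℝ) (lam : ℝ) (Q P : ℝ → Matrix (Fin N) (Fin N) ℂ) : Prop :=
  SmoothPeriodic a P ∧
    ∀ x i j, -(deriv (deriv fun y => P y i j) x) - 4 * (lam : ℂ) * P x i j = Q x i j

end CircleDet

end

open scoped ContDiff Matrix

noncomputable section

namespace CircleDet

open Complex MeasureTheory Filter Topology AddCircle

local notation "⟪" x ", " y "⟫" => inner ℂ x y

section

/-! ### Fourier analysis of smooth periodic functions -/

/-! Write `k = √(-λ)`, `m = k²`, `V = εQ`, `ξ = n/a`, let `G = (-D² + w)⁻¹` with eigenvalues `g_n =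
(ξ² + w)⁻¹`, let `B = (L + w)⁻¹` and `T(w) = Tr B`. Since `ν^(-s) = (sin πs / π) ∫ t^(-s) (ν + t)⁻¹
dt` for `0 < Re s < 1`, the zeta function is the `powerTransform` of `t ↦ T(m + t)` on a strip. The
bound `‖V‖ ≤ m/2` makes the Neumann series converge for all `w ≥ m`, and `T(w)` differs from its
free value `N · freeTrace` only by `O(w^(-3/2))`. The prefactor `sin πs / π` vanishes at `0` with
slope one, so `ζ'(0)` is `N` times the free derivative plus `∫ (T - N · freeTrace)(m + t) dt`
(`exists_spectralZeta`). The free derivative is explicit: the cotangent series gives `freeTrace =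
(πa/√w) coth(πa√w)`, whose part `πa/√w` contributes `-2πak` through a beta integral and whose
exponentially small rest contributes `-2 log(1 - e^(-2πak))` (`exists_freeZeta`).

The integral is expanded with `B = G - GVG + GVGVG - GVGVBVG`. The first-order trace is a multiple
of `∑ g_n²`, which integrates to `∑ g_n`. The second-order trace is `∑ h_l g_n² g_{n+l}`, where
`h_l` is the squared Hilbert–Schmidt norm of a Fourier coefficient of `V`; symmetrised under `(n, l)
↦ (n + l, -l)` each term becomes a total derivative, and the integral is half of `∑ h_l g_n g_{n+l}`
at `w = m`. Partial fractions and telescoping evaluate the sum over `n`, for `l ≠ 0`, as `coth(πak)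
(2πa/k) ((l/a)² + 4k²)⁻¹` (`hasSum_shift_mul`). This is how `(-D² - 4λ)⁻¹` enters, and it matches
`γ` because `f_{-3/2}(z) = 4/(z + 4)`. The defect `coth - 1` and the special value at `l = 0` are
exponentially small. The remainder has diagonal entries at most `2 g_n² v³ w⁻²` with `v = |ε| m`,
which sums and integrates to a multiple of `N a k |ε|³`.

Two analytic points remain. The sum over eigenvalues of the smooth periodic problem is a Hilbert
space trace, because the resolvent is compact and self-adjoint on `L²` and its eigenvectors are
smooth (`mem_specSpace_of_eigenvector`, `hasSum_resolvent_trace`). Continuation to all of `ℂ` needs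
`T` to every order: acting on `e^{iξx} u`, the resolvent has a parametrix made of polynomials in `ξ`
times powers of `g_n` (`exists_trace_expansion`), and the transforms of the resulting sums reduce to
the free zeta function (`exists_moment_transform`). -/

/-- Smooth scalar functions of period `2 π a`. -/
def SmoothPer (a : ℝ) (f : ℝ → ℂ) : Prop :=
  ContDiff ℝ ∞ f ∧ Function.Periodic f (2 * Real.pi * a)

/-- The exponential `e^{inx/a}`. -/
def emode (a : ℝ) (n : ℤ) (x : ℝ) : ℂ := exp (I * n * x / a)

/-- The scalar Fourier coefficient. -/
def fcoef (a : ℝ) (n : ℤ) (f : ℝ → ℂ) : ℂ :=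
  1 / (2 * Real.pi * a : ℂ) * ∫ x in (0 : ℝ)..(2 * Real.pi * a), exp (-(I * n * x / a)) * f x

/-- Sequences decaying faster than every power. -/
def RapidDecay (c : ℤ → ℂ) : Prop :=
  ∀ k : ℕ, ∃ C : ℝ, ∀ n : ℤ, (1 + |(n : ℝ)|) ^ k * ‖c n‖ ≤ C

/-- The sum of a trigonometric series. -/
def synth (a : ℝ) (c : ℤ → ℂ) (x : ℝ) : ℂ := ∑' n : ℤ, c n * emode a n x

theorem fourierCoef_apply {N : ℕ} (a : ℝ) (Q : ℝ → Matrix (Fin N) (Fin N) ℂ) (n : ℤ) (i j) :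
    fourierCoef a Q n i j = fcoef a n (fun x => Q x i j) := rfl

theorem emode_neg (a : ℝ) (n : ℤ) (x : ℝ) : emode a (-n) x = exp (-(I * n * x / a)) := by
  unfold emode; congr 1; push_cast; ring

theorem emode_mul (a : ℝ) (m n : ℤ) (x : ℝ) : emode a m x * emode a n x = emode a (m + n) x := by
  unfold emode; rw [← exp_add]; congr 1; push_cast; ring

theorem emode_zero (a : ℝ) (x : ℝ) : emode a 0 x = 1 := by simp [emode]

theorem norm_emode (a : ℝ) (n : ℤ) (x : ℝ) : ‖emode a n x‖ = 1 := by
  rw [emode, show I * n * x / a = ((n * x / a : ℝ) : ℂ) * I by push_cast; ring]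
  exact norm_exp_ofReal_mul_I _

theorem conj_emode (a : ℝ) (n : ℤ) (x : ℝ) :
    (starRingEnd ℂ) (emode a n x) = emode a (-n) x := by
  rw [emode, emode_neg, ← exp_conj]; congr 1; simp; ring

theorem contDiff_emode (a : ℝ) (n : ℤ) : ContDiff ℝ ∞ (emode a n) := by
  unfold emode
  have : ContDiff ℝ ∞ (fun x : ℝ => (x : ℂ)) := ofRealCLM.contDiff
  fun_prop

theorem continuous_emode (a : ℝ) (n : ℤ) : Continuous (emode a n) := (contDiff_emode a n).continuous

theorem hasDerivAt_emode (a : ℝ) (n : ℤ) (x : ℝ) :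
    HasDerivAt (emode a n) (I * n / a * emode a n x) x := by
  have h : HasDerivAt (fun y : ℝ => I * n * (y : ℂ) / a) (I * n / a) x := by
    simpa using ((hasDerivAt_id x).ofReal_comp.const_mul (I * n)).div_const (a : ℂ)
  have := h.cexp
  rwa [mul_comm (exp _)] at this

theorem emode_periodic {a : ℝ} (ha : 0 < a) (n : ℤ) :
    Function.Periodic (emode a n) (2 * Real.pi * a) := by
  intro x
  have ha' : (a : ℂ) ≠ 0 := by exact_mod_cast ha.ne'
  rw [emode, emode, show I * n * ((x + 2 * Real.pi * a : ℝ) : ℂ) / a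
    = I * n * x / a + n * (2 * Real.pi * I) by push_cast; field_simp, exp_add,
    exp_int_mul_two_pi_mul_I, mul_one]

theorem smoothPer_emode {a : ℝ} (ha : 0 < a) (n : ℤ) : SmoothPer a (emode a n) :=
  ⟨contDiff_emode a n, emode_periodic ha n⟩

theorem fcoef_eq (a : ℝ) (n : ℤ) (f : ℝ → ℂ) :
    fcoef a n f = 1 / (2 * Real.pi * a : ℂ) *
      ∫ x in (0 : ℝ)..(2 * Real.pi * a), emode a (-n) x * f x := by
  simp_rw [emode_neg]; rfl

theorem integral_emode {a : ℝ} (ha : 0 < a) (n : ℤ) :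
    ∫ x in (0 : ℝ)..(2 * Real.pi * a), emode a n x = if n = 0 then (2 * Real.pi * a : ℂ) else 0 := by
  have ha' : (a : ℂ) ≠ 0 := by exact_mod_cast ha.ne'
  split_ifs with h
  · subst h; simp [emode_zero]
  · have hn : (n : ℂ) ≠ 0 := by exact_mod_cast h
    have hd : ∀ x ∈ Set.uIcc (0 : ℝ) (2 * Real.pi * a),
        HasDerivAt (fun y => (I * n / a)⁻¹ * emode a n y) (emode a n x) x := by
      intro x _
      refine ((hasDerivAt_emode a n x).const_mul (I * n / a)⁻¹).congr_deriv ?_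
      rw [inv_mul_cancel_left₀ (div_ne_zero (mul_ne_zero I_ne_zero hn) ha')]
    rw [intervalIntegral.integral_eq_sub_of_hasDerivAt hd
      ((continuous_emode a n).intervalIntegrable _ _)]
    have := emode_periodic ha n 0
    rw [zero_add] at this
    rw [this, sub_self]

theorem two_pi_a_ne {a : ℝ} (ha : 0 < a) : (2 * Real.pi * a : ℂ) ≠ 0 := by
  have := Real.pi_pos
  exact_mod_cast (by positivity : (2 * Real.pi * a : ℝ) ≠ 0)

theorem fcoef_emode {a : ℝ} (ha : 0 < a) (n m : ℤ) :
    fcoef a n (emode a m) = if m = n then 1 else 0 := by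
  rw [fcoef_eq]
  simp_rw [emode_mul]
  rw [integral_emode ha]
  have := two_pi_a_ne ha
  by_cases h : m = n
  · subst h
    rw [if_pos (by ring), if_pos rfl, one_div_mul_cancel this]
  · rw [if_neg (by omega), if_neg h, mul_zero]

theorem fcoef_mul_emode (a : ℝ) (n m : ℤ) (f : ℝ → ℂ) :
    fcoef a n (fun x => f x * emode a m x) = fcoef a (n - m) f := by
  rw [fcoef_eq, fcoef_eq]
  congr 2; ext x
  rw [show -(n - m) = -n + m by ring, ← emode_mul]; ring

theorem fcoef_add {a : ℝ} (n : ℤ) {f g : ℝ → ℂ} (hf : Continuous f) (hg : Continuous g) :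
    fcoef a n (fun x => f x + g x) = fcoef a n f + fcoef a n g := by
  simp_rw [fcoef_eq, mul_add]
  rw [intervalIntegral.integral_add, mul_add]
  · exact ((continuous_emode a _).mul hf).intervalIntegrable _ _
  · exact ((continuous_emode a _).mul hg).intervalIntegrable _ _

theorem fcoef_sum {ι : Type*} {a : ℝ} (n : ℤ) (s : Finset ι) {f : ι → ℝ → ℂ}
    (hf : ∀ i, Continuous (f i)) :
    fcoef a n (fun x => ∑ i ∈ s, f i x) = ∑ i ∈ s, fcoef a n (f i) := by
  simp_rw [fcoef_eq, Finset.mul_sum]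
  rw [intervalIntegral.integral_finsetSum, Finset.mul_sum]
  intro i _
  exact ((continuous_emode a _).mul (hf i)).intervalIntegrable _ _

theorem fcoef_const_mul (a : ℝ) (n : ℤ) (c : ℂ) (f : ℝ → ℂ) :
    fcoef a n (fun x => c * f x) = c * fcoef a n f := by
  simp_rw [fcoef_eq, mul_left_comm _ c]
  rw [intervalIntegral.integral_const_mul, mul_left_comm]

theorem fcoef_neg (a : ℝ) (n : ℤ) (f : ℝ → ℂ) :
    fcoef a n (fun x => -f x) = -fcoef a n f := by
  simpa using fcoef_const_mul a n (-1) f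

theorem fcoef_conj (a : ℝ) (n : ℤ) (f : ℝ → ℂ) :
    fcoef a n (fun x => (starRingEnd ℂ) (f x)) = (starRingEnd ℂ) (fcoef a (-n) f) := by
  rw [fcoef_eq, fcoef_eq, map_mul]
  congr 1
  · simp [conj_ofNat]
  · simp_rw [intervalIntegral, map_sub, ← integral_conj, map_mul, conj_emode, neg_neg]

theorem norm_fcoef_le {a : ℝ} (ha : 0 < a) (n : ℤ) {f : ℝ → ℂ} {C : ℝ} (hf : ∀ x, ‖f x‖ ≤ C) :
    ‖fcoef a n f‖ ≤ C := by
  rw [fcoef_eq, norm_mul]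
  have h := intervalIntegral.norm_integral_le_of_norm_le_const (a := 0) (b := 2 * Real.pi * a)
    (f := fun x => emode a (-n) x * f x) (C := C) (fun x _ => by
      rw [norm_mul, norm_emode, one_mul]; exact hf x)
  have hp : (0 : ℝ) < 2 * Real.pi * a := by have := Real.pi_pos; positivity
  rw [sub_zero, abs_of_pos hp] at h
  have e : ‖(1 / (2 * Real.pi * a : ℂ))‖ = 1 / (2 * Real.pi * a) := by
    rw [norm_div, norm_one]
    congr 1
    rw [show (2 * Real.pi * a : ℂ) = ((2 * Real.pi * a : ℝ) : ℂ) by push_cast; ring, norm_real,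
      Real.norm_eq_abs, abs_of_pos hp]
  rw [e]
  calc _ ≤ 1 / (2 * Real.pi * a) * (C * (2 * Real.pi * a)) := by gcongr
    _ = C := by field_simp

theorem SmoothPer.continuous {a : ℝ} {f : ℝ → ℂ} (hf : SmoothPer a f) : Continuous f :=
  hf.1.continuous

theorem SmoothPer.deriv {a : ℝ} {f : ℝ → ℂ} (hf : SmoothPer a f) : SmoothPer a (deriv f) := by
  refine ⟨(contDiff_infty_iff_deriv.1 hf.1).2, fun x => ?_⟩
  rw [← deriv_comp_add_const]
  congr 1; ext y; exact hf.2 y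

theorem SmoothPer.differentiable {a : ℝ} {f : ℝ → ℂ} (hf : SmoothPer a f) : Differentiable ℝ f :=
  hf.1.differentiable (by simp)

theorem SmoothPer.add {a : ℝ} {f g : ℝ → ℂ} (hf : SmoothPer a f) (hg : SmoothPer a g) :
    SmoothPer a (fun x => f x + g x) := ⟨hf.1.add hg.1, fun x => by simp [hf.2 x, hg.2 x]⟩

theorem SmoothPer.mul {a : ℝ} {f g : ℝ → ℂ} (hf : SmoothPer a f) (hg : SmoothPer a g) :
    SmoothPer a (fun x => f x * g x) := ⟨hf.1.mul hg.1, fun x => by simp [hf.2 x, hg.2 x]⟩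

theorem SmoothPer.const (a : ℝ) (c : ℂ) : SmoothPer a (fun _ => c) :=
  ⟨contDiff_const, fun _ => rfl⟩

theorem SmoothPer.const_mul {a : ℝ} {f : ℝ → ℂ} (c : ℂ) (hf : SmoothPer a f) :
    SmoothPer a (fun x => c * f x) := (SmoothPer.const a c).mul hf

theorem SmoothPer.neg {a : ℝ} {f : ℝ → ℂ} (hf : SmoothPer a f) :
    SmoothPer a (fun x => - f x) := ⟨hf.1.neg, fun x => by simp [hf.2 x]⟩

theorem SmoothPer.sum {ι : Type*} {a : ℝ} (s : Finset ι) {f : ι → ℝ → ℂ}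
    (hf : ∀ i, SmoothPer a (f i)) : SmoothPer a (fun x => ∑ i ∈ s, f i x) :=
  ⟨ContDiff.sum fun i _ => (hf i).1, fun x => Finset.sum_congr rfl fun i _ => (hf i).2 x⟩

theorem bounded_of_periodic {f : ℝ → ℂ} {T : ℝ} (hT : 0 < T) (hf : Continuous f)
    (hp : Function.Periodic f T) : ∃ C, ∀ x, ‖f x‖ ≤ C := by
  obtain ⟨C, hC⟩ := (isCompact_Icc (a := (0 : ℝ)) (b := T)).exists_bound_of_continuousOn
    hf.continuousOn
  refine ⟨C, fun x => ?_⟩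
  obtain ⟨y, hy, e⟩ := hp.exists_mem_Ico₀ hT x
  rw [e]; exact hC y ⟨hy.1, hy.2.le⟩

theorem SmoothPer.bounded {a : ℝ} (ha : 0 < a) {f : ℝ → ℂ} (hf : SmoothPer a f) :
    ∃ C, ∀ x, ‖f x‖ ≤ C :=
  bounded_of_periodic (by have := Real.pi_pos; positivity) hf.continuous hf.2

theorem fcoef_deriv {a : ℝ} (ha : 0 < a) (n : ℤ) {f : ℝ → ℂ} (hf : SmoothPer a f) :
    fcoef a n (deriv f) = I * n / a * fcoef a n f := by
  have hp := (smoothPer_emode ha (-n)).mul hf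
  have hd : ∀ x ∈ Set.uIcc (0 : ℝ) (2 * Real.pi * a), HasDerivAt (fun x => emode a (-n) x * f x)
      (I * ((-n : ℤ) : ℂ) / a * emode a (-n) x * f x + emode a (-n) x * deriv f x) x :=
    fun x _ => (hasDerivAt_emode a (-n) x).mul (hf.differentiable x).hasDerivAt
  have c1 := continuous_emode a (-n)
  have c2 := hf.continuous
  have c3 := hf.deriv.continuous
  have h := intervalIntegral.integral_eq_sub_of_hasDerivAt hd
    ((by fun_prop : Continuous _).intervalIntegrable _ _)
  have e := hp.2 0
  simp only [zero_add] at e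
  rw [e, sub_self, intervalIntegral.integral_add
    ((by fun_prop : Continuous _).intervalIntegrable _ _)
    ((by fun_prop : Continuous _).intervalIntegrable _ _)] at h
  simp_rw [mul_assoc (I * ((-n : ℤ) : ℂ) / a)] at h
  rw [intervalIntegral.integral_const_mul] at h
  rw [fcoef_eq, fcoef_eq, eq_neg_of_add_eq_zero_right h]
  push_cast; ring

theorem fcoef_deriv2 {a : ℝ} (ha : 0 < a) (n : ℤ) {f : ℝ → ℂ} (hf : SmoothPer a f) :
    fcoef a n (deriv (deriv f)) = -((n : ℂ) / a) ^ 2 * fcoef a n f := by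
  rw [fcoef_deriv ha n hf.deriv, fcoef_deriv ha n hf]
  linear_combination ((n : ℂ) / a) ^ 2 * fcoef a n f * I_sq

/-- A derivative multiplies the coefficient by `in/a`, so one more power of `|n|` is paid for by
applying the induction hypothesis to `f'` as well as to `f`. -/
theorem rapidDecay_fcoef {a : ℝ} (ha : 0 < a) {f : ℝ → ℂ} (hf : SmoothPer a f) :
    RapidDecay (fun n => fcoef a n f) := by
  intro k
  induction k generalizing f with
  | zero =>
    obtain ⟨C, hC⟩ := hf.bounded ha
    exact ⟨C, fun n => by simpa using norm_fcoef_le ha n hC⟩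
  | succ k ih =>
    obtain ⟨C, hC⟩ := ih hf
    obtain ⟨C', hC'⟩ := ih hf.deriv
    refine ⟨C + a * C', fun n => ?_⟩
    have h1 := hC n
    have h2 := hC' n
    simp only [fcoef_deriv ha n hf] at h2
    rw [norm_mul, norm_div, norm_mul, norm_I, one_mul, norm_intCast,
      norm_real, Real.norm_eq_abs, abs_of_pos ha] at h2
    calc (1 + |(n : ℝ)|) ^ (k + 1) * ‖fcoef a n f‖
        = (1 + |(n : ℝ)|) ^ k * ‖fcoef a n f‖
          + a * ((1 + |(n : ℝ)|) ^ k * (|(n : ℝ)| / a * ‖fcoef a n f‖)) := by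
            field_simp; ring
      _ ≤ _ := by gcongr

theorem summable_one_add_abs : Summable (fun n : ℤ => ((1 + |(n : ℝ)|) ^ 2)⁻¹) := by
  have h := (Real.summable_one_div_int_pow (p := 2)).2 (by norm_num)
  refine Summable.of_norm_bounded_eventually h ?_
  have : ∀ᶠ n : ℤ in cofinite, n ≠ 0 := by
    exact (Set.finite_singleton (0 : ℤ)).eventually_cofinite_notMem
  filter_upwards [this] with n hn
  have hn' : (0 : ℝ) < |(n : ℝ)| := abs_pos.2 (by exact_mod_cast hn)
  rw [Real.norm_of_nonneg (by positivity), one_div, ← sq_abs (n : ℝ)]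
  gcongr
  linarith

theorem RapidDecay.bound {c : ℤ → ℂ} (hc : RapidDecay c) (k : ℕ) :
    ∃ C : ℝ, 0 ≤ C ∧ ∀ n : ℤ, ‖c n‖ ≤ C * ((1 + |(n : ℝ)|) ^ k)⁻¹ := by
  obtain ⟨C, hC⟩ := hc k
  refine ⟨C, (by positivity : (0:ℝ) ≤ _).trans (hC 0), fun n => ?_⟩
  rw [← div_eq_mul_inv, le_div_iff₀ (by positivity), mul_comm]
  exact hC n

theorem RapidDecay.summable {c : ℤ → ℂ} (hc : RapidDecay c) : Summable (fun n => ‖c n‖) := by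
  obtain ⟨C, _, hC⟩ := hc.bound 2
  exact Summable.of_nonneg_of_le (fun _ => norm_nonneg _) hC (summable_one_add_abs.mul_left C)

theorem RapidDecay.of_le {c d : ℤ → ℂ} {K : ℝ} {j : ℕ} (hc : RapidDecay c)
    (h : ∀ n : ℤ, ‖d n‖ ≤ K * (1 + |(n : ℝ)|) ^ j * ‖c n‖) (hK : 0 ≤ K) : RapidDecay d := by
  intro k
  obtain ⟨C, hC⟩ := hc (k + j)
  refine ⟨K * C, fun n => ?_⟩
  calc (1 + |(n : ℝ)|) ^ k * ‖d n‖ ≤ (1 + |(n : ℝ)|) ^ k * (K * (1 + |(n : ℝ)|) ^ j * ‖c n‖) := by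
        gcongr; exact h n
    _ = K * ((1 + |(n : ℝ)|) ^ (k + j) * ‖c n‖) := by rw [pow_add]; ring
    _ ≤ K * C := by gcongr; exact hC n

theorem RapidDecay.deriv {a : ℝ} {c : ℤ → ℂ} (hc : RapidDecay c) :
    RapidDecay (fun n => I * n / a * c n) := by
  refine hc.of_le (K := |a|⁻¹) (j := 1) (fun n => ?_) (by positivity)
  rw [norm_mul, norm_div, norm_mul, norm_I, one_mul, norm_intCast, norm_real, Real.norm_eq_abs,
    div_eq_inv_mul, pow_one]
  gcongr
  linarith

theorem RapidDecay.summable_synth {c : ℤ → ℂ} (hc : RapidDecay c) (a x : ℝ) :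
    Summable (fun n => c n * emode a n x) := by
  refine Summable.of_norm ?_
  simpa [norm_emode] using hc.summable

theorem hasDerivAt_synth {a : ℝ} {c : ℤ → ℂ} (hc : RapidDecay c) (x : ℝ) :
    HasDerivAt (synth a c) (synth a (fun n => I * n / a * c n) x) x := by
  have h0 := hc.summable_synth a 0
  refine hasDerivAt_tsum (g := fun n y => c n * emode a n y)
    (g' := fun n y => I * n / a * c n * emode a n y) (y₀ := 0)
    (u := fun n => ‖I * n / a * c n‖) (hc.deriv (a := a)).summable
    (fun n y => ?_) (fun n y => ?_) h0 x
  · exact ((hasDerivAt_emode a n y).const_mul (c n)).congr_deriv (by ring)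
  · rw [norm_mul, norm_emode, mul_one]

theorem deriv_synth {a : ℝ} {c : ℤ → ℂ} (hc : RapidDecay c) :
    deriv (synth a c) = synth a (fun n => I * n / a * c n) :=
  funext fun x => (hasDerivAt_synth hc x).deriv

theorem smoothPer_synth {a : ℝ} (ha : 0 < a) {c : ℤ → ℂ} (hc : RapidDecay c) :
    SmoothPer a (synth a c) := by
  constructor
  · rw [contDiff_infty]
    intro n
    induction n generalizing c with
    | zero =>
      exact contDiff_zero.2
        (continuous_iff_continuousAt.2 fun x => (hasDerivAt_synth hc x).continuousAt)
    | succ n ih =>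
      rw [Nat.cast_succ, contDiff_succ_iff_deriv]
      refine ⟨fun x => (hasDerivAt_synth hc x).differentiableAt, by simp, ?_⟩
      rw [deriv_synth hc]
      exact ih hc.deriv
  · intro x
    simp [synth, emode_periodic ha _ x]

/-- The convolution theorem: the trigonometric series is integrated term by term against `f`,
dominated by `C ‖c n‖` on one period. -/
theorem hasSum_fcoef_mul {a : ℝ} (ha : 0 < a) {c : ℤ → ℂ} (hc : RapidDecay c) {f : ℝ → ℂ}
    (hf : Continuous f) (m : ℤ) :
    HasSum (fun n => fcoef a (m - n) f * c n) (fcoef a m (fun x => f x * synth a c x)) := by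
  have hT : (0 : ℝ) ≤ 2 * Real.pi * a := by have := Real.pi_pos; positivity
  obtain ⟨C, hC⟩ := (isCompact_Icc (a := (0 : ℝ)) (b := 2 * Real.pi * a)).exists_bound_of_continuousOn
    hf.continuousOn
  have h := intervalIntegral.hasSum_integral_of_dominated_convergence (a := 0)
    (b := 2 * Real.pi * a) (μ := volume)
    (F := fun (n : ℤ) x => emode a (-m) x * (f x * (c n * emode a n x)))
    (f := fun x => emode a (-m) x * (f x * synth a c x))
    (fun n _ => C * ‖c n‖) (fun n => ?_) (fun n => ?_) ?_ ?_ ?_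
  · rw [fcoef_eq]
    refine (h.mul_left (1 / (2 * Real.pi * a : ℂ))).congr_fun fun n => ?_
    rw [fcoef_eq, mul_comm, mul_left_comm, ← intervalIntegral.integral_const_mul]
    congr 2; ext x
    rw [show -(m - n) = -m + n by ring, ← emode_mul]; ring
  · have := continuous_emode a (-m)
    have := continuous_emode a n
    exact (by fun_prop : Continuous _).aestronglyMeasurable
  · refine Eventually.of_forall fun x hx => ?_
    rw [Set.uIoc_of_le hT] at hx
    simp only [norm_mul, norm_emode, one_mul, mul_one]
    gcongr
    exact hC x ⟨hx.1.le, hx.2⟩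
  · exact Eventually.of_forall fun x _ => hc.summable.mul_left C
  · simp
  · exact Eventually.of_forall fun x _ => ((hc.summable_synth a x).hasSum.mul_left _).mul_left _

theorem fcoef_synth {a : ℝ} (ha : 0 < a) {c : ℤ → ℂ} (hc : RapidDecay c) (m : ℤ) :
    fcoef a m (synth a c) = c m := by
  have h := hasSum_fcoef_mul ha hc (f := fun _ => 1) continuous_const m
  simp only [one_mul] at h
  have e : ∀ n, fcoef a n (fun _ => (1 : ℂ)) = if n = 0 then 1 else 0 := by
    intro n
    have := fcoef_emode ha n 0
    rw [show emode a 0 = fun _ => (1 : ℂ) from funext (emode_zero a)] at this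
    rw [this]; simp [eq_comm]
  refine h.unique ?_
  convert hasSum_ite_eq m (c m) using 1
  ext n
  rw [e]
  by_cases hn : n = m
  · simp [hn]
  · rw [if_neg (by omega), if_neg hn, zero_mul]

theorem fcoef_eq_fourierCoeff {a : ℝ} [hT : Fact (0 < 2 * Real.pi * a)] (n : ℤ)
    (f : AddCircle (2 * Real.pi * a) → ℂ) :
    fourierCoeff f n = fcoef a n (fun x => f x) := by
  rw [fourierCoeff_eq_intervalIntegral f n 0, fcoef_eq, zero_add, real_smul]
  congr 1
  · push_cast; ring
  · congr 1; ext x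
    rw [fourier_coe_apply, smul_eq_mul, emode]
    congr 2
    have ha : (a : ℂ) ≠ 0 := by
      rintro h
      have h' : a = 0 := by exact_mod_cast h
      simpa [h'] using hT.out
    have : (Real.pi : ℂ) ≠ 0 := by exact_mod_cast Real.pi_ne_zero
    push_cast; field_simp

/-- A continuous periodic function as a function on the circle. -/
def toCircleFun {a : ℝ} {E : Type*} [TopologicalSpace E] (f : ℝ → E) (hf : Continuous f)
    (hp : Function.Periodic f (2 * Real.pi * a)) : C(AddCircle (2 * Real.pi * a), E) where
  toFun := hp.lift
  continuous_toFun := continuous_coinduced_dom.mpr hf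

theorem toCircleFun_coe {a : ℝ} {E : Type*} [TopologicalSpace E] (f : ℝ → E) (hf : Continuous f)
    (hp : Function.Periodic f (2 * Real.pi * a)) (x : ℝ) :
    toCircleFun f hf hp (x : AddCircle (2 * Real.pi * a)) = f x := rfl

/-- The coefficients of a smooth function are absolutely summable, so its Fourier series converges
to it at every point. -/
theorem synth_fcoef {a : ℝ} (ha : 0 < a) {f : ℝ → ℂ} (hf : SmoothPer a f) :
    synth a (fun n => fcoef a n f) = f := by
  have hT : (0 : ℝ) < 2 * Real.pi * a := by have := Real.pi_pos; positivity
  have := Fact.mk hT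
  ext x
  have e : fourierCoeff (toCircleFun f hf.continuous hf.2) = fun n => fcoef a n f := by
    ext n; rw [fcoef_eq_fourierCoeff]; rfl
  have h := has_pointwise_sum_fourier_series_of_summable
    (f := toCircleFun f hf.continuous hf.2) (by
      rw [e]; exact (rapidDecay_fcoef ha hf).summable.of_norm) (x : AddCircle (2 * Real.pi * a))
  rw [e, toCircleFun_coe] at h
  rw [← h.tsum_eq]
  refine tsum_congr fun n => ?_
  rw [smul_eq_mul, fourier_coe_apply, emode]
  congr 2
  have ha' : (a : ℂ) ≠ 0 := by exact_mod_cast ha.ne'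
  have : (Real.pi : ℂ) ≠ 0 := by exact_mod_cast Real.pi_ne_zero
  push_cast; field_simp

theorem SmoothPer.ext_fcoef {a : ℝ} (ha : 0 < a) {f g : ℝ → ℂ} (hf : SmoothPer a f)
    (hg : SmoothPer a g) (h : ∀ n, fcoef a n f = fcoef a n g) : f = g := by
  rw [← synth_fcoef ha hf, ← synth_fcoef ha hg]
  simp_rw [h]

theorem hasSum_fcoef_mul' {a : ℝ} (ha : 0 < a) {f g : ℝ → ℂ} (hf : Continuous f)
    (hg : SmoothPer a g) (m : ℤ) :
    HasSum (fun n => fcoef a (m - n) f * fcoef a n g) (fcoef a m (fun x => f x * g x)) := by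
  have := hasSum_fcoef_mul ha (rapidDecay_fcoef ha hg) hf m
  rwa [synth_fcoef ha hg] at this

theorem fcoef_zero_eq (a : ℝ) (f : ℝ → ℂ) :
    fcoef a 0 f = 1 / (2 * Real.pi * a : ℂ) * ∫ x in (0 : ℝ)..(2 * Real.pi * a), f x := by
  rw [fcoef_eq]; simp [emode_zero]

theorem integral_eq_fcoef_zero {a : ℝ} (ha : 0 < a) (f : ℝ → ℂ) :
    ∫ x in (0 : ℝ)..(2 * Real.pi * a), f x = 2 * Real.pi * a * fcoef a 0 f := by
  rw [fcoef_zero_eq, ← mul_assoc, mul_one_div_cancel (two_pi_a_ne ha), one_mul]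

end

section

/-! ### The function `f_{-3/2}` and the second-order term -/

theorem fFun_neg_three_halves (z : ℝ) (hz : -4 < z) : fFun (-3 / 2) z = 4 / (z + 4) := by
  have hA : (0 : ℝ) < 1 + z / 4 := by linarith
  have hpos : ∀ x ∈ Set.Icc (0 : ℝ) 1, 0 < 1 + (1 - x ^ 2) / 4 * z := by
    rintro x ⟨h0, h1⟩
    have h2 : x ^ 2 ≤ 1 := by nlinarith
    rcases le_or_gt 0 z with h | h
    · have := mul_nonneg (sub_nonneg.2 h2) h
      linarith
    · have := mul_nonneg (sq_nonneg x) (neg_nonneg.2 h.le)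
      linarith
  -- With `u = 1 + (1 - x²) z / 4`, the derivative of `x u^(-1/2)` is `u^(-3/2) (u + x² z / 4)`, and
  -- `u + x² z / 4 = 1 + z / 4` does not depend on `x`.
  have hd : ∀ x ∈ Set.uIcc (0 : ℝ) 1,
      HasDerivAt (fun x : ℝ => x * (1 + (1 - x ^ 2) / 4 * z) ^ (-1 / 2 : ℝ) / (1 + z / 4))
        ((1 + (1 - x ^ 2) / 4 * z) ^ (-3 / 2 : ℝ)) x := by
    intro x hx
    rw [Set.uIcc_of_le zero_le_one] at hx
    have hp := hpos x hx
    have h1 : HasDerivAt (fun x : ℝ => 1 + (1 - x ^ 2) / 4 * z) (-x / 2 * z) x := by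
      have := ((((hasDerivAt_pow 2 x).const_sub 1).div_const 4).mul_const z).const_add 1
      refine this.congr_deriv ?_
      push_cast; ring
    have h2 := h1.rpow_const (p := (-1 / 2 : ℝ)) (Or.inl hp.ne')
    have h3 := ((hasDerivAt_id x).mul h2).div_const (1 + z / 4)
    refine h3.congr_deriv ?_
    simp only [id]
    rw [show (-1 / 2 : ℝ) - 1 = -3 / 2 by norm_num, show (-1 / 2 : ℝ) = -3 / 2 + 1 by norm_num,
      Real.rpow_add_one hp.ne', div_eq_iff hA.ne']
    ring
  have hc : ContinuousOn (fun x : ℝ => (1 + (1 - x ^ 2) / 4 * z) ^ (-3 / 2 : ℝ))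
      (Set.uIcc 0 1) := by
    rw [Set.uIcc_of_le zero_le_one]
    exact ContinuousOn.rpow_const (by fun_prop) fun x hx => Or.inl (hpos x hx).ne'
  rw [fFun, intervalIntegral.integral_eq_sub_of_hasDerivAt hd hc.intervalIntegrable]
  have : z + 4 ≠ 0 := by linarith
  norm_num
  field_simp
  rw [add_comm, div_self (by linarith)]

/-- The eigenvalue of `-D²` on `e^{inx/a}`. -/
def freq (a : ℝ) (n : ℤ) : ℝ := (n : ℝ) / a

/-- The squared Hilbert–Schmidt norm of the Fourier coefficient of index `n`. -/
def hsCoef {N : ℕ} (a : ℝ) (Q : ℝ → Matrix (Fin N) (Fin N) ℂ) (n : ℤ) : ℝ :=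
  ∑ i, ∑ j, ‖fourierCoef a Q n i j‖ ^ 2

theorem hsCoef_nonneg {N : ℕ} (a : ℝ) (Q : ℝ → Matrix (Fin N) (Fin N) ℂ) (n : ℤ) :
    0 ≤ hsCoef a Q n := by unfold hsCoef; positivity

theorem SmoothPeriodic.entry {N : ℕ} {a : ℝ} {P : ℝ → Matrix (Fin N) (Fin N) ℂ}
    (h : SmoothPeriodic a P) (i j) : SmoothPer a (fun x => P x i j) :=
  ⟨h.1 i j, fun x => by simp [h.2 x]⟩

theorem IsPotential.entry {N : ℕ} {a : ℝ} {Q : ℝ → Matrix (Fin N) (Fin N) ℂ}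
    (h : IsPotential a Q) (i j) : SmoothPer a (fun x => Q x i j) := h.1.entry i j

theorem IsPotential.conj_entry {N : ℕ} {a : ℝ} {Q : ℝ → Matrix (Fin N) (Fin N) ℂ}
    (h : IsPotential a Q) (x i j) : (starRingEnd ℂ) (Q x i j) = Q x j i := by
  have := congrFun (congrFun (h.2 x) j) i
  simpa [Matrix.conjTranspose_apply] using this

theorem IsPotential.fcoef_neg {N : ℕ} {a : ℝ} {Q : ℝ → Matrix (Fin N) (Fin N) ℂ}
    (h : IsPotential a Q) (n : ℤ) (i j) :
    fcoef a (-n) (fun x => Q x i j) = (starRingEnd ℂ) (fourierCoef a Q n j i) := by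
  rw [fourierCoef_apply, ← neg_neg n, ← fcoef_conj, neg_neg]
  simp_rw [h.conj_entry]

/-- Parseval for a Fourier multiplier `w`. Hermitian symmetry makes the coefficient of index `-n`
the adjoint of the one of index `n`, so the trace of their product is a squared Hilbert–Schmidt
norm. -/
theorem hasSum_fcoef_trace {N : ℕ} {a : ℝ} (ha : 0 < a) {Q F : ℝ → Matrix (Fin N) (Fin N) ℂ}
    (hQ : IsPotential a Q) (hF : ∀ i j, SmoothPer a (fun x => F x i j)) {w : ℤ → ℝ}
    (hw : ∀ n i j, fcoef a n (fun x => F x i j) = w n * fourierCoef a Q n i j) :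
    HasSum (fun n => ((w n * hsCoef a Q n : ℝ) : ℂ)) (fcoef a 0 (fun x => (Q x * F x).trace)) := by
  have e : (fun x => (Q x * F x).trace) = fun x => ∑ i, ∑ j, Q x i j * F x j i := by
    ext x; simp [Matrix.trace, Matrix.mul_apply]
  rw [e, fcoef_sum _ _ (fun i => (SmoothPer.sum _ fun j =>
    (hQ.entry i j).mul (hF j i)).continuous)]
  have h : HasSum (fun n => ∑ i, ∑ j, fcoef a (0 - n) (fun x => Q x i j) *
      fcoef a n (fun x => F x j i)) (∑ i, fcoef a 0 fun x => ∑ j, Q x i j * F x j i) := by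
    refine hasSum_sum fun i _ => ?_
    rw [fcoef_sum _ _ (fun j => ((hQ.entry i j).mul (hF j i)).continuous)]
    exact hasSum_sum fun j _ => hasSum_fcoef_mul' ha (hQ.entry i j).continuous (hF j i) 0
  refine h.congr_fun fun n => ?_
  simp_rw [zero_sub, hQ.fcoef_neg, hw]
  rw [hsCoef, Finset.sum_comm, ofReal_mul, ofReal_sum, Finset.mul_sum]
  refine Finset.sum_congr rfl fun i _ => ?_
  rw [ofReal_sum, Finset.mul_sum]
  refine Finset.sum_congr rfl fun j _ => ?_
  rw [mul_left_comm, conj_mul']; push_cast; rfl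

theorem hasSum_hsCoef {N : ℕ} {a : ℝ} (ha : 0 < a) {Q : ℝ → Matrix (Fin N) (Fin N) ℂ}
    (hQ : IsPotential a Q) :
    HasSum (fun n => (hsCoef a Q n : ℂ)) (fcoef a 0 (fun x => (Q x * Q x).trace)) := by
  simpa using hasSum_fcoef_trace ha hQ hQ.entry (w := fun _ => 1) (by simp [fourierCoef_apply])

theorem summable_hsCoef {N : ℕ} {a : ℝ} (ha : 0 < a) {Q : ℝ → Matrix (Fin N) (Fin N) ℂ}
    (hQ : IsPotential a Q) : Summable (hsCoef a Q) := by
  exact_mod_cast (hasSum_hsCoef ha hQ).summable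

theorem RapidDecay.mul_bounded {c : ℤ → ℂ} (hc : RapidDecay c) {w : ℤ → ℝ} {K : ℝ}
    (hw : ∀ n, |w n| ≤ K) : RapidDecay (fun n => (w n : ℂ) * c n) := by
  refine hc.of_le (K := K) (j := 0) (fun n => ?_) ((abs_nonneg _).trans (hw 0))
  rw [norm_mul, norm_real, pow_zero, mul_one]
  gcongr; exact hw n

/-- The symbol of `(-D² - 4 λ)⁻¹`. -/
def resolventSymbol (a lam : ℝ) (n : ℤ) : ℝ := (freq a n ^ 2 - 4 * lam)⁻¹

theorem resolventSymbol_pos {lam : ℝ} (hl : lam < 0) (a : ℝ) (n : ℤ) :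
    0 < resolventSymbol a lam n := by
  unfold resolventSymbol; have := sq_nonneg (freq a n); apply inv_pos.2; linarith

theorem resolventSymbol_mul {lam : ℝ} (hl : lam < 0) (a : ℝ) (n : ℤ) :
    resolventSymbol a lam n * (freq a n ^ 2 - 4 * lam) = 1 := by
  have := sq_nonneg (freq a n)
  exact inv_mul_cancel₀ (by linarith)

theorem resolventSymbol_le {lam : ℝ} (hl : lam < 0) (a : ℝ) (n : ℤ) :
    resolventSymbol a lam n ≤ (-4 * lam)⁻¹ := by
  unfold resolventSymbol; have := sq_nonneg (freq a n)
  apply inv_anti₀ <;> linarith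

/-- The function `(-D² - 4 λ)⁻¹ Q`. -/
def freeResolvent {N : ℕ} (a lam : ℝ) (Q : ℝ → Matrix (Fin N) (Fin N) ℂ) :
    ℝ → Matrix (Fin N) (Fin N) ℂ :=
  fun x => Matrix.of fun i j =>
    synth a (fun n => (resolventSymbol a lam n : ℂ) * fourierCoef a Q n i j) x

section

variable {N : ℕ} {a lam : ℝ} {Q : ℝ → Matrix (Fin N) (Fin N) ℂ}

theorem IsPotential.rapidDecay (ha : 0 < a) (hQ : IsPotential a Q) (i j) :
    RapidDecay (fun n => fourierCoef a Q n i j) := rapidDecay_fcoef ha (hQ.entry i j)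

theorem rapidDecay_resolvent (ha : 0 < a) (hl : lam < 0) (hQ : IsPotential a Q) (i j) :
    RapidDecay (fun n => (resolventSymbol a lam n : ℂ) * fourierCoef a Q n i j) :=
  (hQ.rapidDecay ha i j).mul_bounded (K := (-4 * lam)⁻¹) fun n => by
    rw [abs_of_pos (resolventSymbol_pos hl a n)]; exact resolventSymbol_le hl a n

/-- The equation multiplies the `n`-th coefficient of `P` by `ξ² - 4λ > 0`, hence determines it.
Uniqueness of `P` and the trace formula for `γ` both rest on this. -/
theorem fcoef_of_isFreeResolvent (ha : 0 < a) (hl : lam < 0)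
    {P : ℝ → Matrix (Fin N) (Fin N) ℂ} (hP : IsFreeResolvent a lam Q P) (n : ℤ) (i j) :
    fcoef a n (fun x => P x i j) = resolventSymbol a lam n * fourierCoef a Q n i j := by
  have hs := hP.1.entry i j
  have e : (fun x => Q x i j) = fun x => -(deriv (deriv fun y => P y i j) x)
      + -(4 * (lam : ℂ)) * P x i j := by
    ext x; rw [← hP.2 x i j]; ring
  have h : fourierCoef a Q n i j = (((n : ℂ) / a) ^ 2 - 4 * lam) * fcoef a n (fun x => P x i j) := by
    rw [fourierCoef_apply, e, fcoef_add n (hs.deriv.deriv.neg).continuous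
      (hs.const_mul _).continuous, fcoef_const_mul, fcoef_neg, fcoef_deriv2 ha n hs]
    ring
  rw [h, ← mul_assoc]
  have h2 : (resolventSymbol a lam n : ℂ) * (((n : ℂ) / a) ^ 2 - 4 * lam) = 1 := by
    have : resolventSymbol a lam n * (freq a n ^ 2 - 4 * lam) = 1 :=
      resolventSymbol_mul hl a n
    have h3 := congrArg ((↑) : ℝ → ℂ) this
    simpa [freq] using h3
  rw [h2, one_mul]

theorem isFreeResolvent_freeResolvent (ha : 0 < a) (hl : lam < 0) (hQ : IsPotential a Q) :
    IsFreeResolvent a lam Q (freeResolvent a lam Q) := by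
  have hs : ∀ i j, SmoothPer a (fun x => freeResolvent a lam Q x i j) := fun i j =>
    smoothPer_synth ha (rapidDecay_resolvent ha hl hQ i j)
  refine ⟨⟨fun i j => (hs i j).1, fun x => ?_⟩, fun x i j => ?_⟩
  · ext i j; exact (hs i j).2 x
  · have h1 : SmoothPer a (fun x => -(deriv (deriv fun y => freeResolvent a lam Q y i j) x)
      + -(4 * (lam : ℂ)) * freeResolvent a lam Q x i j) :=
      (hs i j).deriv.deriv.neg.add ((hs i j).const_mul _)
    have h2 := SmoothPer.ext_fcoef ha h1 (hQ.entry i j) fun n => by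
      rw [fcoef_add n (hs i j).deriv.deriv.neg.continuous
        ((hs i j).const_mul _).continuous, fcoef_const_mul, CircleDet.fcoef_neg,
        fcoef_deriv2 ha n (hs i j)]
      have : fcoef a n (fun x => freeResolvent a lam Q x i j)
          = resolventSymbol a lam n * fourierCoef a Q n i j :=
        fcoef_synth ha (rapidDecay_resolvent ha hl hQ i j) n
      rw [this, fourierCoef_apply]
      have h2 : (resolventSymbol a lam n : ℂ) * (((n : ℂ) / a) ^ 2 - 4 * lam) = 1 := by
        have : resolventSymbol a lam n * (freq a n ^ 2 - 4 * lam) = 1 :=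
          resolventSymbol_mul hl a n
        have h3 := congrArg ((↑) : ℝ → ℂ) this
        simpa [freq] using h3
      linear_combination fcoef a n (fun x => Q x i j) * h2
    have := congrFun h2 x
    rw [← this]; ring

theorem existsUnique_isFreeResolvent (ha : 0 < a) (hl : lam < 0) (hQ : IsPotential a Q) :
    ∃! P, IsFreeResolvent a lam Q P := by
  refine ⟨_, isFreeResolvent_freeResolvent ha hl hQ, fun P hP => ?_⟩
  have hf := isFreeResolvent_freeResolvent ha hl hQ
  ext x i j
  refine congrFun (SmoothPer.ext_fcoef ha (hP.1.entry i j) (hf.1.entry i j) fun n => ?_) x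
  rw [fcoef_of_isFreeResolvent ha hl hP, fcoef_of_isFreeResolvent ha hl hf]

theorem funLaplacian_eq (ha : 0 < a) (hl : lam < 0) (hQ : IsPotential a Q) (x : ℝ) :
    funLaplacian a (fun y => fFun (-3 / 2) (y / lam)) Q x
      = ((-4 * lam : ℝ) : ℂ) • freeResolvent a lam Q x := by
  -- The argument `z = -ξ²/λ` is nonnegative and `4/(z + 4) = -4λ/(ξ² - 4λ)`. The factor `-4λ` later
  -- turns the prefactor `1/(8 (-λ)^(3/2))` into `1/(2 (-λ)^(1/2))`.
  have e : ∀ n : ℤ, (fFun (-3 / 2) (-((n : ℝ) / a) ^ 2 / lam) : ℝ)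
      = -4 * lam * resolventSymbol a lam n := by
    intro n
    have h0 : 0 ≤ -((n : ℝ) / a) ^ 2 / lam :=
      div_nonneg_of_nonpos (by have := sq_nonneg ((n : ℝ) / a); linarith) hl.le
    rw [fFun_neg_three_halves _ (by linarith), resolventSymbol, freq]
    have h1 : 0 < ((n : ℝ) / a) ^ 2 - 4 * lam := by
      have := sq_nonneg ((n : ℝ) / a); linarith
    have h2 : -((n : ℝ) / a) ^ 2 / lam + 4 ≠ 0 := by linarith
    rw [div_eq_iff h2]
    generalize ((n : ℝ) / a) ^ 2 = y at *
    have : y - 4 * lam ≠ 0 := h1.ne'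
    have := hl.ne
    field_simp
    ring
  ext i j
  have hr := (rapidDecay_resolvent ha hl hQ i j).summable_synth a x
  have hs : ∀ i j, HasSum (fun n : ℤ => (((fFun (-3 / 2) (-((n : ℝ) / a) ^ 2 / lam) : ℝ) : ℂ)
      * exp (I * n * x / a)) • fourierCoef a Q n i j)
      (((-4 * lam : ℝ) : ℂ) * freeResolvent a lam Q x i j) := by
    intro i j
    refine (((rapidDecay_resolvent ha hl hQ i j).summable_synth a x).hasSum.mul_left
      ((-4 * lam : ℝ) : ℂ)).congr_fun fun n => ?_
    rw [e, emode, smul_eq_mul]; push_cast; ring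
  have hm : HasSum (fun n : ℤ => (((fFun (-3 / 2) (-((n : ℝ) / a) ^ 2 / lam) : ℝ) : ℂ)
      * exp (I * n * x / a)) • fourierCoef a Q n)
      (((-4 * lam : ℝ) : ℂ) • freeResolvent a lam Q x) :=
    Pi.hasSum.2 fun i => Pi.hasSum.2 fun j => hs i j
  exact congrFun (congrFun hm.tsum_eq i) j

theorem neg_rpow_three_halves (hl : lam < 0) :
    (-lam) ^ (3 / 2 : ℝ) = (-lam) * (-lam) ^ (1 / 2 : ℝ) := by
  rw [show (3 / 2 : ℝ) = 1 + 1 / 2 by norm_num, Real.rpow_add (by linarith), Real.rpow_one]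

theorem gammaFun_eq_freeResolvent (ha : 0 < a) (hl : lam < 0) (hQ : IsPotential a Q) :
    gammaFun a Q lam =
      1 / (2 * ((-lam) ^ (1 / 2 : ℝ) : ℝ) : ℂ) *
          (∫ x in (0 : ℝ)..(2 * Real.pi * a), (Q x).trace)
        - 1 / (2 * ((-lam) ^ (1 / 2 : ℝ) : ℝ) : ℂ) *
          (∫ x in (0 : ℝ)..(2 * Real.pi * a), (Q x * freeResolvent a lam Q x).trace) := by
  rw [gammaFun]
  simp_rw [funLaplacian_eq ha hl hQ, Matrix.mul_smul, Matrix.trace_smul, smul_eq_mul]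
  rw [intervalIntegral.integral_const_mul, neg_rpow_three_halves hl, ← mul_assoc]
  congr 2
  have h1 : (((-lam) ^ (1 / 2 : ℝ) : ℝ) : ℂ) ≠ 0 := by
    exact_mod_cast (Real.rpow_pos_of_pos (by linarith) _).ne'
  have h2 : (lam : ℂ) ≠ 0 := by exact_mod_cast hl.ne
  push_cast
  field_simp
  norm_num

theorem gammaFun_eq_of_isFreeResolvent (ha : 0 < a) (hl : lam < 0) (hQ : IsPotential a Q)
    {P : ℝ → Matrix (Fin N) (Fin N) ℂ} (hP : IsFreeResolvent a lam Q P) :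
    gammaFun a Q lam =
      1 / (2 * ((-lam) ^ (1 / 2 : ℝ) : ℝ) : ℂ) *
          (∫ x in (0 : ℝ)..(2 * Real.pi * a), (Q x).trace)
        - 1 / (2 * ((-lam) ^ (1 / 2 : ℝ) : ℝ) : ℂ) *
          (∫ x in (0 : ℝ)..(2 * Real.pi * a), (Q x * P x).trace) := by
  rw [(existsUnique_isFreeResolvent ha hl hQ).unique hP (isFreeResolvent_freeResolvent ha hl hQ)]
  exact gammaFun_eq_freeResolvent ha hl hQ

/-- The Fourier form of `γ`, ready for comparison with the lattice sums of the second-order trace.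
-/
theorem gammaFun_eq_tsum (ha : 0 < a) (hl : lam < 0) (hQ : IsPotential a Q) :
    gammaFun a Q lam = (Real.pi * a / ((-lam) ^ (1 / 2 : ℝ) : ℝ) : ℂ) *
      ((fourierCoef a Q 0).trace - ((∑' n, resolventSymbol a lam n * hsCoef a Q n : ℝ) : ℂ)) := by
  have hf := isFreeResolvent_freeResolvent ha hl hQ
  have h := hasSum_fcoef_trace ha hQ hf.1.entry (fcoef_of_isFreeResolvent ha hl hf)
  have h2 : fcoef a 0 (fun x => (Q x).trace) = (fourierCoef a Q 0).trace := by
    simp only [Matrix.trace, Matrix.diag]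
    rw [fcoef_sum _ _ fun i => (hQ.entry i i).continuous]
    rfl
  rw [gammaFun_eq_freeResolvent ha hl hQ, integral_eq_fcoef_zero ha, integral_eq_fcoef_zero ha,
    ofReal_tsum, h.tsum_eq, h2]
  have h1 : (((-lam) ^ (1 / 2 : ℝ) : ℝ) : ℂ) ≠ 0 := by
    exact_mod_cast (Real.rpow_pos_of_pos (by linarith) _).ne'
  field_simp

end

end

section

/-! ### Lattice sums -/

theorem HasSum.of_eq {ι E : Type*} [AddCommMonoid E] [TopologicalSpace E] {f g : ι → E} {s t : E}
    (h : HasSum f s) (hs : s = t) (hf : ∀ i, g i = f i) : HasSum g t := by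
  rw [← hs, funext hf]; exact h

/-- `coth (π y)`, written in terms of `e^{-2 π y}`. -/
def cothPi (y : ℝ) : ℝ :=
  (1 + Real.exp (-(2 * Real.pi * y))) / (1 - Real.exp (-(2 * Real.pi * y)))

theorem exp_neg_two_pi_lt_one {y : ℝ} (hy : 0 < y) : Real.exp (-(2 * Real.pi * y)) < 1 := by
  rw [Real.exp_lt_one_iff]; have := Real.pi_pos; have : 0 < 2 * Real.pi * y := by positivity
  linarith

theorem cothPi_sub_one {y : ℝ} (hy : 0 < y) : cothPi y - 1 =
    2 * Real.exp (-(2 * Real.pi * y)) / (1 - Real.exp (-(2 * Real.pi * y))) := by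
  have := exp_neg_two_pi_lt_one hy
  rw [cothPi, div_sub_one (by linarith)]; congr 1; ring

theorem cot_pi_mul_I (y : ℝ) : Complex.cot (Real.pi * (I * y)) = -I * cothPi y := by
  rw [Complex.cot_pi_eq_exp_ratio, cothPi]
  have : (2 * Real.pi * I * (I * y) : ℂ) = ((-(2 * Real.pi * y) : ℝ) : ℂ) := by
    push_cast; linear_combination (2 * Real.pi * y : ℂ) * I_mul_I
  rw [this]
  push_cast
  rw [div_mul_eq_div_div, div_I]
  ring

theorem I_mul_mem_integerComplement {y : ℝ} (hy : 0 < y) : (I * y : ℂ) ∈ Complex.integerComplement := by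
  rintro ⟨n, hn⟩
  have := congrArg Complex.im hn
  simp at this
  exact hy.ne this

theorem hasSum_int_of_even {f : ℤ → ℝ} (he : ∀ n, f (-n) = f n) {s : ℝ}
    (h : HasSum (fun n : ℕ => f ((n : ℤ) + 1)) s) : HasSum f (f 0 + 2 * s) := by
  have h1 : HasSum (fun n : ℕ => f n) (f 0 + s) := by
    have := (hasSum_nat_add_iff (f := fun n : ℕ => f n) 1).1 (by simpa using h)
    simpa [add_comm] using this
  have h2 : HasSum (fun n : ℕ => f (-((n : ℤ) + 1))) s := by simpa only [he] using h
  exact HasSum.of_eq (HasSum.of_nat_of_neg_add_one h1 h2) (by ring) fun _ => rfl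

/-- The Mittag-Leffler expansion of `π cot πz` at `z = iy`, where `cot(iπy) = -i coth(πy)`. -/
theorem hasSum_inv_sq_add_sq {y : ℝ} (hy : 0 < y) :
    HasSum (fun n : ℤ => ((n : ℝ) ^ 2 + y ^ 2)⁻¹) (Real.pi * cothPi y / y) := by
  have hz := I_mul_mem_integerComplement hy
  have hyc : (y : ℂ) ≠ 0 := by exact_mod_cast hy.ne'
  have h1 := (summable_cotTerm hz).hasSum
  rw [show (∑' n, cotTerm (I * y) n) = _ from (cot_series_rep' hz).symm, cot_pi_mul_I] at h1
  have h2 : HasSum (fun n : ℕ => ((((n : ℤ) + 1 : ℤ) : ℝ) ^ 2 + y ^ 2)⁻¹)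
      ((Real.pi * cothPi y - 1 / y) / (2 * y)) := by
    rw [← Complex.hasSum_ofReal]
    have h3 := h1.mul_left (I / (2 * y))
    have e : (I / (2 * y) * (Real.pi * (-I * cothPi y) - 1 / (I * y)) : ℂ)
        = (((Real.pi * cothPi y - 1 / y) / (2 * y) : ℝ) : ℂ) := by
      push_cast
      have := I_ne_zero
      field_simp
      linear_combination (-(Real.pi * cothPi y * y : ℂ)) * I_sq
    rw [← e]
    refine h3.congr_fun fun n => ?_
    have hn : ((n : ℂ) + 1) ^ 2 + y ^ 2 ≠ 0 := by
      have : (0 : ℝ) < ((n : ℝ) + 1) ^ 2 + y ^ 2 := by positivity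
      exact_mod_cast this.ne'
    have hf : (I * y - (n + 1) : ℂ) * (I * y + (n + 1)) = -(((n : ℂ) + 1) ^ 2 + y ^ 2) := by
      linear_combination (y : ℂ) ^ 2 * I_sq
    have hz1 : (I * y - (n + 1) : ℂ) ≠ 0 := by
      rintro h; rw [h, zero_mul] at hf; exact hn (by linear_combination hf)
    have hz2 : (I * y + (n + 1) : ℂ) ≠ 0 := by
      rintro h; rw [h, mul_zero] at hf; exact hn (by linear_combination hf)
    rw [cotTerm, div_add_div _ _ hz1 hz2, hf]
    push_cast
    field_simp
    linear_combination (2 * y : ℂ) * I_sq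
  refine HasSum.of_eq (hasSum_int_of_even (f := fun n : ℤ => ((n : ℝ) ^ 2 + y ^ 2)⁻¹)
    (by simp) h2) ?_ fun _ => rfl
  simp only [Int.cast_zero]
  field_simp
  ring

theorem summable_inv_sq_add_sq {y : ℝ} (hy : 0 < y) :
    Summable (fun n : ℤ => ((n : ℝ) ^ 2 + y ^ 2)⁻¹) := (hasSum_inv_sq_add_sq hy).summable

/-- The exponentially small part of `∑ (n² + y²)⁻²`. -/
def expTail (y : ℝ) : ℝ :=
  Real.pi / y ^ 2 * (2 * Real.pi * Real.exp (-(2 * Real.pi * y)) /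
    (1 - Real.exp (-(2 * Real.pi * y))) ^ 2 +
      Real.exp (-(2 * Real.pi * y)) / (1 - Real.exp (-(2 * Real.pi * y))) / y)

/-- Obtained by differentiating the previous sum in `y`, each term contributing `-2y (n² + y²)⁻²`.
The power `π/(2y³)` comes from the part `π/y` of `π coth(πy)/y`, and the rest is exponentially
small. -/
theorem hasSum_inv_sq_add_sq_sq {y : ℝ} (hy : 0 < y) :
    HasSum (fun n : ℤ => (((n : ℝ) ^ 2 + y ^ 2)⁻¹) ^ 2)
      (Real.pi / (2 * y ^ 3) + expTail y) := by
  set δ := y / 2 with hδ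
  have hδ0 : 0 < δ := by positivity
  have hd : HasDerivAt (fun z => ∑' n : ℤ, ((n : ℝ) ^ 2 + z ^ 2)⁻¹)
      (∑' n : ℤ, -(2 * y) * (((n : ℝ) ^ 2 + y ^ 2)⁻¹) ^ 2) y := by
    -- Keeping `z` above `δ = y/2` gives a summable bound on the derivatives that is independent of
    -- `z`.
    refine hasDerivAt_tsum_of_isPreconnected (t := Set.Ioi δ) (y₀ := y)
      (g := fun (n : ℤ) z => ((n : ℝ) ^ 2 + z ^ 2)⁻¹)
      (g' := fun (n : ℤ) z => -(2 * z) * (((n : ℝ) ^ 2 + z ^ 2)⁻¹) ^ 2)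
      (u := fun n : ℤ => 2 / δ * ((n : ℝ) ^ 2 + δ ^ 2)⁻¹)
      ((summable_inv_sq_add_sq hδ0).mul_left _) isOpen_Ioi isPreconnected_Ioi
      (fun n z hz => ?_) (fun n z hz => ?_) (by simp [hδ]; linarith) (summable_inv_sq_add_sq hy)
      (by simp [hδ]; linarith)
    · have hz0 : 0 < z := hδ0.trans hz
      have hp : (n : ℝ) ^ 2 + z ^ 2 ≠ 0 := by positivity
      refine (((hasDerivAt_pow 2 z).const_add _).inv hp).congr_deriv ?_
      field_simp
      simp [mul_comm]
    · have hz0 : 0 < z := hδ0.trans hz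
      have hz' : δ ≤ z := le_of_lt hz
      rw [norm_mul, norm_neg, Real.norm_of_nonneg (by positivity),
        Real.norm_of_nonneg (by positivity), sq]
      calc 2 * z * (((n : ℝ) ^ 2 + z ^ 2)⁻¹ * ((n : ℝ) ^ 2 + z ^ 2)⁻¹)
          ≤ 2 * z * ((z ^ 2)⁻¹ * ((n : ℝ) ^ 2 + δ ^ 2)⁻¹) := by
            gcongr
            have := sq_nonneg (n : ℝ); linarith
        _ = 2 / z * ((n : ℝ) ^ 2 + δ ^ 2)⁻¹ := by field_simp
        _ ≤ _ := by gcongr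
  have he : (fun z => ∑' n : ℤ, ((n : ℝ) ^ 2 + z ^ 2)⁻¹) =ᶠ[𝓝 y]
      fun z => Real.pi * cothPi z / z := by
    filter_upwards [lt_mem_nhds hy] with z hz
    exact (hasSum_inv_sq_add_sq hz).tsum_eq
  have hq := exp_neg_two_pi_lt_one hy
  have hd2 : HasDerivAt (fun z => Real.pi * cothPi z / z)
      (-(2 * y) * (Real.pi / (2 * y ^ 3) + expTail y)) y := by
    have e1 : HasDerivAt (fun z : ℝ => Real.exp (-(2 * Real.pi * z)))
        (Real.exp (-(2 * Real.pi * y)) * -(2 * Real.pi)) y := by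
      have := (((hasDerivAt_id y).const_mul (2 * Real.pi)).neg).exp
      simpa using this
    have e2 := (e1.const_add 1).div (e1.const_sub 1) (by linarith)
    have e3 := (e2.const_mul Real.pi).div (hasDerivAt_id y) hy.ne'
    refine e3.congr_deriv ?_
    unfold expTail
    simp only [id, Pi.div_apply]
    generalize Real.exp (-(2 * Real.pi * y)) = q at *
    have : 1 - q ≠ 0 := by linarith
    field_simp
    ring
  have key := (hd2.congr_of_eventuallyEq he).unique hd
  rw [tsum_mul_left] at key
  have hs : Summable (fun n : ℤ => (((n : ℝ) ^ 2 + y ^ 2)⁻¹) ^ 2) := by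
    refine Summable.of_nonneg_of_le (fun _ => by positivity) (fun n => ?_)
      ((summable_inv_sq_add_sq hy).mul_left (y ^ 2)⁻¹)
    rw [sq]
    gcongr
    have := sq_nonneg (n : ℝ); linarith
  have h2 := mul_left_cancel₀ (by linarith : -(2 * y) ≠ 0) key
  rw [h2]
  exact hs.hasSum

theorem hasSum_telescope_one {h : ℤ → ℝ} (hs : Summable fun n => h (n + 1) - h n)
    (h1 : Tendsto (fun n : ℕ => h n) atTop (𝓝 0)) (h2 : Tendsto (fun n : ℕ => h (-n)) atTop (𝓝 0)) :
    HasSum (fun n => h (n + 1) - h n) 0 := by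
  have s1 : HasSum (fun n : ℕ => h ((n : ℤ) + 1) - h n) (0 - h 0) := by
    have hs1 : Summable (fun n : ℕ => h ((n : ℤ) + 1) - h n) :=
      hs.comp_injective (i := fun n : ℕ => (n : ℤ)) Nat.cast_injective
    refine hs1.hasSum_iff_tendsto_nat.2 ?_
    have := h1.sub_const (h 0)
    refine this.congr fun n => ?_
    have := Finset.sum_range_sub (fun n : ℕ => h n) n
    simpa using this.symm
  have s2 : HasSum (fun n : ℕ => h (-((n : ℤ) + 1) + 1) - h (-((n : ℤ) + 1))) (h 0 - 0) := by
    have hs2 : Summable (fun n : ℕ => h (-((n : ℤ) + 1) + 1) - h (-((n : ℤ) + 1))) :=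
      hs.comp_injective (i := fun n : ℕ => -((n : ℤ) + 1)) (fun m n e => by simpa using e)
    refine hs2.hasSum_iff_tendsto_nat.2 ?_
    refine (h2.const_sub (h 0)).congr fun n => ?_
    have := Finset.sum_range_sub' (fun n : ℕ => h (-(n : ℤ))) n
    simp only [Nat.cast_zero, neg_zero] at this
    rw [← this]
    refine Finset.sum_congr rfl fun i _ => ?_
    push_cast
    rw [show -((i : ℤ) + 1) + 1 = -i by ring]
  have := HasSum.of_nat_of_neg_add_one (f := fun n => h (n + 1) - h n) s1 s2
  simpa using this

theorem hasSum_telescope {h : ℤ → ℝ} (h0 : HasSum (fun n => h (n + 1) - h n) 0) (m : ℤ) :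
    HasSum (fun n => h (n + m) - h n) 0 := by
  induction m with
  | zero => simp
  | succ m ih =>
    have := ((Equiv.addRight (m : ℤ)).hasSum_iff.2 h0).add ih
    rw [add_zero] at this
    refine this.congr_fun fun n => ?_
    simp [add_assoc]
  | pred m ih =>
    have := ih.sub ((Equiv.addRight (-(m : ℤ) - 1)).hasSum_iff.2 h0)
    rw [sub_zero] at this
    refine this.congr_fun fun n => ?_
    simp only [Equiv.coe_addRight, Function.comp]
    rw [show n + (-(m : ℤ) - 1) + 1 = n + -m by ring]; ring

/-- The last difference compares one function `u/(u² + y²)` at points `m` apart, so it telescopes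
away over the lattice and leaves `(m² + 4y²)⁻¹` times two copies of the basic sum. This is the
origin of the `4λ` in `(-D² - 4λ)⁻¹`. -/
theorem partial_fraction {u v y m : ℝ} (hy : 0 < y) (hm : m ≠ 0) (hv : v = u + m) :
    (u ^ 2 + y ^ 2)⁻¹ * (v ^ 2 + y ^ 2)⁻¹ = (m ^ 2 + 4 * y ^ 2)⁻¹ *
      ((u ^ 2 + y ^ 2)⁻¹ + (v ^ 2 + y ^ 2)⁻¹
        + 2 / m * (v / (v ^ 2 + y ^ 2) - u / (u ^ 2 + y ^ 2))) := by
  have h1 : u ^ 2 + y ^ 2 ≠ 0 := by positivity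
  have h2 : v ^ 2 + y ^ 2 ≠ 0 := by positivity
  have h3 : m ^ 2 + 4 * y ^ 2 ≠ 0 := by positivity
  rw [show (u ^ 2 + y ^ 2)⁻¹ + (v ^ 2 + y ^ 2)⁻¹ + 2 / m * (v / (v ^ 2 + y ^ 2) - u / (u ^ 2 + y ^ 2))
    = (m ^ 2 + 4 * y ^ 2) * ((u ^ 2 + y ^ 2)⁻¹ * (v ^ 2 + y ^ 2)⁻¹) by
      field_simp; subst hv; ring, inv_mul_cancel_left₀ h3]

theorem summable_shift_mul {y : ℝ} (hy : 0 < y) (m : ℤ) :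
    Summable (fun n : ℤ => ((n : ℝ) ^ 2 + y ^ 2)⁻¹ * (((n + m : ℤ) : ℝ) ^ 2 + y ^ 2)⁻¹) := by
  refine Summable.of_nonneg_of_le (fun _ => by positivity) (fun n => ?_)
    ((summable_inv_sq_add_sq hy).mul_right (y ^ 2)⁻¹)
  gcongr
  have := sq_nonneg ((n + m : ℤ) : ℝ); linarith

theorem hasSum_shift_mul {y : ℝ} (hy : 0 < y) {m : ℤ} (hm : m ≠ 0) :
    HasSum (fun n : ℤ => ((n : ℝ) ^ 2 + y ^ 2)⁻¹ * (((n + m : ℤ) : ℝ) ^ 2 + y ^ 2)⁻¹)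
      (cothPi y * (2 * Real.pi / y) * ((m : ℝ) ^ 2 + 4 * y ^ 2)⁻¹) := by
  set h : ℤ → ℝ := fun n => n / ((n : ℝ) ^ 2 + y ^ 2) with hh
  have shift : ∀ m : ℤ, HasSum (fun n : ℤ => (((n + m : ℤ) : ℝ) ^ 2 + y ^ 2)⁻¹)
      (Real.pi * cothPi y / y) := fun m =>
    (Equiv.addRight m).hasSum_iff.2 (hasSum_inv_sq_add_sq hy)
  -- The function `h` decays only like `1/n`. The partial fraction identity with shift one, solved
  -- for the difference, expresses it through summable series.
  have hsum : Summable fun n => h (n + 1) - h n := by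
    have e : (fun n => h (n + 1) - h n) = fun n : ℤ => (1 / 2 : ℝ) * ((1 + 4 * y ^ 2) *
      (((n : ℝ) ^ 2 + y ^ 2)⁻¹ * (((n + 1 : ℤ) : ℝ) ^ 2 + y ^ 2)⁻¹)
        - ((n : ℝ) ^ 2 + y ^ 2)⁻¹ - (((n + 1 : ℤ) : ℝ) ^ 2 + y ^ 2)⁻¹) := by
      ext n
      rw [partial_fraction hy one_ne_zero (show ((n + 1 : ℤ) : ℝ) = n + 1 by push_cast; ring)]
      have : (1 : ℝ) ^ 2 + 4 * y ^ 2 ≠ 0 := by positivity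
      rw [show (1 : ℝ) + 4 * y ^ 2 = 1 ^ 2 + 4 * y ^ 2 by ring, mul_inv_cancel_left₀ this, hh]
      ring
    rw [e]
    exact ((((summable_shift_mul hy 1).mul_left _).sub (summable_inv_sq_add_sq hy)).sub
      (shift 1).summable).mul_left _
  have hle : ∀ n : ℤ, |h n| ≤ 1 / |(n : ℝ)| := by
    intro n
    rcases eq_or_ne n 0 with rfl | hn
    · simp [hh]
    have hn' : (0 : ℝ) < |(n : ℝ)| := abs_pos.2 (by exact_mod_cast hn)
    rw [hh]
    simp only
    rw [abs_div, abs_of_pos (by positivity : 0 < (n : ℝ) ^ 2 + y ^ 2),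
      div_le_div_iff₀ (by positivity) hn', one_mul, ← sq, sq_abs]
    have := sq_nonneg y; linarith
  have ht := tendsto_one_div_atTop_nhds_zero_nat (𝕜 := ℝ)
  have h0 := hasSum_telescope_one hsum
    (squeeze_zero_norm (fun n => by simpa using hle n) ht)
    (squeeze_zero_norm (fun n => by simpa using hle (-n)) ht)
  have hm' : (m : ℝ) ≠ 0 := by exact_mod_cast hm
  have key := ((((hasSum_inv_sq_add_sq hy).add (shift m)).add
    ((hasSum_telescope h0 m).mul_left (2 / (m : ℝ))))).mul_left ((m : ℝ) ^ 2 + 4 * y ^ 2)⁻¹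
  exact HasSum.of_eq key (by ring) fun n => partial_fraction hy hm' (by push_cast; ring)

/-! ### The free resolvent on the Fourier side -/

/-- The symbol of `(-D² + w)⁻¹`. -/
def symb (a w : ℝ) (n : ℤ) : ℝ := (freq a n ^ 2 + w)⁻¹

section

variable {a w : ℝ}

theorem symb_pos (hw : 0 < w) (n : ℤ) : 0 < symb a w n := by unfold symb; positivity

theorem symb_le (hw : 0 < w) (n : ℤ) : symb a w n ≤ w⁻¹ := by
  unfold symb; gcongr; have := sq_nonneg (freq a n); linarith

theorem symb_eq (ha : 0 < a) {k : ℝ} (n : ℤ) :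
    symb a (k ^ 2) n = a ^ 2 * ((n : ℝ) ^ 2 + (a * k) ^ 2)⁻¹ := by
  rw [symb, freq, ← inv_inv (a ^ 2), ← mul_inv]
  congr 1; field_simp

theorem hasSum_symb (ha : 0 < a) {k : ℝ} (hk : 0 < k) :
    HasSum (symb a (k ^ 2)) (Real.pi * a / k * cothPi (a * k)) := by
  simp_rw [funext fun n => symb_eq ha (k := k) n]
  refine HasSum.of_eq ((hasSum_inv_sq_add_sq (mul_pos ha hk)).mul_left (a ^ 2)) ?_ fun _ => rfl
  field_simp

theorem summable_symb (ha : 0 < a) (hw : 0 < w) : Summable (symb a w) := by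
  have := hasSum_symb ha (Real.sqrt_pos.2 hw)
  rw [Real.sq_sqrt hw.le] at this
  exact this.summable

theorem hasSum_symb_mul_shift (ha : 0 < a) {k : ℝ} (hk : 0 < k) {m : ℤ} (hm : m ≠ 0) :
    HasSum (fun n => symb a (k ^ 2) n * symb a (k ^ 2) (n + m))
      (cothPi (a * k) * (2 * Real.pi * a / k) * resolventSymbol a (-k ^ 2) m) := by
  simp_rw [funext fun n => symb_eq ha (k := k) n]
  have e : cothPi (a * k) * (2 * Real.pi * a / k) * resolventSymbol a (-k ^ 2) m =
      a ^ 4 * (cothPi (a * k) * (2 * Real.pi / (a * k)) * ((m : ℝ) ^ 2 + 4 * (a * k) ^ 2)⁻¹) := by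
    have : resolventSymbol a (-k ^ 2) m = a ^ 2 * ((m : ℝ) ^ 2 + 4 * (a * k) ^ 2)⁻¹ := by
      rw [resolventSymbol, freq, ← inv_inv (a ^ 2), ← mul_inv]
      congr 1; field_simp; ring
    rw [this]; field_simp
  rw [e]
  exact ((hasSum_shift_mul (mul_pos ha hk) hm).mul_left (a ^ 4)).congr_fun fun n => by ring

/-- The zero shift is excluded from the partial fractions, which divide by `m`. Its leading part is
the general formula with the factor `coth` replaced by one. -/
theorem hasSum_symb_sq (ha : 0 < a) {k : ℝ} (hk : 0 < k) :
    HasSum (fun n => symb a (k ^ 2) n ^ 2)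
      ((2 * Real.pi * a / k) * resolventSymbol a (-k ^ 2) 0 + a ^ 4 * expTail (a * k)) := by
  simp_rw [funext fun n => symb_eq ha (k := k) n]
  refine HasSum.of_eq ((hasSum_inv_sq_add_sq_sq (mul_pos ha hk)).mul_left (a ^ 4)) ?_
    fun n => by ring
  rw [mul_add]; congr 1
  simp only [resolventSymbol, freq]
  norm_num
  field_simp
  norm_num

end

end

section

/-! ### Diagonal operators -/

section Diagonal

variable {ι H : Type*} [NormedAddCommGroup H] [InnerProductSpace ℂ H]

/-- Multiplication of a square-summable sequence by a bounded real sequence. -/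
def lpMul (g : ι → ℝ) (hg : ∃ C, ∀ i, |g i| ≤ C) (f : lp (fun _ : ι => ℂ) 2) :
    lp (fun _ : ι => ℂ) 2 :=
  ⟨fun i => (g i : ℂ) * f i, by
    obtain ⟨C, hC⟩ := hg
    refine memℓp_gen ?_
    have h := (lp.memℓp f).summable (by norm_num)
    refine Summable.of_nonneg_of_le (fun i => by positivity) (fun i => ?_) (h.mul_left (C ^ 2))
    simp only [ENNReal.toReal_ofNat, Real.rpow_ofNat, norm_mul, norm_real, Real.norm_eq_abs, mul_pow]
    gcongr
    exact hC i⟩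

theorem norm_lpMul_le (g : ι → ℝ) {C : ℝ} (hC0 : 0 ≤ C) (hC : ∀ i, |g i| ≤ C)
    (f : lp (fun _ : ι => ℂ) 2) : ‖lpMul g ⟨C, hC⟩ f‖ ≤ C * ‖f‖ := by
  have h := lp.norm_mono (p := 2) (by norm_num) (x := lpMul g ⟨C, hC⟩ f) (y := (C : ℂ) • f)
    (fun i => by
      rw [lp.coeFn_smul, Pi.smul_apply, norm_smul, norm_real, Real.norm_of_nonneg hC0]
      simp only [lpMul, norm_mul, norm_real, Real.norm_eq_abs]
      gcongr; exact hC i)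
  rwa [norm_smul, norm_real, Real.norm_of_nonneg hC0] at h

/-- The operator which is diagonal in the basis `b`, with eigenvalues `g`. -/
def diagOp (b : HilbertBasis ι ℂ H) (g : ι → ℝ) (hg : ∃ C, ∀ i, |g i| ≤ C) : H →L[ℂ] H :=
  LinearMap.mkContinuousOfExistsBound
    { toFun := fun x => b.repr.symm (lpMul g hg (b.repr x))
      map_add' := fun x y => by
        rw [← map_add]; congr 1; ext i
        rw [lp.coeFn_add, Pi.add_apply]; simp [lpMul, mul_add]
      map_smul' := fun c x => by
        rw [RingHom.id_apply, ← map_smul]; congr 1; ext i; simp [lpMul, mul_left_comm] }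
    (by
      obtain ⟨C, hC⟩ := hg
      refine ⟨max C 0, fun x => ?_⟩
      have := norm_lpMul_le g (le_max_right C 0) (fun i => (hC i).trans (le_max_left _ _)) (b.repr x)
      simpa using this)

variable (b : HilbertBasis ι ℂ H) {g : ι → ℝ} (hg : ∃ C, ∀ i, |g i| ≤ C)

theorem repr_diagOp (x : H) (i : ι) : b.repr (diagOp b g hg x) i = g i * b.repr x i := by
  change b.repr (b.repr.symm (lpMul g hg (b.repr x))) i = _
  rw [LinearIsometryEquiv.apply_symm_apply]; rfl

theorem inner_diagOp (x : H) (i : ι) : ⟪b i, diagOp b g hg x⟫ = g i * ⟪b i, x⟫ := by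
  rw [← b.repr_apply_apply, repr_diagOp, b.repr_apply_apply]

theorem HilbertBasis.ext_inner (b : HilbertBasis ι ℂ H) {x y : H}
    (h : ∀ i, ⟪b i, x⟫ = ⟪b i, y⟫) : x = y := by
  apply b.repr.injective
  ext i
  rw [b.repr_apply_apply, b.repr_apply_apply, h]

theorem norm_diagOp_le {C : ℝ} (hC0 : 0 ≤ C) (hC : ∀ i, |g i| ≤ C) : ‖diagOp b g hg‖ ≤ C := by
  refine ContinuousLinearMap.opNorm_le_bound _ hC0 fun x => ?_
  change ‖b.repr.symm (lpMul g hg (b.repr x))‖ ≤ _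
  have := norm_lpMul_le g hC0 hC (b.repr x)
  simpa using this

theorem inner_diagOp_left (x : H) (i : ι) : ⟪diagOp b g hg x, b i⟫ = g i * ⟪x, b i⟫ := by
  rw [← inner_conj_symm, inner_diagOp, map_mul, inner_conj_symm, conj_ofReal]

theorem diagOp_symm (x y : H) : ⟪diagOp b g hg x, y⟫ = ⟪x, diagOp b g hg y⟫ := by
  rw [← b.tsum_inner_mul_inner, ← b.tsum_inner_mul_inner]
  refine tsum_congr fun i => ?_
  rw [inner_diagOp, inner_diagOp_left]; ring

theorem diagOp_basis (i : ι) : diagOp b g hg (b i) = (g i : ℂ) • b i := by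
  refine HilbertBasis.ext_inner b fun j => ?_
  rw [inner_diagOp, inner_smul_right]
  rcases eq_or_ne j i with rfl | h
  · rfl
  · rw [b.orthonormal.2 h, mul_zero, mul_zero]

theorem isCompactOperator_rankOne (u v : H) :
    IsCompactOperator (fun x : H => ⟪u, x⟫ • v) := by
  have h : IsCompactOperator (innerSL ℂ u) :=
    isCompactOperator_of_locallyCompactSpace_dom (innerSL ℂ u)
  exact h.clm_comp (ContinuousLinearMap.toSpanSingleton ℂ v)

/-- The finite truncations have finite rank, and the error is a diagonal operator whose norm is at
most the supremum of the remaining entries, which tend to zero. -/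
theorem isCompactOperator_diagOp [CompleteSpace H] (h0 : Tendsto g cofinite (𝓝 0)) :
    IsCompactOperator (diagOp b g hg) := by
  classical
  let F : Finset ι → H →L[ℂ] H := fun s =>
    ∑ i ∈ s, (g i : ℂ) • (ContinuousLinearMap.toSpanSingleton ℂ (b i) ∘L innerSL ℂ (b i))
  have hF : ∀ s x i, ⟪b i, F s x⟫ = if i ∈ s then g i * ⟪b i, x⟫ else 0 := by
    intro s x i
    have : F s x = ∑ j ∈ s, (g j : ℂ) • ⟪b j, x⟫ • b j := by
      simp [F]
    rw [this, inner_sum]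
    simp_rw [inner_smul_right, orthonormal_iff_ite.1 b.orthonormal i]
    simp
  have hc : ∀ s, IsCompactOperator (F s) := fun s =>
    Submodule.sum_mem (compactOperator (RingHom.id ℂ) H H) fun i _ =>
      Submodule.smul_mem _ _ (isCompactOperator_rankOne (b i) (b i))
  refine isCompactOperator_of_tendsto (l := atTop) (F := F) ?_ (Eventually.of_forall hc)
  rw [tendsto_iff_norm_sub_tendsto_zero, Metric.tendsto_atTop]
  intro ε hε
  have hfin := (Metric.tendsto_nhds.1 h0 (ε / 2) (by positivity))
  rw [eventually_cofinite] at hfin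
  refine ⟨hfin.toFinset, fun s hs => ?_⟩
  rw [dist_zero_right, norm_norm]
  refine lt_of_le_of_lt (?_ : _ ≤ ε / 2) (by linarith)
  have hb : ∀ i, |if i ∈ s then 0 else -g i| ≤ ε / 2 := by
    intro i
    split_ifs with hi
    · simp; positivity
    · rw [abs_neg]
      by_contra hcon
      apply hi
      apply hs
      simp only [Set.Finite.mem_toFinset, Set.mem_ofPred_eq, Real.dist_0_eq_abs]
      linarith
  have e : F s - diagOp b g hg = diagOp b (fun i => if i ∈ s then 0 else -g i) ⟨_, hb⟩ := by
    ext1 x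
    refine HilbertBasis.ext_inner b fun i => ?_
    rw [sub_apply, inner_sub_right, hF, inner_diagOp, inner_diagOp]
    split_ifs <;> simp
  rw [e]
  exact norm_diagOp_le b _ (by positivity) hb

end Diagonal

/-! ### Perturbed resolvents in a Banach algebra -/

section Perturbed

variable {A : Type*} [NormedRing A] [CompleteSpace A]

/-- The perturbed resolvent `(1 + G V)⁻¹ G = (G⁻¹ + V)⁻¹`. -/
def perturbed (G V : A) : A := Ring.inverse (1 + G * V) * G

variable {G V : A}

theorem isUnit_one_add_of_norm_lt {X : A} (h : ‖X‖ < 1) : IsUnit (1 + X) := by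
  have := isUnit_one_sub_of_norm_lt_one (x := -X) (by simpa using h)
  simpa using this

theorem perturbed_left (h : ‖G * V‖ < 1) : (1 + G * V) * perturbed G V = G := by
  rw [perturbed, ← mul_assoc, Ring.mul_inverse_cancel _ (isUnit_one_add_of_norm_lt h), one_mul]

theorem perturbed_eq (h : ‖G * V‖ < 1) : perturbed G V = G - G * V * perturbed G V := by
  have := perturbed_left h
  rw [add_mul, one_mul] at this
  exact eq_sub_of_add_eq this

theorem perturbed_right (h : ‖G * V‖ < 1) : perturbed G V * (1 + V * G) = G := by
  rw [perturbed, mul_assoc, show G * (1 + V * G) = (1 + G * V) * G by noncomm_ring, ← mul_assoc,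
    Ring.inverse_mul_cancel _ (isUnit_one_add_of_norm_lt h), one_mul]

theorem perturbed_eq' (h : ‖G * V‖ < 1) : perturbed G V = G - perturbed G V * V * G := by
  have := perturbed_right h
  rw [mul_add, mul_one, ← mul_assoc] at this
  exact eq_sub_of_add_eq this

/-- Expanding on the left, then on the right, then on the left again leaves a factor `G` at both
ends of the remainder. Its diagonal entries therefore carry `g_n²`, which is summable in `n` and
integrable in `w`. -/
theorem perturbed_third_order (h : ‖G * V‖ < 1) : perturbed G V =
    G - G * V * G + G * V * G * V * G - G * V * G * V * perturbed G V * V * G := by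
  conv_lhs => rw [perturbed_eq h, perturbed_eq' h, perturbed_eq h]
  noncomm_ring

theorem norm_perturbed_le (h : ‖G * V‖ ≤ 1 / 2) : ‖perturbed G V‖ ≤ 2 * ‖G‖ := by
  have h1 := perturbed_eq (lt_of_le_of_lt h (by norm_num))
  have h2 : ‖perturbed G V‖ ≤ ‖G‖ + ‖G * V‖ * ‖perturbed G V‖ := by
    conv_lhs => rw [h1]
    exact (norm_sub_le _ _).trans (by gcongr; exact norm_mul_le _ _)
  nlinarith [norm_nonneg (perturbed G V)]

/-- Taking the adjoint of the left equation shows that `B*` solves the same equation `X (1 + VG) =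
G` as `B`, and `1 + VG` is invertible. -/
theorem isSelfAdjoint_perturbed [StarRing A] (hG : IsSelfAdjoint G) (hV : IsSelfAdjoint V)
    (h : ‖G * V‖ < 1) (h' : ‖V * G‖ < 1) : IsSelfAdjoint (perturbed G V) := by
  have h1 := congrArg star (perturbed_left h)
  rw [star_mul, star_add, star_one, star_mul, hG.star_eq, hV.star_eq] at h1
  have h2 := perturbed_right h
  exact (isUnit_one_add_of_norm_lt h').mul_right_cancel (h1.trans h2.symm)

end Perturbed

end

section

/-! ### The Hilbert space of the circle -/

section Space

variable (N : ℕ) (a : ℝ) [hT : Fact (0 < 2 * Real.pi * a)]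

/-- Square-integrable functions on the circle with values in `ℂ^N`. -/
abbrev CircleL2 : Type :=
  Lp (EuclideanSpace ℂ (Fin N)) 2 (haarAddCircle (T := 2 * Real.pi * a))

variable {N a}

omit hT in
theorem pos_of_fact (h : Fact (0 < 2 * Real.pi * a)) : 0 < a := by
  have := h.out
  have := Real.pi_pos
  by_contra h'
  have : 2 * Real.pi * a ≤ 0 := mul_nonpos_of_nonneg_of_nonpos (by positivity) (by linarith)
  linarith

/-- Continuous functions as elements of `L²`. -/
def contL2 (f : C(AddCircle (2 * Real.pi * a), EuclideanSpace ℂ (Fin N))) : CircleL2 N a :=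
  ContinuousMap.toLp 2 haarAddCircle ℂ f

theorem contL2_ae (f : C(AddCircle (2 * Real.pi * a), EuclideanSpace ℂ (Fin N))) :
    contL2 f =ᵐ[haarAddCircle] f := ContinuousMap.coeFn_toLp _ _

/-- The vector-valued exponential. -/
def expVec (p : ℤ × Fin N) : C(AddCircle (2 * Real.pi * a), EuclideanSpace ℂ (Fin N)) where
  toFun x := fourier p.1 x • EuclideanSpace.single p.2 (1 : ℂ)
  continuous_toFun := (fourier p.1).continuous.smul continuous_const

theorem inner_expVec (p : ℤ × Fin N) (f : CircleL2 N a) :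
    ⟪contL2 (expVec p), f⟫ = fourierCoeff (fun x => f x p.2) p.1 := by
  rw [L2.inner_def, fourierCoeff]
  refine integral_congr_ae ?_
  filter_upwards [contL2_ae (expVec (a := a) p)] with x hx
  rw [hx]
  simp only [expVec, ContinuousMap.coe_mk]
  rw [inner_smul_left, EuclideanSpace.inner_single_left, fourier_neg, smul_eq_mul]
  simp

theorem coe_contL2_apply (f : C(AddCircle (2 * Real.pi * a), EuclideanSpace ℂ (Fin N)))
    (n : ℤ) (i : Fin N) : fourierCoeff (fun x => contL2 f x i) n = fourierCoeff (fun x => f x i) n := by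
  apply congrFun
  apply fourierCoeff_congr_ae
  filter_upwards [contL2_ae f] with x hx
  rw [hx]

theorem orthonormal_expVec :
    Orthonormal ℂ (fun p : ℤ × Fin N => (contL2 (expVec p) : CircleL2 N a)) := by
  rw [orthonormal_iff_ite]
  rintro ⟨n, i⟩ ⟨m, j⟩
  rw [inner_expVec, coe_contL2_apply]
  have e : (fun x => (expVec (m, j) x).ofLp i) =
      fun x => (if i = j then (1 : ℂ) else 0) * fourier (T := 2 * Real.pi * a) m x := by
    ext x
    simp only [expVec, ContinuousMap.coe_mk, PiLp.smul_apply, smul_eq_mul, PiLp.single_apply]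
    rw [mul_comm]
  simp only
  rw [e, fourierCoeff.const_mul, fourierCoeff_fourier]
  simp only [Pi.single_apply, Prod.mk.injEq, ite_and]
  split_ifs <;> simp

/-- Each component of `f` is a scalar square-integrable function all of whose Fourier coefficients
vanish. -/
theorem expVec_complete (f : CircleL2 N a)
    (h : ∀ p, ⟪(contL2 (expVec p) : CircleL2 N a), f⟫ = 0) : f = 0 := by
  have hi : ∀ i : Fin N, (fun x => f x i) =ᵐ[haarAddCircle] 0 := by
    intro i
    set g : Lp ℂ 2 (haarAddCircle (T := 2 * Real.pi * a)) :=
      (EuclideanSpace.proj (𝕜 := ℂ) i).compLp f with hg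
    have hgf : g =ᵐ[haarAddCircle] fun x => f x i :=
      (EuclideanSpace.proj (𝕜 := ℂ) i).coeFn_compLp f
    have hg0 : g = 0 := by
      apply fourierBasis.repr.injective
      ext n
      rw [fourierBasis_repr, fourierCoeff_congr_ae hgf]
      have := h (n, i)
      rw [inner_expVec] at this
      simpa using this
    rw [hg0] at hgf
    exact hgf.symm.trans (Lp.coeFn_zero _ _ _)
  apply Lp.ext
  have := ae_all_iff.2 hi
  filter_upwards [this, Lp.coeFn_zero (EuclideanSpace ℂ (Fin N)) 2
    (haarAddCircle (T := 2 * Real.pi * a))] with x hx h0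
  rw [h0]
  ext i
  simpa using hx i

/-- The Fourier basis of `L²(S¹, ℂ^N)`. -/
def circleBasis (N : ℕ) (a : ℝ) [Fact (0 < 2 * Real.pi * a)] :
    HilbertBasis (ℤ × Fin N) ℂ (CircleL2 N a) :=
  HilbertBasis.mkOfOrthogonalEqBot orthonormal_expVec (by
    rw [Submodule.eq_bot_iff]
    intro f hf
    refine expVec_complete f fun p => ?_
    exact (Submodule.mem_orthogonal _ _).1 hf _ (Submodule.subset_span ⟨p, rfl⟩))

theorem circleBasis_apply (p : ℤ × Fin N) :
    circleBasis N a p = contL2 (expVec p) := by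
  rw [circleBasis, HilbertBasis.coe_mkOfOrthogonalEqBot]

/-! ### Smooth vector-valued functions -/

/-- Smooth periodic functions with values in `ℂ^N`. -/
def smoothVec (N : ℕ) (a : ℝ) : Submodule ℂ (ℝ → Fin N → ℂ) where
  carrier := {φ | ∀ i, SmoothPer a (fun x => φ x i)}
  zero_mem' := fun _ => SmoothPer.const a 0
  add_mem' := fun h k i => (h i).add (k i)
  smul_mem' := fun c _ h i => (h i).const_mul c

omit hT in
theorem smoothVec_continuous {φ : ℝ → Fin N → ℂ} (h : φ ∈ smoothVec N a) :
    Continuous (fun x => WithLp.toLp 2 (φ x) : ℝ → EuclideanSpace ℂ (Fin N)) :=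
  (PiLp.continuous_toLp 2 _).comp (continuous_pi fun i => (h i).continuous)

omit hT in
theorem smoothVec_periodic {φ : ℝ → Fin N → ℂ} (h : φ ∈ smoothVec N a) :
    Function.Periodic (fun x => WithLp.toLp 2 (φ x) : ℝ → EuclideanSpace ℂ (Fin N))
      (2 * Real.pi * a) := fun x => by
  have : φ (x + 2 * Real.pi * a) = φ x := funext fun i => (h i).2 x
  simp only [this]

/-- The embedding of smooth functions into `L²`. -/
def smoothL2 : smoothVec N a →ₗ[ℂ] CircleL2 N a where
  toFun φ := contL2 (toCircleFun _ (smoothVec_continuous φ.2) (smoothVec_periodic φ.2))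
  map_add' φ ψ := by
    unfold contL2
    rw [← map_add]; congr 1; ext x
    induction x using QuotientAddGroup.induction_on with
    | H x => rfl
  map_smul' c φ := by
    unfold contL2
    rw [RingHom.id_apply, ← map_smul]; congr 1; ext x
    induction x using QuotientAddGroup.induction_on with
    | H x => rfl

theorem inner_circleBasis_smoothL2 (φ : smoothVec N a) (n : ℤ) (i : Fin N) :
    ⟪circleBasis N a (n, i), smoothL2 φ⟫ = fcoef a n (fun x => φ.1 x i) := by
  rw [circleBasis_apply, inner_expVec]
  change fourierCoeff (fun x => contL2 _ x i) n = _
  rw [coe_contL2_apply, fcoef_eq_fourierCoeff]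
  rfl

theorem smoothL2_injective : Function.Injective (smoothL2 : smoothVec N a → CircleL2 N a) := by
  intro φ ψ h
  apply Subtype.ext
  ext x i
  refine congrFun (SmoothPer.ext_fcoef (pos_of_fact hT) (φ.2 i) (ψ.2 i) fun n => ?_) x
  rw [← inner_circleBasis_smoothL2, h, inner_circleBasis_smoothL2]

theorem norm_smoothL2_le {φ : smoothVec N a} {C : ℝ} (hC : 0 ≤ C)
    (h : ∀ x, ‖(WithLp.toLp 2 (φ.1 x) : EuclideanSpace ℂ (Fin N))‖ ≤ C) : ‖smoothL2 φ‖ ≤ C := by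
  have := Lp.norm_le_of_ae_bound (f := (smoothL2 φ : CircleL2 N a)) hC (by
    filter_upwards [contL2_ae (toCircleFun _ (smoothVec_continuous φ.2)
      (smoothVec_periodic φ.2))] with x hx
    change ‖(contL2 _ : CircleL2 N a) x‖ ≤ C
    rw [hx]
    induction x using QuotientAddGroup.induction_on with
    | H x => exact h x)
  simpa [measureUnivNNReal] using this

/-- The function `e^{inx/a} v_i`. -/
def expSmooth (hT : Fact (0 < 2 * Real.pi * a)) (n : ℤ) (i : Fin N) : smoothVec N a :=
  ⟨fun x => Pi.single i (emode a n x), fun j => by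
    rcases eq_or_ne j i with rfl | h
    · simpa using smoothPer_emode (pos_of_fact hT) n
    · simpa [h] using SmoothPer.const a 0⟩

theorem smoothL2_expSmooth (n : ℤ) (i : Fin N) :
    smoothL2 (expSmooth hT n i) = circleBasis N a (n, i) := by
  refine HilbertBasis.ext_inner (circleBasis N a) fun ⟨m, j⟩ => ?_
  rw [inner_circleBasis_smoothL2, orthonormal_iff_ite.1 (circleBasis N a).orthonormal]
  rcases eq_or_ne j i with rfl | h
  · simp [expSmooth, fcoef_emode (pos_of_fact hT), eq_comm]
  · simp [expSmooth, h, fcoef]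

/-! ### Multiplication by the potential -/

variable {Q : ℝ → Matrix (Fin N) (Fin N) ℂ}

omit hT in
theorem IsPotential.continuous_clm (hQ : IsPotential a Q) :
    Continuous (fun x => Matrix.toEuclideanCLM (n := Fin N) (𝕜 := ℂ) (Q x)) := by
  have h : Continuous Q := continuous_pi fun i => continuous_pi fun j => (hQ.entry i j).continuous
  exact (LinearMap.continuous_of_finiteDimensional
    (Matrix.toEuclideanCLM (n := Fin N) (𝕜 := ℂ)).toAlgEquiv.toLinearMap).comp h

omit hT in
theorem IsPotential.periodic_clm (hQ : IsPotential a Q) :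
    Function.Periodic (fun x => Matrix.toEuclideanCLM (n := Fin N) (𝕜 := ℂ) (Q x))
      (2 * Real.pi * a) := fun x => by simp [hQ.1.2 x]

/-- The potential as a continuous function on the circle. -/
def potFun (hQ : IsPotential a Q) : C(AddCircle (2 * Real.pi * a),
    EuclideanSpace ℂ (Fin N) →L[ℂ] EuclideanSpace ℂ (Fin N)) :=
  toCircleFun _ hQ.continuous_clm hQ.periodic_clm

/-- Multiplication by the potential. -/
def potOp (hQ : IsPotential a Q) : CircleL2 N a →L[ℂ] CircleL2 N a :=
  (ContinuousLinearMap.id ℂ (EuclideanSpace ℂ (Fin N) →L[ℂ] EuclideanSpace ℂ (Fin N))).holderL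
    haarAddCircle ⊤ 2 2 (ContinuousMap.toLp ⊤ haarAddCircle ℂ (potFun hQ))

theorem potOp_ae (hQ : IsPotential a Q) (f : CircleL2 N a) :
    potOp hQ f =ᵐ[haarAddCircle] fun x => potFun hQ x (f x) := by
  have h1 := ContinuousLinearMap.coeFn_holder (r := 2)
    (ContinuousLinearMap.id ℂ (EuclideanSpace ℂ (Fin N) →L[ℂ] EuclideanSpace ℂ (Fin N)))
    (ContinuousMap.toLp ⊤ haarAddCircle ℂ (potFun hQ)) f
  have h2 := ContinuousMap.coeFn_toLp (p := ⊤) (𝕜 := ℂ) haarAddCircle (potFun hQ)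
  filter_upwards [h1, h2] with x hx hx2
  rw [hx2] at hx
  exact hx

theorem norm_potOp_le (hQ : IsPotential a Q) {C : ℝ} (hC : 0 ≤ C)
    (h : ∀ x, ‖Matrix.toEuclideanCLM (n := Fin N) (𝕜 := ℂ) (Q x)‖ ≤ C) : ‖potOp hQ‖ ≤ C := by
  have h1 : ‖(ContinuousMap.toLp ⊤ haarAddCircle ℂ (potFun hQ) :
      Lp (EuclideanSpace ℂ (Fin N) →L[ℂ] EuclideanSpace ℂ (Fin N)) ⊤
        (haarAddCircle (T := 2 * Real.pi * a)))‖ ≤ C := by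
    have := Lp.norm_le_of_ae_bound (f := (ContinuousMap.toLp ⊤ haarAddCircle ℂ (potFun hQ) :
      Lp (EuclideanSpace ℂ (Fin N) →L[ℂ] EuclideanSpace ℂ (Fin N)) ⊤
        (haarAddCircle (T := 2 * Real.pi * a)))) hC (by
      filter_upwards [ContinuousMap.coeFn_toLp (p := ⊤) (𝕜 := ℂ) haarAddCircle (potFun hQ)]
        with x hx
      rw [hx]
      induction x using QuotientAddGroup.induction_on with
      | H x => exact h x)
    simpa using this
  refine (ContinuousLinearMap.le_opNorm _ _).trans ?_
  calc _ ≤ 1 * C := by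
        gcongr
        exact (ContinuousLinearMap.norm_holderL_le _).trans ContinuousLinearMap.norm_id_le
    _ = C := one_mul C

omit hT in
theorem IsPotential.isSelfAdjoint_clm (hQ : IsPotential a Q) (x : ℝ) :
    IsSelfAdjoint (Matrix.toEuclideanCLM (n := Fin N) (𝕜 := ℂ) (Q x)) := by
  rw [IsSelfAdjoint, ← map_star]
  congr 1
  exact hQ.2 x

theorem potOp_symm (hQ : IsPotential a Q) (f g : CircleL2 N a) :
    ⟪potOp hQ f, g⟫ = ⟪f, potOp hQ g⟫ := by
  rw [L2.inner_def, L2.inner_def]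
  refine integral_congr_ae ?_
  filter_upwards [potOp_ae hQ f, potOp_ae hQ g] with x h1 h2
  rw [h1, h2]
  induction x using QuotientAddGroup.induction_on with
  | H x =>
    have := (hQ.isSelfAdjoint_clm x)
    rw [ContinuousLinearMap.isSelfAdjoint_iff'] at this
    change ⟪Matrix.toEuclideanCLM (n := Fin N) (𝕜 := ℂ) (Q x) _, _⟫
      = ⟪_, Matrix.toEuclideanCLM (n := Fin N) (𝕜 := ℂ) (Q x) _⟫
    rw [← ContinuousLinearMap.adjoint_inner_right, this]

theorem isSelfAdjoint_potOp (hQ : IsPotential a Q) : IsSelfAdjoint (potOp hQ) :=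
  ContinuousLinearMap.isSelfAdjoint_iff_isSymmetric.2 (potOp_symm hQ)

omit hT in
theorem mulVec_mem_smoothVec (hQ : IsPotential a Q) {φ : ℝ → Fin N → ℂ} (h : φ ∈ smoothVec N a) :
    (fun x => Q x *ᵥ φ x) ∈ smoothVec N a := fun i => by
  simp only [Matrix.mulVec, dotProduct]
  exact SmoothPer.sum _ fun j => (hQ.entry i j).mul (h j)

theorem potOp_smoothL2 (hQ : IsPotential a Q) (φ : smoothVec N a) :
    potOp hQ (smoothL2 φ) = smoothL2 ⟨fun x => Q x *ᵥ φ.1 x, mulVec_mem_smoothVec hQ φ.2⟩ := by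
  apply Lp.ext
  have h1 := contL2_ae (toCircleFun _ (smoothVec_continuous φ.2) (smoothVec_periodic φ.2))
  have h2 := contL2_ae (toCircleFun _ (smoothVec_continuous (mulVec_mem_smoothVec hQ φ.2))
    (smoothVec_periodic (mulVec_mem_smoothVec hQ φ.2)))
  filter_upwards [potOp_ae hQ (smoothL2 φ), h1, h2] with x hx h1 h2
  rw [hx]
  change potFun hQ x ((contL2 _ : CircleL2 N a) x) = (contL2 _ : CircleL2 N a) x
  rw [h1, h2]
  induction x using QuotientAddGroup.induction_on with
  | H x => rfl

/-- Multiplication by `Q` is block Toeplitz in the Fourier basis. This makes the diagonal of `V`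
independent of the frequency and lets the second-order sums see `Q` only through `hsCoef`. -/
theorem inner_potOp_basis (hQ : IsPotential a Q) (n m : ℤ) (i j : Fin N) :
    ⟪circleBasis N a (n, i), potOp hQ (circleBasis N a (m, j))⟫ = fourierCoef a Q (n - m) i j := by
  rw [← smoothL2_expSmooth m j, potOp_smoothL2, inner_circleBasis_smoothL2, fourierCoef_apply,
    ← fcoef_mul_emode]
  simp [expSmooth]

end Space

end

section

/-! ### Resolvents -/

section Resolvent

variable {N : ℕ} {a : ℝ} [hT : Fact (0 < 2 * Real.pi * a)]

omit hT in
theorem symb_bounded {w : ℝ} (hw : 0 < w) : ∃ C, ∀ p : ℤ × Fin N, |symb a w p.1| ≤ C :=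
  ⟨w⁻¹, fun p => by rw [abs_of_pos (symb_pos hw _)]; exact symb_le hw _⟩

/-- The free resolvent `(-D² + w)⁻¹`. -/
def freeRes (N : ℕ) (a : ℝ) [Fact (0 < 2 * Real.pi * a)] {w : ℝ} (hw : 0 < w) :
    CircleL2 N a →L[ℂ] CircleL2 N a :=
  diagOp (circleBasis N a) (fun p => symb a w p.1) (symb_bounded hw)

theorem norm_freeRes_le {w : ℝ} (hw : 0 < w) : ‖freeRes N a hw‖ ≤ w⁻¹ :=
  norm_diagOp_le _ _ (by positivity) fun p => by
    rw [abs_of_pos (symb_pos hw _)]; exact symb_le hw _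

theorem isSelfAdjoint_freeRes {w : ℝ} (hw : 0 < w) : IsSelfAdjoint (freeRes N a hw) :=
  ContinuousLinearMap.isSelfAdjoint_iff_isSymmetric.2 (diagOp_symm _ _)

theorem inner_freeRes {w : ℝ} (hw : 0 < w) (x : CircleL2 N a) (p) :
    ⟪circleBasis N a p, freeRes N a hw x⟫ = symb a w p.1 * ⟪circleBasis N a p, x⟫ :=
  inner_diagOp _ _ _ _

theorem freeRes_basis {w : ℝ} (hw : 0 < w) (p) :
    freeRes N a hw (circleBasis N a p) = (symb a w p.1 : ℂ) • circleBasis N a p :=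
  diagOp_basis _ _ _

omit hT in
theorem hasSum_prod_fintype {ι κ E : Type*} [Fintype κ] [AddCommMonoid E] [TopologicalSpace E]
    [ContinuousAdd E] {F : ι × κ → E} {s : κ → E} (h : ∀ i, HasSum (fun n => F (n, i)) (s i)) :
    HasSum F (∑ i, s i) := by
  classical
  have h1 : ∀ i : κ, HasSum (fun p : ι × κ => if p.2 = i then F p else 0) (s i) := by
    intro i
    have hinj : Function.Injective (fun n : ι => (n, i)) := fun m n e => congrArg Prod.fst e
    refine (hinj.hasSum_iff fun p hp => ?_).1 ((h i).congr_fun fun n => by simp)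
    rw [if_neg]
    rintro rfl
    exact hp ⟨p.1, rfl⟩
  refine (hasSum_sum fun i _ => h1 i).congr_fun fun p => ?_
  simp

omit hT in
theorem hasSum_prod_fin {f : ℤ → ℝ} {s : ℝ} (h : HasSum f s) (N : ℕ) :
    HasSum (fun p : ℤ × Fin N => f p.1) (N * s) :=
  HasSum.of_eq (hasSum_prod_fintype (F := fun p : ℤ × Fin N => f p.1) fun _ => h) (by simp)
    fun _ => rfl

theorem isCompactOperator_freeRes {w : ℝ} (hw : 0 < w) : IsCompactOperator (freeRes N a hw) :=
  isCompactOperator_diagOp _ _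
    (hasSum_prod_fin (summable_symb (pos_of_fact hT) hw).hasSum N).summable.tendsto_cofinite_zero

omit hT in
theorem deriv_deriv_apply {φ : ℝ → Fin N → ℂ} (h : φ ∈ smoothVec N a) (x : ℝ) (i : Fin N) :
    deriv (deriv φ) x i = deriv (deriv fun y => φ y i) x := by
  have h1 : ∀ y, deriv φ y = fun i => deriv (fun z => φ z i) y := fun y =>
    deriv_pi fun i => (h i).differentiable y
  rw [funext h1, deriv_pi fun i => (h i).deriv.differentiable x]

variable {Q : ℝ → Matrix (Fin N) (Fin N) ℂ}

omit hT in
theorem schrodinger_apply {φ : ℝ → Fin N → ℂ} (h : φ ∈ smoothVec N a) (x : ℝ) (i : Fin N) :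
    schrodinger Q φ x i = -(deriv (deriv fun y => φ y i) x) + (Q x *ᵥ φ x) i := by
  simp [schrodinger, deriv_deriv_apply h]

omit hT in
theorem schrodinger_mem (hQ : IsPotential a Q) {φ : ℝ → Fin N → ℂ} (h : φ ∈ smoothVec N a) :
    schrodinger Q φ ∈ smoothVec N a := fun i => by
  simp_rw [schrodinger_apply h]
  exact (h i).deriv.deriv.neg.add (mulVec_mem_smoothVec hQ h i)

/-- The differential operator `L` on smooth functions. -/
def smoothOp (hQ : IsPotential a Q) (φ : smoothVec N a) : smoothVec N a :=
  ⟨schrodinger Q φ.1, schrodinger_mem hQ φ.2⟩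

theorem inner_smoothOp (hQ : IsPotential a Q) (φ : smoothVec N a) (p) :
    ⟪circleBasis N a p, smoothL2 (smoothOp hQ φ)⟫ =
      (freq a p.1 ^ 2 : ℝ) * ⟪circleBasis N a p, smoothL2 φ⟫
        + ⟪circleBasis N a p, potOp hQ (smoothL2 φ)⟫ := by
  obtain ⟨n, i⟩ := p
  rw [potOp_smoothL2, inner_circleBasis_smoothL2, inner_circleBasis_smoothL2,
    inner_circleBasis_smoothL2]
  simp only [smoothOp]
  simp_rw [schrodinger_apply φ.2]
  rw [fcoef_add _ (φ.2 i).deriv.deriv.neg.continuous (mulVec_mem_smoothVec hQ φ.2 i).continuous,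
    fcoef_neg, fcoef_deriv2 (pos_of_fact hT) n (φ.2 i), freq]
  push_cast; ring

/-- The resolvent `(L + w)⁻¹`. -/
def res (hQ : IsPotential a Q) {w : ℝ} (hw : 0 < w) : CircleL2 N a →L[ℂ] CircleL2 N a :=
  perturbed (freeRes N a hw) (potOp hQ)

/-- The pair of assumptions `‖V‖ ≤ m/2` and `m ≤ w` recurs below. For `V = εQ` the first follows
from `|ε| ≤ 1/2` and `‖Q‖ ≤ m`; the ratio `1/2` yields invertibility of `1 + GV` and `‖B‖ ≤ 2/w`. -/
theorem norm_freeRes_mul_potOp (hQ : IsPotential a Q) {m w : ℝ} (hb : ‖potOp hQ‖ ≤ m / 2)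
    (hw : 0 < w) (hmw : m ≤ w) : ‖freeRes N a hw * potOp hQ‖ ≤ 1 / 2 := by
  calc _ ≤ ‖freeRes N a hw‖ * ‖potOp hQ‖ := norm_mul_le _ _
    _ ≤ w⁻¹ * (w / 2) := by gcongr; exacts [norm_freeRes_le hw, hb.trans (by linarith)]
    _ = 1 / 2 := by field_simp

theorem norm_potOp_mul_freeRes (hQ : IsPotential a Q) {m w : ℝ} (hb : ‖potOp hQ‖ ≤ m / 2)
    (hw : 0 < w) (hmw : m ≤ w) : ‖potOp hQ * freeRes N a hw‖ ≤ 1 / 2 := by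
  calc _ ≤ ‖potOp hQ‖ * ‖freeRes N a hw‖ := norm_mul_le _ _
    _ ≤ (w / 2) * w⁻¹ := by gcongr; exacts [hb.trans (by linarith), norm_freeRes_le hw]
    _ = 1 / 2 := by field_simp

section

variable (hQ : IsPotential a Q) {m w : ℝ} (hb : ‖potOp hQ‖ ≤ m / 2) (hw : 0 < w) (hmw : m ≤ w)

include hb hmw

theorem norm_GV_lt : ‖freeRes N a hw * potOp hQ‖ < 1 :=
  lt_of_le_of_lt (norm_freeRes_mul_potOp hQ hb hw hmw) (by norm_num)

theorem norm_res_le : ‖res hQ hw‖ ≤ 2 * w⁻¹ :=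
  (norm_perturbed_le (norm_freeRes_mul_potOp hQ hb hw hmw)).trans
    (by gcongr; exact norm_freeRes_le hw)

theorem isSelfAdjoint_res : IsSelfAdjoint (res hQ hw) :=
  isSelfAdjoint_perturbed (isSelfAdjoint_freeRes hw) (isSelfAdjoint_potOp hQ)
    (norm_GV_lt hQ hb hw hmw)
    (lt_of_le_of_lt (norm_potOp_mul_freeRes hQ hb hw hmw) (by norm_num))

theorem isCompactOperator_res : IsCompactOperator (res hQ hw) := by
  have h := perturbed_eq (norm_GV_lt hQ hb hw hmw)
  -- The identity `B = G (1 - VB)` writes the resolvent as a compact operator after a bounded one.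
  have e : res hQ hw = (freeRes N a hw).comp (1 - potOp hQ * res hQ hw) := by
    refine h.trans ?_
    ext1 x
    change _ = freeRes N a hw (x - potOp hQ (res hQ hw x))
    rw [map_sub]; rfl
  rw [e]
  exact (isCompactOperator_freeRes hw).comp_clm _

theorem res_injective : Function.Injective (res hQ hw) := by
  refine (injective_iff_map_eq_zero _).2 fun x hx => ?_
  have h := congrArg (fun T : CircleL2 N a →L[ℂ] CircleL2 N a => T x)
    (perturbed_left (norm_GV_lt hQ hb hw hmw))
  have h2 : freeRes N a hw x = 0 := by
    rw [← h]
    change (1 + freeRes N a hw * potOp hQ) (res hQ hw x) = 0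
    rw [hx, map_zero]
  refine HilbertBasis.ext_inner (circleBasis N a) fun p => ?_
  have h3 := inner_freeRes hw x p
  rw [h2, inner_zero_right] at h3
  have h4 : (symb a w p.1 : ℂ) ≠ 0 := by exact_mod_cast (symb_pos hw _).ne'
  rw [inner_zero_right]
  exact (mul_eq_zero.1 h3.symm).resolve_left h4

/-- Applying `G` to `(L + w)φ` gives `(1 + GV)φ`. No unbounded operator is constructed: every link
between the differential expression and the bounded resolvent passes through this identity on smooth
functions. -/
theorem res_smoothOp (φ : smoothVec N a) :
    res hQ hw (smoothL2 (smoothOp hQ φ) + (w : ℂ) • smoothL2 φ) = smoothL2 φ := by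
  have hu := isUnit_one_add_of_norm_lt (norm_GV_lt hQ hb hw hmw)
  have h1 : freeRes N a hw (smoothL2 (smoothOp hQ φ) + (w : ℂ) • smoothL2 φ)
      = (1 + freeRes N a hw * potOp hQ) (smoothL2 φ) := by
    refine HilbertBasis.ext_inner (circleBasis N a) fun p => ?_
    rw [inner_freeRes, inner_add_right, inner_smoothOp, inner_smul_right]
    change _ = ⟪_, smoothL2 φ + freeRes N a hw (potOp hQ (smoothL2 φ))⟫
    rw [inner_add_right, inner_freeRes]
    have : (symb a w p.1 : ℂ) * ((freq a p.1 ^ 2 : ℝ) + w) = 1 := by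
      have h : symb a w p.1 * (freq a p.1 ^ 2 + w) = 1 :=
        inv_mul_cancel₀ (by positivity)
      exact_mod_cast h
    linear_combination ⟪circleBasis N a p, smoothL2 φ⟫ * this
  have h2 : res hQ hw (smoothL2 (smoothOp hQ φ) + (w : ℂ) • smoothL2 φ)
      = Ring.inverse (1 + freeRes N a hw * potOp hQ)
        (freeRes N a hw (smoothL2 (smoothOp hQ φ) + (w : ℂ) • smoothL2 φ)) := rfl
  rw [h2, h1]
  have h3 := Ring.inverse_mul_cancel _ hu
  exact congrArg (fun T : CircleL2 N a →L[ℂ] CircleL2 N a => T (smoothL2 φ)) h3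

end

/-! ### Eigenspaces -/

omit hT in
theorem eigenspace_le (μ : ℝ) : eigenspace a Q μ ≤ smoothVec N a := by
  rintro φ ⟨h1, h2, -⟩ i
  exact ⟨contDiff_pi.1 h1 i, fun x => congrFun (h2 x) i⟩

/-- The eigenspace of `L` as a subspace of `L²`. -/
def specSpace (N : ℕ) (a : ℝ) [Fact (0 < 2 * Real.pi * a)] (Q : ℝ → Matrix (Fin N) (Fin N) ℂ)
    (μ : ℝ) : Submodule ℂ (CircleL2 N a) :=
  LinearMap.range ((smoothL2 (N := N) (a := a)).comp (Submodule.inclusion (eigenspace_le (Q := Q) μ)))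

theorem mem_specSpace (hQ : IsPotential a Q) {μ : ℝ} {f : CircleL2 N a} :
    f ∈ specSpace N a Q μ ↔ ∃ φ, smoothOp hQ φ = (μ : ℂ) • φ ∧ smoothL2 φ = f := by
  constructor
  · rintro ⟨⟨φ, hφ⟩, rfl⟩
    refine ⟨⟨φ, eigenspace_le μ hφ⟩, ?_, rfl⟩
    apply Subtype.ext
    ext1 x
    exact hφ.2.2 x
  · rintro ⟨φ, h, rfl⟩
    have hm : φ.1 ∈ eigenspace a Q μ :=
      ⟨contDiff_pi.2 fun i => (φ.2 i).1, fun x => funext fun i => (φ.2 i).2 x,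
        fun x => congrFun (congrArg Subtype.val h) x⟩
    exact ⟨⟨φ.1, hm⟩, rfl⟩

theorem finrank_specSpace (μ : ℝ) : Module.finrank ℂ (specSpace N a Q μ) = multiplicity a Q μ := by
  rw [multiplicity]
  refine (LinearEquiv.ofInjective _ ?_).finrank_eq.symm
  exact smoothL2_injective.comp (Submodule.inclusion_injective _)

theorem specSpace_eq_bot_iff (μ : ℝ) : specSpace N a Q μ = ⊥ ↔ eigenspace a Q μ = ⊥ := by
  rw [specSpace, LinearMap.range_eq_bot]
  constructor
  · intro h
    rw [Submodule.eq_bot_iff]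
    intro φ hφ
    have h2 := congrArg (fun T => T ⟨φ, hφ⟩) h
    have h3 : (⟨φ, hφ⟩ : eigenspace a Q μ) = 0 :=
      (smoothL2_injective.comp (Submodule.inclusion_injective (eigenspace_le (Q := Q) μ)))
        (by simpa using h2)
    exact congrArg Subtype.val h3
  · intro h
    ext1 ⟨φ, hφ⟩
    have : φ = 0 := by rw [h] at hφ; exact hφ
    subst this
    have h0 : (⟨0, hφ⟩ : eigenspace a Q μ) = 0 := rfl
    rw [h0, map_zero, map_zero]

section

variable (hQ : IsPotential a Q) {m w : ℝ} (hb : ‖potOp hQ‖ ≤ m / 2) (hw : 0 < w) (hmw : m ≤ w)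

include hb hmw in
theorem res_of_mem_specSpace {μ : ℝ} {f : CircleL2 N a} (hf : f ∈ specSpace N a Q μ) :
    ((μ + w : ℝ) : ℂ) • res hQ hw f = f := by
  obtain ⟨φ, h1, rfl⟩ := (mem_specSpace hQ).1 hf
  have h2 := res_smoothOp hQ hb hw hmw φ
  rw [h1, map_smul, ← add_smul, map_smul] at h2
  exact_mod_cast h2

/-- The quadratic form of `-D²` is nonnegative, being a sum of `ξ²` times squared moduli of
coefficients, so an eigenvalue cannot lie below `-‖V‖`. -/
theorem neg_norm_le_of_mem_specSpace {μ : ℝ} {f : CircleL2 N a} (hf : f ∈ specSpace N a Q μ)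
    (h0 : f ≠ 0) : -‖potOp hQ‖ ≤ μ := by
  obtain ⟨φ, h1, rfl⟩ := (mem_specSpace hQ).1 hf
  set f := smoothL2 φ with hfd
  have hin : ∀ p, ⟪circleBasis N a p, (μ : ℂ) • f - potOp hQ f⟫
      = (freq a p.1 ^ 2 : ℝ) * ⟪circleBasis N a p, f⟫ := by
    intro p
    have := inner_smoothOp hQ φ p
    rw [h1, map_smul] at this
    rw [inner_sub_right, this]; ring
  have hre : 0 ≤ (⟪f, (μ : ℂ) • f - potOp hQ f⟫).re := by
    have hs := (circleBasis N a).hasSum_inner_mul_inner f ((μ : ℂ) • f - potOp hQ f)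
    have hs' := (Complex.hasSum_re hs)
    refine hs'.nonneg fun p => ?_
    rw [hin, ← inner_conj_symm, mul_left_comm, conj_mul']
    norm_cast
    positivity
  rw [inner_sub_right, inner_smul_right, sub_re, inner_self_eq_norm_sq_to_K] at hre
  have h3 : |(⟪f, potOp hQ f⟫).re| ≤ ‖potOp hQ‖ * ‖f‖ ^ 2 := by
    refine (Complex.abs_re_le_norm _).trans ((norm_inner_le_norm _ _).trans ?_)
    calc _ ≤ ‖f‖ * (‖potOp hQ‖ * ‖f‖) := by gcongr; exact ContinuousLinearMap.le_opNorm _ _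
      _ = _ := by ring
  have h4 := (abs_le.1 h3).1
  have h5 : (((μ : ℂ) * ((‖f‖ : ℝ) : ℂ) ^ 2)).re = μ * ‖f‖ ^ 2 := by
    rw [← ofReal_pow, ← ofReal_mul, ofReal_re]
  have h6 : 0 ≤ μ * ‖f‖ ^ 2 - (⟪f, potOp hQ f⟫).re := by rw [← h5]; exact hre
  have h7 : 0 < ‖f‖ ^ 2 := by have := norm_pos_iff.2 h0; positivity
  nlinarith

end

end Resolvent

end

section

/-! ### Regularity of eigenvectors -/

section Regularity

variable {N : ℕ} {a : ℝ} [hT : Fact (0 < 2 * Real.pi * a)]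
  {Q : ℝ → Matrix (Fin N) (Fin N) ℂ}

omit hT in
theorem IsPotential.decay_bound (ha : 0 < a) (hQ : IsPotential a Q) (k : ℕ) :
    ∃ D : ℝ, 0 ≤ D ∧ ∀ (n : ℤ) (i j : Fin N), ‖fourierCoef a Q n i j‖ ≤ D * ((1 + |(n : ℝ)|) ^ k)⁻¹ := by
  choose C hC0 hC using fun i j => (hQ.rapidDecay ha i j).bound k
  refine ⟨∑ i, ∑ j, C i j, Finset.sum_nonneg fun i _ => Finset.sum_nonneg fun j _ => hC0 i j,
    fun n i j => (hC i j n).trans ?_⟩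
  gcongr
  exact (Finset.single_le_sum (fun j _ => hC0 i j) (Finset.mem_univ j)).trans
    (Finset.single_le_sum (f := fun i => ∑ j, C i j)
      (fun i _ => Finset.sum_nonneg fun j _ => hC0 i j) (Finset.mem_univ i))

theorem inner_potOp_basis_left (hQ : IsPotential a Q) (n m : ℤ) (i j : Fin N) :
    ‖⟪potOp hQ (circleBasis N a (n, i)), circleBasis N a (m, j)⟫‖ = ‖fourierCoef a Q (m - n) j i‖ := by
  rw [← inner_potOp_basis hQ, norm_inner_symm]

omit hT in
theorem one_add_abs_le (n l : ℤ) :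
    1 + |(n : ℝ)| ≤ (1 + |((l - n : ℤ) : ℝ)|) * (1 + |(l : ℝ)|) := by
  have h : |(n : ℝ)| ≤ |((l - n : ℤ) : ℝ)| + |(l : ℝ)| := by
    have := abs_sub (l : ℝ) ((l - n : ℤ) : ℝ)
    push_cast at this ⊢
    rw [sub_sub_cancel] at this
    linarith
  nlinarith [abs_nonneg ((l - n : ℤ) : ℝ), abs_nonneg (l : ℝ)]

/-- On coefficients `V` is convolution with a rapidly decreasing sequence, and this preserves
polynomial decay by `1 + |n| ≤ (1 + |l - n|)(1 + |l|)`. -/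
theorem potOp_decay (hQ : IsPotential a Q) (k : ℕ) : ∃ K : ℝ, 0 ≤ K ∧
    ∀ (f : CircleL2 N a) (C : ℝ), 0 ≤ C →
      (∀ (n : ℤ) (i : Fin N), (1 + |(n : ℝ)|) ^ k * ‖⟪circleBasis N a (n, i), f⟫‖ ≤ C) →
      ∀ (n : ℤ) (i : Fin N), (1 + |(n : ℝ)|) ^ k *
        ‖⟪circleBasis N a (n, i), potOp hQ f⟫‖ ≤ K * C := by
  -- Of the exponent `k + 2`, the part `k` pays for the weight inequality and the part `2` makes the
  -- sum over `l` converge.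
  obtain ⟨D, hD0, hD⟩ := hQ.decay_bound (pos_of_fact hT) (k + 2)
  set S := ∑' n : ℤ, ((1 + |(n : ℝ)|) ^ 2)⁻¹ with hS
  have hS0 : 0 ≤ S := tsum_nonneg fun _ => by positivity
  refine ⟨D * (N * S), by positivity, fun f C hC0 hC n i => ?_⟩
  have h1 := (circleBasis N a).hasSum_inner_mul_inner (potOp hQ (circleBasis N a (n, i))) f
  rw [potOp_symm] at h1
  have h2 : HasSum (fun l : ℤ => ((1 + |((l - n : ℤ) : ℝ)|) ^ 2)⁻¹) S :=
    ((Equiv.subRight n).hasSum_iff (f := fun l : ℤ => ((1 + |(l : ℝ)|) ^ 2)⁻¹)).2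
      summable_one_add_abs.hasSum
  have h3 := (hasSum_prod_fin h2 N).mul_left (D * C * ((1 + |(n : ℝ)|) ^ k)⁻¹)
  have h4 := h1.norm_le_of_bounded h3 (fun p => by
    obtain ⟨l, j⟩ := p
    rw [norm_mul, inner_potOp_basis_left]
    have e1 := hD (l - n) j i
    have e2 : ‖⟪circleBasis N a (l, j), f⟫‖ ≤ C * ((1 + |(l : ℝ)|) ^ k)⁻¹ := by
      rw [← div_eq_mul_inv, le_div_iff₀ (by positivity), mul_comm]; exact hC l j
    calc _ ≤ (D * ((1 + |((l - n : ℤ) : ℝ)|) ^ (k + 2))⁻¹) * (C * ((1 + |(l : ℝ)|) ^ k)⁻¹) := by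
          gcongr
      _ = D * C * (((1 + |((l - n : ℤ) : ℝ)|) * (1 + |(l : ℝ)|)) ^ k)⁻¹
          * ((1 + |((l - n : ℤ) : ℝ)|) ^ 2)⁻¹ := by
          rw [pow_add, mul_pow, mul_inv, mul_inv]; ring
      _ ≤ _ := by
          gcongr
          exact one_add_abs_le n l)
  calc _ ≤ (1 + |(n : ℝ)|) ^ k * (D * C * ((1 + |(n : ℝ)|) ^ k)⁻¹ * (N * S)) := by gcongr
    _ = _ := by field_simp

omit hT in
theorem one_add_abs_mul_symb (ha : 0 < a) {w : ℝ} (hw : 0 < w) (n : ℤ) :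
    (1 + |(n : ℝ)|) * symb a w n ≤ w⁻¹ + a ^ 2 := by
  have h1 := symb_le (a := a) hw n
  have h2 : |(n : ℝ)| * symb a w n ≤ a ^ 2 := by
    have h3 : |(n : ℝ)| ≤ (n : ℝ) ^ 2 := by
      rw [← sq_abs]
      rcases eq_or_ne n 0 with rfl | hn
      · simp
      · have : (1 : ℝ) ≤ |(n : ℝ)| := by exact_mod_cast Int.one_le_abs hn
        nlinarith
    rw [symb, ← div_eq_mul_inv, div_le_iff₀ (by positivity), freq]
    have : a ^ 2 * (((n : ℝ) / a) ^ 2 + w) = (n : ℝ) ^ 2 + a ^ 2 * w := by field_simp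
    rw [this]
    have : 0 < a ^ 2 * w := by positivity
    linarith
  linarith

variable (hQ : IsPotential a Q) {m w : ℝ} (hb : ‖potOp hQ‖ ≤ m / 2) (hw : 0 < w) (hmw : m ≤ w)

include hb hmw

theorem coef_of_eigenvector {β : ℝ} (hβ : β ≠ 0) {f : CircleL2 N a}
    (h : res hQ hw f = (β : ℂ) • f) (p) :
    ⟪circleBasis N a p, f⟫ = symb a w p.1 *
      ((β⁻¹ : ℝ) * ⟪circleBasis N a p, f⟫ - ⟪circleBasis N a p, potOp hQ f⟫) := by
  have h1 := congrArg (fun T : CircleL2 N a →L[ℂ] CircleL2 N a => ⟪circleBasis N a p, T f⟫)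
    (perturbed_left (norm_GV_lt hQ hb hw hmw))
  have h2 : ⟪circleBasis N a p, res hQ hw f + freeRes N a hw (potOp hQ (res hQ hw f))⟫
    = ⟪circleBasis N a p, freeRes N a hw f⟫ := h1
  rw [inner_add_right, inner_freeRes, inner_freeRes, h, map_smul, inner_smul_right,
    inner_smul_right] at h2
  have hβ' : (β : ℂ) ≠ 0 := by exact_mod_cast hβ
  have : ((β⁻¹ : ℝ) : ℂ) * β = 1 := by push_cast; field_simp
  linear_combination ((β⁻¹ : ℝ) : ℂ) * h2 - (⟪circleBasis N a p, f⟫ + symb a w p.1 *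
    ⟪circleBasis N a p, potOp hQ f⟫) * this

/-- A bootstrap on `f = G(β⁻¹ f - Vf)`: `V` preserves polynomial decay and `(1 + |n|) g_n` is
bounded, so each round gains one power, starting from bounded coefficients. -/
theorem decay_of_eigenvector {β : ℝ} (hβ : β ≠ 0) {f : CircleL2 N a}
    (h : res hQ hw f = (β : ℂ) • f) (k : ℕ) : ∃ C : ℝ, 0 ≤ C ∧ ∀ (n : ℤ) (i : Fin N),
      (1 + |(n : ℝ)|) ^ k * ‖⟪circleBasis N a (n, i), f⟫‖ ≤ C := by
  induction k with
  | zero =>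
    refine ⟨‖f‖, norm_nonneg _, fun n i => ?_⟩
    rw [pow_zero, one_mul]
    refine (norm_inner_le_norm _ _).trans ?_
    rw [(circleBasis N a).orthonormal.1, one_mul]
  | succ k ih =>
    obtain ⟨C, hC0, hC⟩ := ih
    obtain ⟨K, hK0, hK⟩ := potOp_decay hQ k
    refine ⟨(w⁻¹ + a ^ 2) * (|β⁻¹| * C + K * C), by positivity, fun n i => ?_⟩
    rw [coef_of_eigenvector hQ hb hw hmw hβ h, norm_mul, norm_real,
      Real.norm_of_nonneg (symb_pos hw n).le]
    have h1 := hC n i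
    have h2 := hK f C hC0 hC n i
    have h3 := one_add_abs_mul_symb (pos_of_fact hT) hw n
    have h4 := symb_pos (a := a) hw n
    calc _ ≤ (1 + |(n : ℝ)|) ^ (k + 1) * (symb a w n * (|β⁻¹| * ‖⟪circleBasis N a (n, i), f⟫‖ +
          ‖⟪circleBasis N a (n, i), potOp hQ f⟫‖)) := by
          gcongr
          refine (norm_sub_le _ _).trans_eq ?_
          rw [norm_mul, norm_real, Real.norm_eq_abs]
      _ = ((1 + |(n : ℝ)|) * symb a w n) * (|β⁻¹| * ((1 + |(n : ℝ)|) ^ k *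
          ‖⟪circleBasis N a (n, i), f⟫‖) + (1 + |(n : ℝ)|) ^ k *
          ‖⟪circleBasis N a (n, i), potOp hQ f⟫‖) := by ring
      _ ≤ _ := by gcongr

/-- Rapid decay makes `f` the class of a smooth function `φ`. Both `(L + w)φ` and `β⁻¹ φ` are sent
to `f` by the resolvent, which is injective. -/
theorem mem_specSpace_of_eigenvector {β : ℝ} (hβ : β ≠ 0) {f : CircleL2 N a}
    (h : res hQ hw f = (β : ℂ) • f) : f ∈ specSpace N a Q (β⁻¹ - w) := by
  have ha := pos_of_fact hT
  have hr : ∀ i, RapidDecay (fun n => ⟪circleBasis N a (n, i), f⟫) := fun i k => by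
    obtain ⟨C, -, hC⟩ := decay_of_eigenvector hQ hb hw hmw hβ h k
    exact ⟨C, fun n => hC n i⟩
  let φ : smoothVec N a := ⟨fun x i => synth a (fun n => ⟪circleBasis N a (n, i), f⟫) x,
    fun i => smoothPer_synth ha (hr i)⟩
  have hφ : smoothL2 φ = f := by
    refine HilbertBasis.ext_inner (circleBasis N a) fun ⟨n, i⟩ => ?_
    rw [inner_circleBasis_smoothL2]
    exact fcoef_synth ha (hr i) n
  have hβ' : (β : ℂ) ≠ 0 := by exact_mod_cast hβ
  refine (mem_specSpace hQ).2 ⟨φ, smoothL2_injective ?_, hφ⟩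
  have h1 := res_smoothOp hQ hb hw hmw φ
  have h2 : res hQ hw (((β⁻¹ : ℝ) : ℂ) • f) = f := by
    rw [map_smul, h, smul_smul]; push_cast; rw [inv_mul_cancel₀ hβ', one_smul]
  have h3 := res_injective hQ hb hw hmw ((h1.trans hφ).trans h2.symm)
  rw [map_smul, hφ] at *
  rw [eq_sub_of_add_eq h3, ← sub_smul]
  push_cast; rfl

end Regularity

/-! ### The trace of the resolvent -/

section Trace

variable {N : ℕ} {a : ℝ} [hT : Fact (0 < 2 * Real.pi * a)]
  {Q : ℝ → Matrix (Fin N) (Fin N) ℂ}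

variable (hQ : IsPotential a Q) {m w : ℝ} (hb : ‖potOp hQ‖ ≤ m / 2)

include hb

theorem specSpace_pos {μ : ℝ} (h : specSpace N a Q μ ≠ ⊥) : m / 2 ≤ μ + m := by
  obtain ⟨f, hf, h0⟩ := Submodule.exists_mem_ne_zero_of_ne_bot h
  have := neg_norm_le_of_mem_specSpace hQ hf h0
  linarith

theorem specSpace_orthogonal (hm : 0 < m) :
    OrthogonalFamily ℂ (fun μ => specSpace N a Q μ) fun μ => (specSpace N a Q μ).subtypeₗᵢ := by
  rintro μ ν hne ⟨f, hf⟩ ⟨g, hg⟩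
  change ⟪f, g⟫ = 0
  have h1 := res_of_mem_specSpace hQ hb hm le_rfl hf
  have h2 := res_of_mem_specSpace hQ hb hm le_rfl hg
  have hs := (ContinuousLinearMap.isSelfAdjoint_iff_isSymmetric.1
    (isSelfAdjoint_res hQ hb hm le_rfl)) f g
  have e1 : ⟪f, g⟫ = (μ + m : ℝ) * ⟪res hQ hm f, g⟫ := by
    conv_lhs => rw [← h1]
    rw [inner_smul_left, conj_ofReal]
  have e2 : ⟪f, g⟫ = (ν + m : ℝ) * ⟪res hQ hm f, g⟫ := by
    conv_lhs => rw [← h2]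
    rw [inner_smul_right]
    congr 1
    exact hs.symm
  have e3 : ((μ - ν : ℝ) : ℂ) * ⟪res hQ hm f, g⟫ = 0 := by
    have := e1.symm.trans e2
    push_cast at this ⊢
    linear_combination this
  have hne' : ((μ - ν : ℝ) : ℂ) ≠ 0 := by exact_mod_cast sub_ne_zero.2 hne
  rw [e1, (mul_eq_zero.1 e3).resolve_left hne', mul_zero]

/-- An eigenvalue of the resolvent is nonzero by injectivity and real by symmetry, so its inverse
minus `m` is an eigenvalue of `L` and the regularity result applies. -/
theorem eigenspace_res_le (hm : 0 < m) (β : ℂ) :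
    Module.End.eigenspace (res hQ hm : Module.End ℂ (CircleL2 N a)) β ≤ ⨆ μ, specSpace N a Q μ := by
  have hsymm := ContinuousLinearMap.isSelfAdjoint_iff_isSymmetric.1
    (isSelfAdjoint_res hQ hb hm le_rfl)
  intro f hf
  rcases eq_or_ne f 0 with rfl | h0
  · exact Submodule.zero_mem _
  have hf' : res hQ hm f = β • f := Module.End.mem_eigenspace_iff.1 hf
  have hβ : β ≠ 0 := by
    rintro rfl
    rw [zero_smul] at hf'
    exact h0 (res_injective hQ hb hm le_rfl (by rw [hf', map_zero]))
  have hreal := hsymm.conj_eigenvalue_eq_self (Module.End.hasEigenvalue_of_hasEigenvector ⟨hf, h0⟩)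
  obtain ⟨r, rfl⟩ := Complex.conj_eq_iff_real.1 hreal
  have hr : r ≠ 0 := by exact_mod_cast hβ
  exact Submodule.mem_iSup_of_mem (r⁻¹ - m)
    (mem_specSpace_of_eigenvector hQ hb hm le_rfl hr hf')

theorem specSpace_complete (hm : 0 < m) : (⨆ μ, specSpace N a Q μ)ᗮ = ⊥ := by
  have h := ContinuousLinearMap.orthogonalComplement_iSup_eigenspaces_eq_bot
    (isCompactOperator_res hQ hb hm le_rfl)
    (ContinuousLinearMap.isSelfAdjoint_iff_isSymmetric.1 (isSelfAdjoint_res hQ hb hm le_rfl))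
  rw [eq_bot_iff, ← h]
  exact Submodule.orthogonal_le (iSup_le fun β => eigenspace_res_le hQ hb hm β)

theorem finiteDimensional_specSpace (hm : 0 < m) (μ : ℝ) :
    FiniteDimensional ℂ (specSpace N a Q μ) := by
  by_cases h : specSpace N a Q μ = ⊥
  · rw [h]; infer_instance
  have hpos := specSpace_pos hQ hb h
  have hne : ((μ + m : ℝ) : ℂ) ≠ 0 := by exact_mod_cast (by linarith : (0 : ℝ) < μ + m).ne'
  have := ContinuousLinearMap.finite_dimensional_eigenspace
    (isCompactOperator_res hQ hb hm le_rfl) (((μ + m : ℝ) : ℂ)⁻¹) (inv_ne_zero hne)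
  refine Submodule.finiteDimensional_of_le (S₂ := Module.End.eigenspace
    (res hQ hm).toLinearMap (((μ + m : ℝ) : ℂ)⁻¹)) fun f hf => ?_
  rw [Module.End.mem_eigenspace_iff]
  have h1 := res_of_mem_specSpace hQ hb hm le_rfl hf
  change res hQ hm f = _
  conv_rhs => rw [← h1]
  rw [smul_smul, inv_mul_cancel₀ hne, one_smul]

theorem exists_eigenbasis (hm : 0 < m) :
    ∃ v : HilbertBasis (Σ μ : ℝ, Fin (multiplicity a Q μ)) ℂ (CircleL2 N a),
      ∀ k, v k ∈ specSpace N a Q k.1 := by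
  have hfin := finiteDimensional_specSpace hQ hb hm
  let b := fun μ : ℝ => (stdOrthonormalBasis ℂ (specSpace N a Q μ)).reindex
    (finCongr (finrank_specSpace (Q := Q) (a := a) μ))
  have ho := (specSpace_orthogonal hQ hb hm).orthonormal_sigma_orthonormal
    (v_family := fun μ => ⇑(b μ)) (fun μ => (b μ).orthonormal)
  refine ⟨HilbertBasis.mkOfOrthogonalEqBot ho ?_, fun k => ?_⟩
  · rw [eq_bot_iff, ← specSpace_complete hQ hb hm]
    refine Submodule.orthogonal_le (iSup_le fun μ f hf => ?_)
    have h1 := (b μ).sum_repr ⟨f, hf⟩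
    have h2 := congrArg Subtype.val h1
    rw [← show _ = f from h2, Submodule.coe_sum]
    exact Submodule.sum_mem _ fun i _ => Submodule.smul_mem _ _
      (Submodule.subset_span ⟨⟨μ, i⟩, rfl⟩)
  · rw [HilbertBasis.coe_mkOfOrthogonalEqBot]
    exact (b k.1 k.2).2

/-- The trace does not depend on the orthonormal basis: the two sums are the iterated sums, in
either order, of the nonnegative family `(μ_k + w)⁻¹ |⟨e_p, v_k⟩|²`. Grouping the eigenbasis by
eigenvalue produces the multiplicities. -/
theorem hasSum_resolvent_trace (hm : 0 < m) (hw : 0 < w) (hmw : m ≤ w) {T : ℝ}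
    (hsum : HasSum (fun p => (⟪circleBasis N a p, res hQ hw (circleBasis N a p)⟫).re) T) :
    HasSum (fun μ : ℝ => multiplicity a Q μ * (μ + w)⁻¹) T := by
  obtain ⟨v, hv⟩ := exists_eigenbasis hQ hb hm
  have hpos : ∀ k : Σ μ : ℝ, Fin (multiplicity a Q μ), 0 < k.1 + w := fun k => by
    have hne : specSpace N a Q k.1 ≠ ⊥ := fun h => by
      have := hv k
      rw [h] at this
      exact v.orthonormal.ne_zero k this
    have := specSpace_pos hQ hb hne
    linarith
  have hres : ∀ k, res hQ hw (v k) = (((k.1 + w)⁻¹ : ℝ) : ℂ) • v k := fun k => by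
    have h1 := res_of_mem_specSpace hQ hb hw hmw (hv k)
    have hne : ((k.1 + w : ℝ) : ℂ) ≠ 0 := by exact_mod_cast (hpos k).ne'
    conv_rhs => rw [← h1]
    rw [smul_smul, ofReal_inv, inv_mul_cancel₀ hne, one_smul]
  have hsymm := ContinuousLinearMap.isSelfAdjoint_iff_isSymmetric.1
    (isSelfAdjoint_res hQ hb hw hmw)
  let F : (ℤ × Fin N) × (Σ μ : ℝ, Fin (multiplicity a Q μ)) → ℝ := fun q =>
    (q.2.1 + w)⁻¹ * ‖⟪circleBasis N a q.1, v q.2⟫‖ ^ 2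
  have hF0 : 0 ≤ F := fun q => by
    have := hpos q.2
    simp only [F, Pi.zero_apply]; positivity
  have h1 : ∀ p, HasSum (fun k => F (p, k))
      (⟪circleBasis N a p, res hQ hw (circleBasis N a p)⟫).re := fun p => by
    have h := Complex.hasSum_re (v.hasSum_inner_mul_inner (circleBasis N a p)
      (res hQ hw (circleBasis N a p)))
    refine h.congr_fun fun k => ?_
    have e : ⟪v k, res hQ hw (circleBasis N a p)⟫
        = (((k.1 + w)⁻¹ : ℝ) : ℂ) * ⟪v k, circleBasis N a p⟫ := by
      have h : ⟪res hQ hw (v k), circleBasis N a p⟫ = ⟪v k, res hQ hw (circleBasis N a p)⟫ :=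
        hsymm (v k) (circleBasis N a p)
      rw [← h, hres k, inner_smul_left, conj_ofReal]
    rw [e, mul_left_comm, ← inner_conj_symm (v k), mul_conj']
    simp only [F]
    norm_cast
  have hFs : Summable F := by
    rw [summable_prod_of_nonneg hF0]
    refine ⟨fun p => (h1 p).summable, ?_⟩
    simp_rw [(h1 _).tsum_eq]
    exact hsum.summable
  have hFT : HasSum F T := by
    have := hFs.hasSum
    have h2 := this.prod_fiberwise h1
    rwa [h2.unique hsum] at this
  have h3 : ∀ k, HasSum (fun p => F (p, k)) (k.1 + w)⁻¹ := fun k => by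
    have h := Complex.hasSum_re ((circleBasis N a).hasSum_inner_mul_inner (v k) (v k))
    have e : (⟪v k, v k⟫).re = 1 := by
      rw [inner_self_eq_norm_sq_to_K, v.orthonormal.1]; simp
    rw [e] at h
    have h' := h.mul_left (k.1 + w)⁻¹
    rw [mul_one] at h'
    refine h'.congr_fun fun p => ?_
    simp only [F]
    congr 1
    rw [← inner_conj_symm (v k) (circleBasis N a p), conj_mul']
    norm_cast
  have h4 := ((Equiv.prodComm _ _).hasSum_iff.2 hFT).prod_fiberwise (g := fun k :
    (Σ μ : ℝ, Fin (multiplicity a Q μ)) => (k.1 + w)⁻¹) h3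
  have h5 := h4.sigma (fun μ => hasSum_fintype _)
  simpa using h5

end Trace

end

section

/-! ### Mellin transforms -/

theorem ofReal_exp_cpow (r : ℝ) (z : ℂ) : ((Real.exp r : ℝ) : ℂ) ^ z = cexp (r * z) := by
  rw [cpow_def_of_ne_zero (by exact_mod_cast (Real.exp_pos r).ne'), ← ofReal_log (Real.exp_pos r).le,
    Real.log_exp]

/-- The substitution `t = νx/(1 - x)` maps the unit interval onto the half line and turns the Mellin
integral into the beta integral of `u` and `p - u`. -/
theorem hasMellin_add_rpow_neg {ν p : ℝ} (hν : 0 < ν) {u : ℂ} (hu : 0 < u.re) (hup : u.re < p) :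
    HasMellin (fun t : ℝ => (((ν + t) ^ (-p) : ℝ) : ℂ)) u
      ((ν : ℂ) ^ (u - p) * (Gamma u * Gamma (p - u) / Gamma p)) := by
  let φ : ℝ → ℝ := fun x => ν * x / (1 - x)
  let φ' : ℝ → ℝ := fun x => ν / (1 - x) ^ 2
  have hd : ∀ x ∈ Set.Ioo (0 : ℝ) 1, HasDerivWithinAt φ (φ' x) (Set.Ioo 0 1) x := fun x hx => by
    have h1 : (1 - x) ≠ 0 := by linarith [hx.2]
    have h := ((hasDerivAt_id x).const_mul ν).div ((hasDerivAt_id x).const_sub 1) h1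
    refine (h.congr_deriv ?_).hasDerivWithinAt
    simp only [id, φ']
    field_simp
    ring
  have hinj : Set.InjOn φ (Set.Ioo 0 1) := fun x hx y hy h => by
    have h1 : (1 - x) ≠ 0 := by linarith [hx.2]
    have h2 : (1 - y) ≠ 0 := by linarith [hy.2]
    simp only [φ] at h
    field_simp at h
    linarith
  have himg : φ '' Set.Ioo 0 1 = Set.Ioi 0 := by
    ext t
    constructor
    · rintro ⟨x, hx, rfl⟩
      have : 0 < 1 - x := by linarith [hx.2]
      exact div_pos (mul_pos hν hx.1) this
    · intro ht
      have ht' : (0 : ℝ) < t := ht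
      have h1 : 0 < ν + t := by linarith
      refine ⟨t / (ν + t), ⟨by positivity, by rw [div_lt_one h1]; linarith⟩, ?_⟩
      simp only [φ]
      have : 1 - t / (ν + t) = ν / (ν + t) := by field_simp; ring
      rw [this]
      field_simp
  have key : ∀ x ∈ Set.Ioo (0 : ℝ) 1,
      |φ' x| • ((φ x : ℂ) ^ (u - 1) • (((ν + φ x) ^ (-p) : ℝ) : ℂ))
        = (ν : ℂ) ^ (u - p) * ((x : ℂ) ^ (u - 1) * (1 - (x : ℂ)) ^ (p - u - 1)) := fun x hx => by
    have h1 : 0 < 1 - x := by linarith [hx.2]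
    -- Writing `ν`, `x` and `1 - x` as exponentials reduces an identity of complex powers to a
    -- linear one between exponents.
    obtain ⟨L, hL⟩ : ∃ L, Real.exp L = ν := ⟨_, Real.exp_log hν⟩
    obtain ⟨X, hX⟩ : ∃ L, Real.exp L = x := ⟨_, Real.exp_log hx.1⟩
    obtain ⟨Y, hY⟩ : ∃ L, Real.exp L = 1 - x := ⟨_, Real.exp_log h1⟩
    have e1 : φ x = Real.exp (L + X - Y) := by
      rw [Real.exp_sub, Real.exp_add, hL, hX, hY]
    have e2 : ν + φ x = Real.exp (L - Y) := by
      rw [Real.exp_sub, hL, hY]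
      simp only [φ]
      field_simp
      ring
    have e3 : |φ' x| = Real.exp (L - 2 * Y) := by
      rw [Real.exp_sub, two_mul, Real.exp_add, hL, hY, abs_of_pos (by simp only [φ']; positivity)]
      simp only [φ', sq]
    have e4 : (1 : ℂ) - x = ((1 - x : ℝ) : ℂ) := by push_cast; rfl
    rw [e2, e3, e1, e4, ← hY, ← hX, ← hL, ← Real.exp_mul, ofReal_exp_cpow, ofReal_exp_cpow,
      ofReal_exp_cpow, ofReal_exp_cpow, real_smul, smul_eq_mul, ofReal_exp, ofReal_exp,
      ← Complex.exp_add, ← Complex.exp_add, ← Complex.exp_add, ← Complex.exp_add]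
    congr 1
    push_cast
    ring
  have hv : 0 < ((p : ℂ) - u).re := by simp; linarith
  have hb := betaIntegral_convergent hu hv
  have hB := betaIntegral_eq_Gamma_mul_div u (p - u) hu hv
  rw [intervalIntegrable_iff_integrableOn_Ioo_of_le zero_le_one] at hb
  rw [betaIntegral, intervalIntegral.integral_of_le zero_le_one, integral_Ioc_eq_integral_Ioo,
    add_sub_cancel] at hB
  constructor
  · rw [MellinConvergent, ← himg,
      integrableOn_image_iff_integrableOn_abs_deriv_smul measurableSet_Ioo hd hinj]
    exact IntegrableOn.congr_fun (hb.const_mul ((ν : ℂ) ^ (u - p)))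
      (fun x hx => (key x hx).symm) measurableSet_Ioo
  · rw [mellin, ← himg, integral_image_eq_integral_abs_deriv_smul measurableSet_Ioo hd hinj,
      setIntegral_congr_fun measurableSet_Ioo key, integral_const_mul, hB]

/-- Decay of order `r` at infinity of a function continuous on the half line. -/
def Decay (r : ℝ) (f : ℝ → ℂ) : Prop :=
  ContinuousOn f (Set.Ici 0) ∧ f =O[atTop] fun t => t ^ (-r)

namespace Decay

variable {r : ℝ} {f g : ℝ → ℂ}

theorem add (hf : Decay r f) (hg : Decay r g) : Decay r fun t => f t + g t :=
  ⟨hf.1.add hg.1, hf.2.add hg.2⟩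

theorem const_mul (hf : Decay r f) (c : ℂ) : Decay r fun t => c * f t :=
  ⟨continuousOn_const.mul hf.1, hf.2.const_mul_left c⟩

theorem sum {ι : Type*} {s : Finset ι} {F : ι → ℝ → ℂ} (h : ∀ i ∈ s, Decay r (F i)) :
    Decay r fun t => ∑ i ∈ s, F i t :=
  ⟨continuousOn_finsetSum s fun i hi => (h i hi).1,
    by simpa only [Finset.sum_apply] using Asymptotics.IsBigO.fun_sum fun i hi => (h i hi).2⟩

theorem of_bound (hf : ContinuousOn f (Set.Ici 0)) (hr : 0 ≤ r) {C w : ℝ} (hw : 0 < w)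
    (h : ∀ t, 0 ≤ t → ‖f t‖ ≤ C * (w + t) ^ (-r)) : Decay r f := by
  refine ⟨hf, Asymptotics.IsBigO.of_bound |C| ?_⟩
  filter_upwards [eventually_gt_atTop 0] with t ht
  refine (h t ht.le).trans ?_
  rw [Real.norm_of_nonneg (by positivity)]
  have h1 : (w + t) ^ (-r) ≤ t ^ (-r) :=
    Real.rpow_le_rpow_of_nonpos ht (by linarith) (by linarith)
  have h2 : 0 ≤ (w + t) ^ (-r) := by positivity
  exact mul_le_mul (le_abs_self C) h1 h2 (abs_nonneg C)

theorem mono (hf : Decay r f) {r' : ℝ} (h : r' ≤ r) : Decay r' f := by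
  refine ⟨hf.1, hf.2.trans (Asymptotics.IsBigO.of_bound 1 ?_)⟩
  filter_upwards [eventually_ge_atTop 1] with t ht
  rw [one_mul, Real.norm_of_nonneg (by positivity), Real.norm_of_nonneg (by positivity)]
  exact Real.rpow_le_rpow_of_exponent_le ht (by linarith)

theorem locallyIntegrableOn (hf : Decay r f) : LocallyIntegrableOn f (Set.Ioi 0) :=
  (hf.1.mono Set.Ioi_subset_Ici_self).locallyIntegrableOn measurableSet_Ioi

theorem isBigO_zero (hf : Decay r f) : f =O[𝓝[>] 0] fun t : ℝ => t ^ (-(0 : ℝ)) := by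
  simp only [neg_zero, Real.rpow_zero]
  have h := (hf.1 0 Set.self_mem_Ici).mono Set.Ioi_subset_Ici_self
  exact h.tendsto.isBigO_one ℝ

theorem mellinConvergent (hf : Decay r f) {u : ℂ} (hu : 0 < u.re) (hur : u.re < r) :
    MellinConvergent f u :=
  mellinConvergent_of_isBigO_rpow hf.locallyIntegrableOn hf.2 hur hf.isBigO_zero hu

theorem differentiableAt_mellin (hf : Decay r f) {u : ℂ} (hu : 0 < u.re) (hur : u.re < r) :
    DifferentiableAt ℂ (mellin f) u :=
  mellin_differentiableAt_of_isBigO_rpow hf.locallyIntegrableOn hf.2 hur hf.isBigO_zero hu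

end Decay

/-- The transform `s ↦ (sin π s / π) ∫₀^∞ t^(-s) f(t) dt`, which takes `t ↦ (ν + t)⁻¹` to
`s ↦ ν^(-s)`. -/
def powerTransform (f : ℝ → ℂ) (s : ℂ) : ℂ := sin (Real.pi * s) / Real.pi * mellin f (1 - s)

namespace Decay

variable {r : ℝ} {f g : ℝ → ℂ}

theorem differentiableAt_powerTransform (hf : Decay r f) {s : ℂ} (h1 : s.re < 1)
    (h2 : 1 - r < s.re) : DifferentiableAt ℂ (powerTransform f) s := by
  have h : DifferentiableAt ℂ (fun s => mellin f (1 - s)) s :=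
    DifferentiableAt.comp s (g := mellin f) (f := fun s => 1 - s)
      (hf.differentiableAt_mellin (by simp; linarith) (by simp; linarith)) (by fun_prop)
  unfold powerTransform
  fun_prop

theorem powerTransform_add (hf : Decay r f) (hg : Decay r g) {s : ℂ} (h1 : s.re < 1)
    (h2 : 1 - r < s.re) :
    powerTransform (fun t => f t + g t) s = powerTransform f s + powerTransform g s := by
  have hu : 0 < (1 - s).re := by simp; linarith
  have hur : (1 - s).re < r := by simp; linarith
  simp only [powerTransform]
  rw [(hasMellin_add (hf.mellinConvergent hu hur) (hg.mellinConvergent hu hur)).2, mul_add]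

theorem powerTransform_const_mul (c : ℂ) (f : ℝ → ℂ) (s : ℂ) :
    powerTransform (fun t => c * f t) s = c * powerTransform f s := by
  have := mellin_const_smul f (1 - s) c
  simp only [smul_eq_mul] at this
  simp only [powerTransform, this]
  ring

theorem powerTransform_sum {ι : Type*} {S : Finset ι} {F : ι → ℝ → ℂ}
    (h : ∀ i ∈ S, Decay r (F i)) {s : ℂ} (h1 : s.re < 1) (h2 : 1 - r < s.re) :
    powerTransform (fun t => ∑ i ∈ S, F i t) s = ∑ i ∈ S, powerTransform (F i) s := by
  classical
  induction S using Finset.induction_on with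
  | empty => simp [powerTransform, mellin]
  | insert i S hi ih =>
    simp only [Finset.sum_insert hi]
    rw [powerTransform_add (h i (Finset.mem_insert_self i S))
      (Decay.sum fun j hj => h j (Finset.mem_insert_of_mem hj)) h1 h2,
      ih fun j hj => h j (Finset.mem_insert_of_mem hj)]

/-- The prefactor `sin πs / π` vanishes at `0` with derivative one, so only the value at `1` of the
Mellin transform survives; `1 < r` makes the transform holomorphic there. -/
theorem hasDerivAt_powerTransform_zero (hf : Decay r f) (hr : 1 < r) :
    HasDerivAt (powerTransform f) (∫ t in Set.Ioi (0 : ℝ), f t) 0 := by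
  have h : DifferentiableAt ℂ (fun s => mellin f (1 - s)) 0 :=
    DifferentiableAt.comp (0 : ℂ) (g := mellin f) (f := fun s => 1 - s)
      (hf.differentiableAt_mellin (by simp) (by simpa)) (by fun_prop)
  have h1 : HasDerivAt (fun s : ℂ => sin (Real.pi * s) / Real.pi) 1 0 := by
    have := (((hasDerivAt_id (0 : ℂ)).const_mul (Real.pi : ℂ)).csin).div_const (Real.pi : ℂ)
    refine this.congr_deriv ?_
    have hpi : (Real.pi : ℂ) ≠ 0 := by exact_mod_cast Real.pi_ne_zero
    simp [hpi]
  refine (h1.mul h.hasDerivAt).congr_deriv ?_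
  simp [mellin]

end Decay

end

section

/-! ### Power transforms of sums -/

theorem integral_rpow_mul_add_rpow_neg {ν p : ℝ} (hν : 0 < ν) {σ : ℝ} (hu : 0 < σ) (hup : σ < p) :
    ∫ t in Set.Ioi (0 : ℝ), t ^ (σ - 1) * (ν + t) ^ (-p)
      = ν ^ (σ - p) * (Real.Gamma σ * Real.Gamma (p - σ) / Real.Gamma p) := by
  have h := (hasMellin_add_rpow_neg hν (u := (σ : ℂ)) (by simpa) (by simpa : ((σ : ℂ)).re < p)).2
  rw [mellin] at h
  apply ofReal_injective
  rw [← integral_complex_ofReal]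
  have h2 : ∫ t in Set.Ioi (0 : ℝ), ((t ^ (σ - 1) * (ν + t) ^ (-p) : ℝ) : ℂ)
      = ∫ t in Set.Ioi (0 : ℝ), (t : ℂ) ^ ((σ : ℂ) - 1) • (((ν + t) ^ (-p) : ℝ) : ℂ) := by
    refine setIntegral_congr_fun measurableSet_Ioi fun t ht => ?_
    have ht' : (0 : ℝ) ≤ t := le_of_lt ht
    simp only [smul_eq_mul]
    rw [ofReal_mul, ofReal_cpow ht']
    push_cast
    rfl
  rw [h2, h]
  push_cast [ofReal_cpow hν.le, Complex.Gamma_ofReal]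
  rw [← Complex.Gamma_ofReal, ← Complex.Gamma_ofReal, ← Complex.Gamma_ofReal]
  push_cast
  rfl

theorem norm_cpow_mul_add_rpow_neg {ν p : ℝ} (hν : 0 < ν) (c u : ℂ) {t : ℝ} (ht : 0 < t) :
    ‖(t : ℂ) ^ (u - 1) • (c * (((ν + t) ^ (-p) : ℝ) : ℂ))‖
      = ‖c‖ * (t ^ (u.re - 1) * (ν + t) ^ (-p)) := by
  rw [smul_eq_mul, norm_mul, norm_mul, norm_real, norm_cpow_eq_rpow_re_of_pos ht,
    Real.norm_of_nonneg (by positivity)]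
  simp
  ring

theorem hasSum_mellin {ι : Type*} [Countable ι] {c : ι → ℂ} {ν : ι → ℝ} (hν : ∀ i, 0 < ν i)
    {p : ℝ} {u : ℂ} (hu : 0 < u.re) (hup : u.re < p)
    (hs : Summable fun i => ‖c i‖ * ν i ^ (u.re - p)) {T : ℝ → ℂ}
    (hT : ∀ t, 0 ≤ t → HasSum (fun i => c i * (((ν i + t) ^ (-p) : ℝ) : ℂ)) (T t)) :
    HasSum (fun i => c i * ((ν i : ℂ) ^ (u - p) * (Gamma u * Gamma (p - u) / Gamma p)))
      (mellin T u) := by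
  have hm := fun i => hasMellin_add_rpow_neg (hν i) hu hup
  have h1 : ∀ i, IntegrableOn (fun t : ℝ => (t : ℂ) ^ (u - 1) •
      (c i * (((ν i + t) ^ (-p) : ℝ) : ℂ))) (Set.Ioi 0) := fun i =>
    (hm i).1.const_smul (c i)
  have h2 : Summable fun i => ∫ t in Set.Ioi (0 : ℝ), ‖(t : ℂ) ^ (u - 1) •
      (c i * (((ν i + t) ^ (-p) : ℝ) : ℂ))‖ := by
    refine (hs.mul_right (Real.Gamma u.re * Real.Gamma (p - u.re) / Real.Gamma p)).congr
      fun i => ?_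
    rw [setIntegral_congr_fun measurableSet_Ioi
      fun t ht => norm_cpow_mul_add_rpow_neg (hν i) (c i) u ht, integral_const_mul,
      integral_rpow_mul_add_rpow_neg (hν i) hu hup, mul_assoc]
  have h3 := hasSum_integral_of_summable_integral_norm h1 h2
  have h4 : ∫ t in Set.Ioi (0 : ℝ), ∑' i, (t : ℂ) ^ (u - 1) •
      (c i * (((ν i + t) ^ (-p) : ℝ) : ℂ)) = mellin T u := by
    rw [mellin]
    refine setIntegral_congr_fun measurableSet_Ioi fun t ht => ?_
    exact ((hT t (le_of_lt ht)).const_smul _).tsum_eq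
  rw [h4] at h3
  refine h3.congr_fun fun i => ?_
  have h5 := mellin_const_smul (fun t : ℝ => (((ν i + t) ^ (-p) : ℝ) : ℂ)) u (c i)
  simp only [smul_eq_mul, (hm i).2] at h5
  exact h5.symm

theorem continuousOn_of_hasSum {ι : Type*} {c : ι → ℂ} {ν : ι → ℝ}
    (hν : ∀ i, c i ≠ 0 → 0 < ν i) {p : ℝ} (hp : 0 ≤ p)
    (hs : Summable fun i => ‖c i‖ * ν i ^ (-p)) {T : ℝ → ℂ}
    (hT : ∀ t, 0 ≤ t → HasSum (fun i => c i * (((ν i + t) ^ (-p) : ℝ) : ℂ)) (T t)) :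
    ContinuousOn T (Set.Ici 0) := by
  have h : ContinuousOn (fun t => ∑' i, c i * (((ν i + t) ^ (-p) : ℝ) : ℂ)) (Set.Ici 0) := by
    refine continuousOn_tsum (fun i t ht => ?_) hs fun i t ht => ?_
    all_goals
      have ht' : (0 : ℝ) ≤ t := ht
      rcases eq_or_ne (c i) 0 with hc | hc
    · simp only [hc, zero_mul]
      exact continuousWithinAt_const
    · have := hν i hc
      refine ContinuousAt.continuousWithinAt ?_
      have h1 : ContinuousAt (fun t : ℝ => (ν i + t) ^ (-p)) t :=
        ContinuousAt.rpow_const (by fun_prop) (Or.inl (by positivity))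
      exact continuousAt_const.mul (continuous_ofReal.continuousAt.comp h1)
    · simp [hc]
    · have := hν i hc
      rw [norm_mul, norm_real, Real.norm_of_nonneg (by positivity)]
      gcongr ‖c i‖ * ?_
      exact Real.rpow_le_rpow_of_nonpos this (by linarith) (by linarith)
  exact h.congr fun t ht => (hT t ht).tsum_eq.symm

/-- Euler's reflection formula, for the gamma factor that the beta integral leaves when `p = 1`. -/
theorem sin_mul_Gamma {s : ℂ} (h0 : 0 < s.re) (h1 : s.re < 1) :
    sin (Real.pi * s) / Real.pi * (Gamma (1 - s) * Gamma s) = 1 := by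
  have h2 := Gamma_mul_Gamma_one_sub s
  have h3 : Gamma s * Gamma (1 - s) ≠ 0 :=
    mul_ne_zero (Gamma_ne_zero_of_re_pos h0) (Gamma_ne_zero_of_re_pos (by simp; linarith))
  have h4 : sin (Real.pi * s) ≠ 0 := fun h => by
    rw [h, div_zero] at h2
    exact h3 h2
  have hpi : (Real.pi : ℂ) ≠ 0 := by exact_mod_cast Real.pi_ne_zero
  rw [mul_comm (Gamma (1 - s)), h2]
  field_simp

/-! ### Dirichlet series as power transforms of resolvent traces. -/

section Dirichlet

variable {ι : Type*} {c : ι → ℝ} {ν : ι → ℝ} {ν₀ r : ℝ} {T : ℝ → ℝ}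

/-- Convergence is read off from the decay of `T`, without counting eigenvalues. By positivity the
Mellin integrals of finite partial sums are bounded by that of `T`, and each term integrates to a
fixed constant times `c i * ν i ^ (-σ)`. -/
theorem summable_rpow_of_decay (hc : ∀ i, 0 ≤ c i) (hν : ∀ i, 0 < ν i)
    (hT : ∀ t, 0 ≤ t → HasSum (fun i => c i * (ν i + t)⁻¹) (T t))
    (hd : Decay r fun t => (T t : ℂ)) {σ : ℝ} (h1 : σ < 1) (h2 : 1 - r < σ) (h0 : 0 < σ) :
    Summable fun i => c i * ν i ^ (-σ) := by
  set B := Real.Gamma (1 - σ) * Real.Gamma (1 - (1 - σ)) / Real.Gamma 1 with hB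
  have hB0 : 0 < B := by
    have := Real.Gamma_pos_of_pos (show 0 < 1 - σ by linarith)
    have := Real.Gamma_pos_of_pos (show 0 < 1 - (1 - σ) by linarith)
    have := Real.Gamma_pos_of_pos one_pos
    positivity
  have hconv := (hd.mellinConvergent (u := ((1 - σ : ℝ) : ℂ)) (by simp; linarith)
    (by simp; linarith)).norm
  refine summable_of_sum_le (c := B⁻¹ * ∫ t in Set.Ioi (0 : ℝ),
    ‖(t : ℂ) ^ (((1 - σ : ℝ) : ℂ) - 1) • (T t : ℂ)‖)
    (fun i => mul_nonneg (hc i) (Real.rpow_nonneg (hν i).le _)) fun S => ?_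
  rw [← div_eq_inv_mul, le_div_iff₀ hB0, Finset.sum_mul]
  have hi : ∀ i ∈ S, IntegrableOn (fun t : ℝ => c i * (t ^ ((1 - σ) - 1) * (ν i + t) ^ (-(1 : ℝ))))
      (Set.Ioi 0) := fun i _ => by
    have h := (hasMellin_add_rpow_neg (p := 1) (hν i) (u := ((1 - σ : ℝ) : ℂ)) (by simp; linarith)
      (by simp; linarith)).1.norm
    refine (IntegrableOn.congr_fun h (fun t ht => ?_) measurableSet_Ioi).const_mul (c i)
    have := norm_cpow_mul_add_rpow_neg (p := 1) (hν i) 1 ((1 - σ : ℝ) : ℂ) ht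
    simpa using this
  calc ∑ i ∈ S, c i * ν i ^ (-σ) * B
      = ∑ i ∈ S, ∫ t in Set.Ioi (0 : ℝ), c i * (t ^ ((1 - σ) - 1) * (ν i + t) ^ (-(1 : ℝ))) := by
        refine Finset.sum_congr rfl fun i _ => ?_
        rw [integral_const_mul, integral_rpow_mul_add_rpow_neg (hν i) (by linarith) (by linarith),
          ← hB, mul_assoc, show 1 - σ - 1 = -σ by ring]
    _ = ∫ t in Set.Ioi (0 : ℝ), ∑ i ∈ S, c i * (t ^ ((1 - σ) - 1) * (ν i + t) ^ (-(1 : ℝ))) :=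
        (integral_finsetSum S hi).symm
    _ ≤ _ := by
        refine setIntegral_mono_on (integrable_finsetSum S hi) hconv measurableSet_Ioi
          fun t ht => ?_
        have ht' : (0 : ℝ) < t := ht
        have hT0 : 0 ≤ T t := (hT t ht'.le).nonneg fun i =>
          mul_nonneg (hc i) (inv_nonneg.2 (by have := hν i; positivity))
        rw [norm_smul, norm_cpow_eq_rpow_re_of_pos ht', norm_real, Real.norm_of_nonneg hT0]
        have h3 := sum_le_hasSum S (fun i _ =>
          mul_nonneg (hc i) (inv_nonneg.2 (by have := hν i; positivity))) (hT t ht'.le)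
        have h4 : (((1 - σ : ℝ) : ℂ) - 1).re = 1 - σ - 1 := by simp
        rw [h4]
        calc _ = t ^ (1 - σ - 1) * ∑ i ∈ S, c i * (ν i + t)⁻¹ := by
              rw [Finset.mul_sum]
              refine Finset.sum_congr rfl fun i _ => ?_
              rw [Real.rpow_neg_one]
              ring
          _ ≤ _ := by gcongr

theorem rpow_neg_le_of_le (h0 : 0 < ν₀) {x : ℝ} (hx : ν₀ ≤ x) {σ τ : ℝ} (h : σ ≤ τ) :
    x ^ (-τ) ≤ ν₀ ^ (σ - τ) * x ^ (-σ) := by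
  have hx0 : 0 < x := h0.trans_le hx
  rw [show -τ = (σ - τ) + -σ by ring, Real.rpow_add hx0]
  gcongr ?_ * _
  exact Real.rpow_le_rpow_of_nonpos h0 hx (by linarith)

/-- The two boundary exponents of a vertical strip dominate all those between them, which provides
the summable majorant needed for holomorphy. -/
theorem rpow_neg_le_add {x : ℝ} (hx : 0 < x) {σ τ ρ : ℝ} (h1 : σ ≤ τ) (h2 : τ ≤ ρ) :
    x ^ (-τ) ≤ x ^ (-σ) + x ^ (-ρ) := by
  have e1 : 0 ≤ x ^ (-σ) := by positivity
  have e2 : 0 ≤ x ^ (-ρ) := by positivity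
  rcases le_total 1 x with h | h
  · have := Real.rpow_le_rpow_of_exponent_le h (by linarith : -τ ≤ -σ)
    linarith
  · have := Real.rpow_le_rpow_of_exponent_ge hx h (by linarith : -ρ ≤ -τ)
    linarith

theorem exists_dirichlet_of_countable [Countable ι] (hc : ∀ i, 0 ≤ c i) (h0 : 0 < ν₀)
    (hν : ∀ i, ν₀ ≤ ν i) (hT : ∀ t, 0 ≤ t → HasSum (fun i => c i * (ν i + t)⁻¹) (T t))
    (hr0 : 0 < r) (hr : r < 1) (hd : Decay r fun t => (T t : ℂ)) :
    ∃ D : ℂ → ℂ, (∀ s : ℂ, 1 - r < s.re → HasSum (fun i => (c i : ℂ) * (ν i : ℂ) ^ (-s)) (D s) ∧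
      DifferentiableAt ℂ D s) ∧
      ∀ s : ℂ, 1 - r < s.re → s.re < 1 → D s = powerTransform (fun t => T t) s := by
  have hν' : ∀ i, 0 < ν i := fun i => h0.trans_le (hν i)
  have hsum : ∀ σ : ℝ, 1 - r < σ → Summable fun i => c i * ν i ^ (-σ) := fun σ hσ => by
    -- The integral argument covers only exponents below one. A larger `σ` is reduced to such a `τ`
    -- by means of the positive lower bound `ν₀`.
    obtain ⟨τ, hτ1, hτ2⟩ := exists_between (lt_min hσ (by linarith : 1 - r < 1))
    have h := summable_rpow_of_decay hc hν' hT hd (σ := τ) (hτ2.trans_le (min_le_right _ _)) hτ1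
      (by linarith)
    refine Summable.of_nonneg_of_le (fun i => mul_nonneg (hc i) (Real.rpow_nonneg (hν' i).le _))
      (fun i => ?_) (h.mul_left (ν₀ ^ (τ - σ)))
    calc _ ≤ c i * (ν₀ ^ (τ - σ) * ν i ^ (-τ)) :=
          mul_le_mul_of_nonneg_left (rpow_neg_le_of_le h0 (hν i)
            (hτ2.le.trans (min_le_left _ _))) (hc i)
      _ = _ := by ring
  have hnorm : ∀ i (s : ℂ), ‖(c i : ℂ) * (ν i : ℂ) ^ (-s)‖ = c i * ν i ^ (-s.re) := fun i s => by
    rw [norm_mul, norm_real, Real.norm_of_nonneg (hc i), norm_cpow_eq_rpow_re_of_pos (hν' i),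
      neg_re]
  have hS : ∀ s : ℂ, 1 - r < s.re → HasSum (fun i => (c i : ℂ) * (ν i : ℂ) ^ (-s))
      (∑' i, (c i : ℂ) * (ν i : ℂ) ^ (-s)) := fun s hs =>
    (Summable.of_norm (by simpa only [hnorm] using hsum _ hs)).hasSum
  refine ⟨fun s => ∑' i, (c i : ℂ) * (ν i : ℂ) ^ (-s), fun s hs => ⟨hS s hs, ?_⟩,
    fun s hs1 hs2 => ?_⟩
  · obtain ⟨τ, hτ1, hτ2⟩ := exists_between hs
    have hU : IsOpen {z : ℂ | τ < z.re ∧ z.re < s.re + 1} :=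
      (isOpen_lt continuous_const continuous_re).inter (isOpen_lt continuous_re continuous_const)
    refine (differentiableOn_tsum_of_summable_norm ((hsum τ hτ1).add
      (hsum (s.re + 1) (by linarith))) (fun i z hz => ?_) hU
      (fun i z hz => ?_)).differentiableAt (hU.mem_nhds ⟨hτ2, by linarith⟩)
    · have : (ν i : ℂ) ≠ 0 := by exact_mod_cast (hν' i).ne'
      exact (DifferentiableAt.const_mul (DifferentiableAt.const_cpow (by fun_prop) (Or.inl this))
        _).differentiableWithinAt
    · rw [hnorm, ← mul_add]
      exact mul_le_mul_of_nonneg_left (rpow_neg_le_add (hν' i) hz.1.le hz.2.le) (hc i)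
  · have hu0 : 0 < (1 - s).re := by simp; linarith
    have hu1 : (1 - s).re < (1 : ℝ) := by simp; linarith
    have h := hasSum_mellin hν' (c := fun i => (c i : ℂ)) (p := 1) hu0 hu1
      (by
        have := hsum _ hs1
        simpa [abs_of_nonneg (hc _)] using this) (T := fun t => (T t : ℂ)) (fun t ht => by
        have := ofRealCLM.hasSum (hT t ht)
        simpa [Real.rpow_neg_one] using this)
    have h' := h.mul_left (sin (Real.pi * s) / Real.pi)
    refine HasSum.unique (hS s hs1) (HasSum.congr_fun h' fun i => ?_)
    have h3 := sin_mul_Gamma (by linarith : 0 < s.re) hs2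
    have h4 : (1 - s - ((1 : ℝ) : ℂ)) = -s := by push_cast; ring
    have h5 : (((1 : ℝ) : ℂ) - (1 - s)) = s := by push_cast; ring
    rw [h4, h5, ofReal_one, Gamma_one, div_one]
    linear_combination (-(c i : ℂ) * (ν i : ℂ) ^ (-s)) * h3

/-- Meant for sums over all real `μ` weighted by multiplicity. Summability at `t = 0` leaves only
countably many nonzero weights. -/
theorem exists_dirichlet (hc : ∀ i, 0 ≤ c i) (h0 : 0 < ν₀)
    (hν : ∀ i, c i ≠ 0 → ν₀ ≤ ν i) (hT : ∀ t, 0 ≤ t → HasSum (fun i => c i * (ν i + t)⁻¹) (T t))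
    (hr0 : 0 < r) (hr : r < 1) (hd : Decay r fun t => (T t : ℂ)) :
    ∃ D : ℂ → ℂ, (∀ s : ℂ, 1 - r < s.re → HasSum (fun i => (c i : ℂ) * (ν i : ℂ) ^ (-s)) (D s) ∧
      DifferentiableAt ℂ D s) ∧
      ∀ s : ℂ, 1 - r < s.re → s.re < 1 → D s = powerTransform (fun t => T t) s := by
  have hcount : (Function.support c).Countable := by
    refine (hT 0 le_rfl).summable.countable_support.mono fun i hi => ?_
    have : 0 < ν i := h0.trans_le (hν i hi)
    simp only [Function.mem_support] at hi ⊢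
    rw [add_zero]
    exact mul_ne_zero hi (inv_ne_zero this.ne')
  have : Countable (Function.support c) := hcount.to_subtype
  obtain ⟨D, h1, h2⟩ := exists_dirichlet_of_countable (ι := Function.support c)
    (c := fun i => c i) (ν := fun i => ν i) (T := T) (fun i => hc i) h0 (fun i => hν i i.2)
    (fun t ht => (hasSum_subtype_iff_of_support_subset (f := fun i => c i * (ν i + t)⁻¹)
      (fun i hi => left_ne_zero_of_mul hi)).2 (hT t ht)) hr0 hr hd
  refine ⟨D, fun s hs => ⟨?_, (h1 s hs).2⟩, h2⟩
  refine (hasSum_subtype_iff_of_support_subset (s := Function.support c)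
    (f := fun i => (c i : ℂ) * (ν i : ℂ) ^ (-s)) (fun i hi => ?_)).1 (h1 s hs).1
  exact ofReal_ne_zero.1 (left_ne_zero_of_mul hi)

end Dirichlet

end

section

/-! ### Meromorphic continuation -/

/-- The identity theorem for meromorphic functions. Equality is asserted on punctured neighbourhoods
because the values at poles are arbitrary. -/
theorem eventually_eq_of_preconnected {f g : ℂ → ℂ} {U : Set ℂ} (hf : MeromorphicOn f U)
    (hg : MeromorphicOn g U) (hU : IsPreconnected U) {z₀ : ℂ} (h0 : z₀ ∈ U)
    (h : ∀ᶠ z in 𝓝[≠] z₀, f z = g z) {z : ℂ} (hz : z ∈ U) : ∀ᶠ w in 𝓝[≠] z, f w = g w := by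
  have h1 : meromorphicOrderAt (f - g) z = ⊤ := by
    by_contra hne
    refine (hf.sub hg).meromorphicOrderAt_ne_top_of_isPreconnected hU hz h0 hne ?_
    rw [meromorphicOrderAt_eq_top_iff]
    filter_upwards [h] with w hw
    rw [Pi.sub_apply, hw, sub_self]
  rw [meromorphicOrderAt_eq_top_iff] at h1
  filter_upwards [h1] with w hw
  exact sub_eq_zero.1 hw

/-- The vertical strip `x < Re s < y`. -/
def strip (x y : ℝ) : Set ℂ := {s | x < s.re ∧ s.re < y}

theorem isOpen_strip (x y : ℝ) : IsOpen (strip x y) :=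
  (isOpen_lt continuous_const continuous_re).inter (isOpen_lt continuous_re continuous_const)

theorem isPreconnected_strip (x y : ℝ) : IsPreconnected (strip x y) :=
  ((convex_halfSpace_re_gt x).inter (convex_halfSpace_re_lt y)).isPreconnected

theorem strip_mono {x y x' : ℝ} (h : x' ≤ x) : strip x y ⊆ strip x' y :=
  fun _ hs => ⟨h.trans_lt hs.1, hs.2⟩

theorem ofReal_mem_strip {x y z : ℝ} (h1 : x < y) (h2 : y < z) : (y : ℂ) ∈ strip x z := by
  constructor <;> rwa [ofReal_re]

theorem eventually_eq_of_eqOn_strip {f g : ℂ → ℂ} {x y z : ℝ} (hxy : x < y) (hyz : y < z)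
    (h : ∀ s ∈ strip x z, f s = g s) : ∀ᶠ s in 𝓝[≠] (y : ℂ), f s = g s :=
  (Filter.Eventually.filter_mono nhdsWithin_le_nhds
    ((isOpen_strip x z).mem_nhds (ofReal_mem_strip hxy hyz))).mono h

/-- All the `F K` agree with `D` on one strip, hence with each other on their common domains by the
identity theorem. It is therefore harmless to choose `K` according to the real part of the point. -/
theorem exists_meromorphic_glue {D : ℂ → ℂ} {F : ℕ → ℂ → ℂ} {x y : ℝ}
    (hx : 0 ≤ x) (hxy : x < y) (hy : y < 1)
    (hD : ∀ s : ℂ, x < s.re → DifferentiableAt ℂ D s)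
    (hF : ∀ K : ℕ, MeromorphicOn (F K) (strip (-K) 1))
    (hFD : ∀ K, ∀ s ∈ strip x 1, F K s = D s) :
    ∃ Z : ℂ → ℂ, MeromorphicOn Z Set.univ ∧ ∀ s : ℂ, y < s.re → Z s = D s := by
  have hDm : ∀ s : ℂ, x < s.re → MeromorphicAt D s := fun s hs => by
    have hU : IsOpen {z : ℂ | x < z.re} := isOpen_lt continuous_const continuous_re
    exact (DifferentiableOn.analyticAt (fun z hz => (hD z hz).differentiableWithinAt)
      (hU.mem_nhds hs)).meromorphicAt
  have hopen : IsOpen {z : ℂ | y < z.re} := isOpen_lt continuous_const continuous_re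
  -- The index guarantees `-K < Re s`; the natural-number ceiling is zero as soon as `Re s ≥ 0`.
  let Z : ℂ → ℂ := fun s => if y < s.re then D s else F (⌈-s.re⌉₊ + 1) s
  refine ⟨Z, fun s₀ _ => ?_, fun s hs => if_pos hs⟩
  rcases lt_or_ge y s₀.re with h | h
  · refine (hDm s₀ (by linarith)).congr (Filter.Eventually.filter_mono nhdsWithin_le_nhds
      ((hopen.eventually_mem h).mono fun z hz => (if_pos hz).symm))
  -- A move by less than `1/4` raises the ceiling by at most one, so `K₀` bounds every index used
  -- near `s₀`.
  · set K₀ := ⌈-s₀.re⌉₊ + 2 with hK₀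
    have hceil := Nat.le_ceil (-s₀.re)
    have hmem : s₀ ∈ strip (-(K₀ : ℝ)) 1 := ⟨by rw [hK₀]; push_cast; linarith, by linarith⟩
    have hagree : ∀ K ∈ Finset.range (K₀ + 1), -(K : ℝ) < s₀.re →
        ∀ᶠ z in 𝓝[≠] s₀, F K z = F K₀ z := fun K hK hs => by
      have hle : (K : ℝ) ≤ K₀ := by exact_mod_cast Nat.lt_succ_iff.1 (Finset.mem_range.1 hK)
      have hK0 : (0 : ℝ) ≤ K := Nat.cast_nonneg K
      refine eventually_eq_of_preconnected (hF K) ((hF K₀).mono_set (strip_mono (by linarith)))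
        (isPreconnected_strip _ _) (ofReal_mem_strip (by linarith : -(K : ℝ) < y) hy)
        (eventually_eq_of_eqOn_strip hxy hy fun s hs => ?_) ⟨hs, by linarith⟩
      rw [hFD K s hs, hFD K₀ s hs]
    have h1 : ∀ᶠ z in 𝓝[≠] s₀, ∀ K ∈ Finset.range (K₀ + 1), -(K : ℝ) < s₀.re →
        F K z = F K₀ z := by
      rw [Filter.eventually_all_finset]
      intro K hK
      by_cases hs : -(K : ℝ) < s₀.re
      · filter_upwards [hagree K hK hs] with z hz _ using hz
      · exact Filter.Eventually.of_forall fun z h => absurd h hs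
    have h2 : ∀ᶠ z in 𝓝[≠] s₀, z ∈ strip (s₀.re - 1 / 4) (s₀.re + 1 / 4) ∧ z.re < 1 :=
      Filter.Eventually.filter_mono nhdsWithin_le_nhds
        (((isOpen_strip _ _).eventually_mem ⟨by linarith, by linarith⟩).and
          ((isOpen_lt continuous_re continuous_const).eventually_mem (by linarith : s₀.re < 1)))
    refine (hF K₀ s₀ hmem).congr ?_
    filter_upwards [h1, h2] with z hz1 hz2
    obtain ⟨⟨hz3, hz4⟩, hz5⟩ := hz2
    by_cases hz : y < z.re
    · change _ = if y < z.re then D z else F (⌈-z.re⌉₊ + 1) z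
      rw [if_pos hz, hFD K₀ z ⟨by linarith, hz5⟩]
    · change _ = if y < z.re then D z else F (⌈-z.re⌉₊ + 1) z
      rw [if_neg hz]
      refine (hz1 _ (Finset.mem_range.2 ?_) ?_).symm
      · have : ⌈-z.re⌉₊ ≤ ⌈-s₀.re⌉₊ + 1 := by
          rw [Nat.ceil_le]
          push_cast
          linarith
        omega
      · have := Nat.le_ceil (-z.re)
        push_cast
        linarith

/-- Agreement off the origin says nothing about the value at `0`. Resetting that one value gives
analyticity and disturbs neither meromorphy nor the Dirichlet series. -/
theorem exists_analytic_at_zero {Z A : ℂ → ℂ} (hZ : MeromorphicOn Z Set.univ)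
    (hA : AnalyticAt ℂ A 0) (h : ∀ᶠ s in 𝓝[≠] (0 : ℂ), Z s = A s) :
    ∃ Z' : ℂ → ℂ, MeromorphicOn Z' Set.univ ∧ AnalyticAt ℂ Z' 0 ∧ deriv Z' 0 = deriv A 0 ∧
      ∀ s, s ≠ 0 → Z' s = Z s := by
  classical
  have h1 : Function.update Z 0 (A 0) =ᶠ[𝓝 0] A := by
    have := eventually_nhdsWithin_iff.1 h
    filter_upwards [this] with s hs
    by_cases h0 : s = 0
    · rw [h0, Function.update_self]
    · rw [Function.update_of_ne h0]
      exact hs h0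
  exact ⟨Function.update Z 0 (A 0), fun s hs => (hZ s hs).update _ _, hA.congr h1.symm,
    h1.deriv_eq, fun s hs => Function.update_of_ne hs _ _⟩

/-- Two continuations share the Dirichlet series on a half-plane, so they agree near `0` off the
point, and analyticity fills it in. The choice made in `spectralZeta` is thus immaterial for the
derivative. -/
theorem IsSpectralZeta.deriv_eq {N : ℕ} {a lam : ℝ} {Q : ℝ → Matrix (Fin N) (Fin N) ℂ}
    {Z W : ℂ → ℂ} (hZ : IsSpectralZeta a Q lam Z) (hW : IsSpectralZeta a Q lam W) :
    deriv Z 0 = deriv W 0 := by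
  obtain ⟨σ, hσ⟩ := hZ.series
  obtain ⟨τ, hτ⟩ := hW.series
  have hopen : IsOpen {z : ℂ | max σ τ < z.re} := isOpen_lt continuous_const continuous_re
  have h1 : ∀ᶠ z in 𝓝[≠] ((max σ τ + 1 : ℝ) : ℂ), Z z = W z := by
    refine Filter.Eventually.filter_mono nhdsWithin_le_nhds
      ((hopen.eventually_mem (by
        change max σ τ < (((max σ τ + 1 : ℝ) : ℂ)).re
        rw [ofReal_re]
        linarith)).mono fun z hz => ?_)
    exact (hσ z ((le_max_left _ _).trans_lt hz)).unique (hτ z ((le_max_right _ _).trans_lt hz))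
  have h2 := eventually_eq_of_preconnected hZ.meromorphic hW.meromorphic
    isPreconnected_univ (Set.mem_univ _) h1 (Set.mem_univ 0)
  have h3 : ∃ᶠ z in 𝓝[≠] (0 : ℂ), Z z = W z := h2.frequently
  exact Filter.EventuallyEq.deriv_eq
    ((hZ.analyticAt_zero.frequently_eq_iff_eventually_eq hW.analyticAt_zero).1 h3)

theorem logDet_eq {N : ℕ} {a lam : ℝ} {Q : ℝ → Matrix (Fin N) (Fin N) ℂ} {Z : ℂ → ℂ}
    (hZ : IsSpectralZeta a Q lam Z) :
    IsSpectralZeta a Q lam (spectralZeta a Q lam) ∧ logDet a Q lam = -deriv Z 0 := by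
  have h : IsSpectralZeta a Q lam (spectralZeta a Q lam) := Classical.epsilon_spec ⟨Z, hZ⟩
  exact ⟨h, by rw [logDet, h.deriv_eq hZ]⟩

theorem Decay.meromorphicOn_powerTransform {r : ℝ} {f : ℝ → ℂ} (hf : Decay r f) :
    MeromorphicOn (powerTransform f) (strip (1 - r) 1) := fun _ hs =>
  (DifferentiableOn.analyticAt (fun _ hz =>
    (hf.differentiableAt_powerTransform hz.2 hz.1).differentiableWithinAt)
    ((isOpen_strip _ _).mem_nhds hs)).meromorphicAt

/-! ### The free zeta function -/

theorem cothPi_le {y₀ y : ℝ} (h0 : 0 < y₀) (h : y₀ ≤ y) : cothPi y ≤ cothPi y₀ := by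
  have h1 := exp_neg_two_pi_lt_one h0
  have h2 : Real.exp (-(2 * Real.pi * y)) ≤ Real.exp (-(2 * Real.pi * y₀)) :=
    Real.exp_le_exp.2 (neg_le_neg (by gcongr))
  simp only [cothPi]
  rw [div_le_div_iff₀ (by linarith) (by linarith)]
  nlinarith

theorem one_le_cothPi {y : ℝ} (h : 0 < y) : 1 ≤ cothPi y := by
  have h1 := exp_neg_two_pi_lt_one h
  have h2 := cothPi_sub_one h
  have h3 : 0 ≤ 2 * Real.exp (-(2 * Real.pi * y)) / (1 - Real.exp (-(2 * Real.pi * y))) :=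
    div_nonneg (by positivity) (by linarith)
  linarith

/-- The sum of `1 / (n² / a² + w)` over all integers `n`. -/
def freeTrace (a w : ℝ) : ℝ := Real.pi * a / √w * cothPi (a * √w)

/-- The exponentially small part of the free trace. -/
def freeTail (a w : ℝ) : ℝ := Real.pi * a / √w * (cothPi (a * √w) - 1)

theorem hasSum_freeTrace {a w : ℝ} (ha : 0 < a) (hw : 0 < w) :
    HasSum (symb a w) (freeTrace a w) := by
  have h := hasSum_symb ha (Real.sqrt_pos.2 hw)
  rwa [Real.sq_sqrt hw.le] at h

theorem freeTrace_eq {a w : ℝ} (hw : 0 < w) :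
    freeTrace a w = Real.pi * a * w ^ (-(1 / 2 : ℝ)) + freeTail a w := by
  rw [freeTrace, freeTail, Real.rpow_neg hw.le, ← Real.sqrt_eq_rpow]
  ring

theorem freeTail_nonneg {a w : ℝ} (ha : 0 < a) (hw : 0 < w) : 0 ≤ freeTail a w := by
  have := one_le_cothPi (mul_pos ha (Real.sqrt_pos.2 hw))
  exact mul_nonneg (by positivity) (by linarith)

theorem freeTrace_nonneg {a w : ℝ} (ha : 0 < a) (hw : 0 < w) : 0 ≤ freeTrace a w :=
  (hasSum_freeTrace ha hw).nonneg fun n => (symb_pos hw n).le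

theorem freeTrace_le {a w₀ w : ℝ} (ha : 0 < a) (h0 : 0 < w₀) (hw : w₀ ≤ w) :
    freeTrace a w ≤ Real.pi * a * cothPi (a * √w₀) * w ^ (-(1 / 2 : ℝ)) := by
  have hw' : 0 < w := h0.trans_le hw
  rw [freeTrace, Real.rpow_neg hw'.le, ← Real.sqrt_eq_rpow]
  calc _ ≤ Real.pi * a / √w * cothPi (a * √w₀) := by
        gcongr
        exact cothPi_le (mul_pos ha (Real.sqrt_pos.2 h0)) (by gcongr)
    _ = _ := by ring

theorem freeTail_le {a w₀ w : ℝ} (ha : 0 < a) (h0 : 0 < w₀) (hw : w₀ ≤ w) :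
    freeTail a w ≤ 2 * Real.pi * a / (√w₀ * (1 - Real.exp (-(2 * Real.pi * (a * √w₀))))) *
      Real.exp (-(2 * Real.pi * (a * √w))) := by
  have hw' : 0 < w := h0.trans_le hw
  have h1 := exp_neg_two_pi_lt_one (mul_pos ha (Real.sqrt_pos.2 h0))
  have hs : √w₀ ≤ √w := Real.sqrt_le_sqrt hw
  have h2 : Real.exp (-(2 * Real.pi * (a * √w))) ≤ Real.exp (-(2 * Real.pi * (a * √w₀))) :=
    Real.exp_le_exp.2 (neg_le_neg (by gcongr))
  have h3 := Real.sqrt_pos.2 h0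
  have h4 : 0 < 1 - Real.exp (-(2 * Real.pi * (a * √w₀))) := by linarith
  rw [freeTail, cothPi_sub_one (mul_pos ha (Real.sqrt_pos.2 hw'))]
  calc _ ≤ Real.pi * a / √w₀ * (2 * Real.exp (-(2 * Real.pi * (a * √w))) /
        (1 - Real.exp (-(2 * Real.pi * (a * √w₀))))) := by
        have : 0 < 1 - Real.exp (-(2 * Real.pi * (a * √w))) := by linarith
        gcongr
    _ = _ := by field_simp

/-- This explicit primitive is the source of the term `2 log(1 - e^(-2πak))` in the free
determinant. -/
theorem hasDerivAt_freeTail {a w : ℝ} (ha : 0 < a) (hw : 0 < w) :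
    HasDerivAt (fun w => 2 * Real.log (1 - Real.exp (-(2 * Real.pi * (a * √w))))) (freeTail a w)
      w := by
  have hs := Real.sqrt_pos.2 hw
  have h1 := exp_neg_two_pi_lt_one (mul_pos ha hs)
  have h2 := ((((Real.hasDerivAt_sqrt hw.ne').const_mul a).const_mul (2 * Real.pi)).fun_neg.exp.const_sub
    1).log (by linarith : 1 - Real.exp (-(2 * Real.pi * (a * √w))) ≠ 0)
  refine (h2.const_mul 2).congr_deriv ?_
  rw [freeTail, cothPi_sub_one (mul_pos ha hs)]
  have h4 : 1 - Real.exp (-(2 * Real.pi * (a * √w))) ≠ 0 := by linarith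
  field_simp

end

section

theorem continuousAt_cothPi {y : ℝ} (hy : 0 < y) : ContinuousAt cothPi y := by
  have h := exp_neg_two_pi_lt_one hy
  have h1 : 1 - Real.exp (-(2 * Real.pi * y)) ≠ 0 := by linarith
  unfold cothPi
  exact ContinuousAt.div (by fun_prop) (by fun_prop) h1

theorem continuousAt_freeTail {a w : ℝ} (ha : 0 < a) (hw : 0 < w) :
    ContinuousAt (freeTail a) w := by
  have hs := Real.sqrt_pos.2 hw
  have h1 : ContinuousAt (fun w => cothPi (a * √w)) w :=
    ContinuousAt.comp (g := cothPi) (f := fun w => a * √w) (continuousAt_cothPi (mul_pos ha hs))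
      (by fun_prop)
  have h2 : ContinuousAt (fun w => Real.pi * a / √w) w :=
    ContinuousAt.div (by fun_prop) (by fun_prop) hs.ne'
  exact h2.mul (h1.sub continuousAt_const)

theorem tendsto_sqrt_add (w : ℝ) : Tendsto (fun t : ℝ => √(w + t)) atTop atTop :=
  Real.tendsto_sqrt_atTop.comp (tendsto_atTop_add_const_left _ _ tendsto_id)

theorem decay_freeTail {a w : ℝ} (ha : 0 < a) (hw : 0 < w) (r : ℝ) :
    Decay r fun t => (freeTail a (w + t) : ℂ) := by
  refine ⟨fun t ht => ?_, ?_⟩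
  · have ht' : (0 : ℝ) ≤ t := ht
    have h := ContinuousAt.comp (g := freeTail a) (f := fun t => w + t) (x := t)
      (continuousAt_freeTail ha (by positivity)) (by fun_prop)
    exact (continuous_ofReal.continuousAt.comp h).continuousWithinAt
  · set C := 2 * Real.pi * a / (√w * (1 - Real.exp (-(2 * Real.pi * (a * √w))))) with hC
    have h1 : (fun t => (freeTail a (w + t) : ℂ)) =O[atTop]
        fun t => Real.exp (-(2 * Real.pi * a) * √t) := by
      refine Asymptotics.IsBigO.of_bound C ?_
      filter_upwards [eventually_ge_atTop 0] with t ht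
      rw [norm_real, Real.norm_of_nonneg (freeTail_nonneg ha (by positivity)),
        Real.norm_of_nonneg (Real.exp_pos _).le]
      refine (freeTail_le ha hw (by linarith)).trans ?_
      have h2 := exp_neg_two_pi_lt_one (mul_pos ha (Real.sqrt_pos.2 hw))
      have hC0 : 0 ≤ C := by
        have : 0 < 1 - Real.exp (-(2 * Real.pi * (a * √w))) := by linarith
        positivity
      refine mul_le_mul_of_nonneg_left (Real.exp_le_exp.2 ?_) hC0
      have h3 : √t ≤ √(w + t) := Real.sqrt_le_sqrt (by linarith)
      rw [neg_mul, neg_le_neg_iff, mul_assoc (2 * Real.pi)]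
      gcongr
    have h2 := ((isLittleO_exp_neg_mul_rpow_atTop (by positivity : 0 < 2 * Real.pi * a)
      (-(2 * r))).comp_tendsto Real.tendsto_sqrt_atTop).isBigO
    refine h1.trans (h2.congr' (Eventually.of_forall fun t => rfl) ?_)
    filter_upwards [eventually_ge_atTop 0] with t ht
    simp only [Function.comp]
    rw [Real.sqrt_eq_rpow, ← Real.rpow_mul ht]
    congr 1
    ring

theorem integral_freeTail {a w : ℝ} (ha : 0 < a) (hw : 0 < w) :
    ∫ t in Set.Ioi (0 : ℝ), freeTail a (w + t)
      = -(2 * Real.log (1 - Real.exp (-(2 * Real.pi * (a * √w))))) := by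
  have h := integral_Ioi_of_hasDerivAt_of_nonneg' (a := 0) (l := 0)
    (g := fun t => 2 * Real.log (1 - Real.exp (-(2 * Real.pi * (a * √(w + t))))))
    (g' := fun t => freeTail a (w + t)) (fun t ht => ?_) (fun t ht => ?_) ?_
  · rw [h, add_zero, zero_sub]
  · have ht' : (0 : ℝ) ≤ t := ht
    have := HasDerivAt.comp_const_add w t (hasDerivAt_freeTail ha (by positivity : 0 < w + t))
    exact this
  · have ht' : (0 : ℝ) < t := ht
    exact freeTail_nonneg ha (by positivity)
  · have h1 : Tendsto (fun t => Real.exp (-(2 * Real.pi * (a * √(w + t))))) atTop (𝓝 0) := by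
      refine Real.tendsto_exp_neg_atTop_nhds_zero.comp ?_
      exact Tendsto.const_mul_atTop (by positivity)
        (Tendsto.const_mul_atTop ha (tendsto_sqrt_add w))
    have h2 := ((h1.const_sub 1).log (by norm_num)).const_mul 2
    simpa using h2

theorem neg_log_one_sub_le {q : ℝ} (h0 : 0 ≤ q) (h1 : q ≤ 1 / 2) :
    |2 * Real.log (1 - q)| ≤ 4 * q := by
  have h2 : 0 < 1 - q := by linarith
  have h3 := Real.one_sub_inv_le_log_of_pos h2
  have h4 : Real.log (1 - q) ≤ 0 := Real.log_nonpos h2.le (by linarith)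
  have h5 : (1 - q)⁻¹ ≤ 1 + 2 * q := by
    rw [inv_le_comm₀ h2 (by linarith), inv_eq_one_div, div_le_iff₀ (by linarith)]
    nlinarith
  rw [abs_le]
  constructor <;> linarith

theorem decay_freeTrace {a w : ℝ} (ha : 0 < a) (hw : 0 < w) :
    Decay (1 / 2) fun t => (freeTrace a (w + t) : ℂ) := by
  refine Decay.of_bound ?_ (by norm_num) hw (C := Real.pi * a * cothPi (a * √w)) fun t ht => ?_
  · have h1 : ContinuousOn (fun t : ℝ => ((Real.pi * a * (w + t) ^ (-(1 / 2 : ℝ)) : ℝ) : ℂ))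
        (Set.Ici 0) := fun t ht => by
      have ht' : (0 : ℝ) ≤ t := ht
      have h2 : ContinuousAt (fun t : ℝ => (w + t) ^ (-(1 / 2 : ℝ))) t :=
        ContinuousAt.rpow_const (by fun_prop) (Or.inl (by positivity))
      exact (continuous_ofReal.continuousAt.comp
        (continuousAt_const.mul h2)).continuousWithinAt
    refine (h1.add (decay_freeTail ha hw 1).1).congr fun t ht => ?_
    have ht' : (0 : ℝ) ≤ t := ht
    rw [freeTrace_eq (by positivity)]
    push_cast
    rfl
  · rw [norm_real, Real.norm_of_nonneg (freeTrace_nonneg ha (by positivity))]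
    exact freeTrace_le ha hw (by linarith)

/-- The part `πa w^(-1/2)` of the free trace has an exact transform by gamma functions, meromorphic
on `ℂ` (here `G`). The tail decays faster than every power, so its transform is holomorphic for `Re
s < 1` and contributes the integral of the tail to the derivative at `0`. -/
theorem exists_freeZeta {a w : ℝ} (ha : 0 < a) (hw : 0 < w) :
    ∃ E : ℂ → ℂ, MeromorphicOn E Set.univ ∧ AnalyticAt ℂ E 0 ∧
      deriv E 0 = ((-(2 * Real.pi * a * √w)
        - 2 * Real.log (1 - Real.exp (-(2 * Real.pi * (a * √w)))) : ℝ) : ℂ) ∧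
      (∀ s : ℂ, 3 / 4 < s.re →
        HasSum (fun n : ℤ => ((freq a n ^ 2 + w : ℝ) : ℂ) ^ (-s)) (E s)) ∧
      ∀ s ∈ strip (3 / 4) 1, E s = powerTransform (fun t => freeTrace a (w + t)) s := by
  have hw' : (w : ℂ) ≠ 0 := by exact_mod_cast hw.ne'
  have hpi : (Real.pi : ℂ) ≠ 0 := by exact_mod_cast Real.pi_ne_zero
  have hG2 : Gamma (1 / 2 : ℝ) ≠ 0 := Gamma_ne_zero_of_re_pos (by simp)
  obtain ⟨D, hD1, hD2⟩ := exists_dirichlet (c := fun _ : ℤ => (1 : ℝ)) (r := 1 / 2)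
    (ν := fun n : ℤ => freq a n ^ 2 + w) (T := fun t => freeTrace a (w + t))
    (fun _ => zero_le_one) hw (fun n _ => by have := sq_nonneg (freq a n); linarith)
    (fun t ht => by
      refine (hasSum_freeTrace ha (by positivity)).congr_fun fun n => ?_
      rw [symb, one_mul, add_assoc]) (by norm_num) (by norm_num) (decay_freeTrace ha hw)
  let G : ℂ → ℂ := fun s => Real.pi * a * (sin (Real.pi * s) / Real.pi *
    ((w : ℂ) ^ (1 - s - (1 / 2 : ℝ)) *
      (Gamma (1 - s) * Gamma ((1 / 2 : ℝ) - (1 - s)) / Gamma (1 / 2 : ℝ))))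
  let F : ℂ → ℂ := fun s => G s + powerTransform (fun t => freeTail a (w + t)) s
  have hG : MeromorphicOn G Set.univ := by
    have h1 : MeromorphicOn (fun s : ℂ => sin (Real.pi * s) / Real.pi *
        (w : ℂ) ^ (1 - s - (1 / 2 : ℝ))) Set.univ := fun s _ => by
      refine (Differentiable.analyticAt ?_ s).meromorphicAt
      intro s
      refine DifferentiableAt.mul (by fun_prop) ?_
      exact DifferentiableAt.const_cpow (by fun_prop) (Or.inl hw')
    have h2 : MeromorphicOn (fun s : ℂ => Gamma (1 - s)) Set.univ := fun s _ =>
      (Meromorphic.Gamma (1 - s)).comp_analyticAt (f := Gamma) (g := fun s => 1 - s) (by fun_prop)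
    have h3 : MeromorphicOn (fun s : ℂ => Gamma ((1 / 2 : ℝ) - (1 - s))) Set.univ := fun s _ =>
      (Meromorphic.Gamma _).comp_analyticAt (f := Gamma)
        (g := fun s => ((1 / 2 : ℝ) : ℂ) - (1 - s)) (by fun_prop)
    have h4 := (MeromorphicOn.const (Real.pi * a : ℂ) (U := Set.univ)).fun_mul
      (h1.fun_mul ((h2.fun_mul h3).fun_div (MeromorphicOn.const (Gamma (1 / 2 : ℝ)))))
    refine fun s hs => (h4 s hs).congr (Eventually.of_forall fun z => ?_)
    simp only [G]
    ring
  have hdec := decay_freeTail ha hw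
  have hF : ∀ K : ℕ, MeromorphicOn F (strip (-K) 1) := fun K =>
    (hG.mono_set (Set.subset_univ _)).fun_add (by
      have := (hdec (1 + K)).meromorphicOn_powerTransform
      rwa [sub_add_cancel_left] at this)
  have hFD : ∀ s ∈ strip (1 / 2) 1, F s = D s := fun s hs => by
    have h1 := hs.1
    have h2 := hs.2
    rw [hD2 s (by linarith) hs.2]
    have hm := (hasMellin_add_rpow_neg (p := 1 / 2) hw (u := 1 - s) (by simp; linarith)
      (by simp; linarith))
    have hm' := hasMellin_const_smul hm.1 (Real.pi * a : ℂ)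
    have hT := (hdec 1).mellinConvergent (u := 1 - s) (by simp; linarith) (by simp; linarith)
    have hadd := (hasMellin_add hm'.1 hT).2
    have e : mellin (fun t => (freeTrace a (w + t) : ℂ)) (1 - s)
        = mellin (fun t => (Real.pi * a : ℂ) • (((w + t) ^ (-(1 / 2 : ℝ)) : ℝ) : ℂ)
          + (freeTail a (w + t) : ℂ)) (1 - s) := by
      simp only [mellin]
      refine setIntegral_congr_fun measurableSet_Ioi fun t ht => ?_
      have ht' : (0 : ℝ) < t := ht
      simp only [freeTrace_eq (a := a) (by positivity : 0 < w + t), smul_eq_mul]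
      push_cast
      rfl
    simp only [F, G, powerTransform]
    rw [e, hadd, hm'.2, hm.2, smul_eq_mul]
    ring
  obtain ⟨Z, hZ1, hZ2⟩ := exists_meromorphic_glue (F := fun _ => F) (x := 1 / 2)
    (y := 3 / 4) (by norm_num) (by norm_num) (by norm_num) (fun s hs => (hD1 s (by linarith)).2) hF (fun _ => hFD)
  have hZF : ∀ᶠ s in 𝓝[≠] (0 : ℂ), Z s = F s := by
    have hsub : strip (-(1 : ℕ)) 1 ⊆ Set.univ := Set.subset_univ _
    refine eventually_eq_of_preconnected (hZ1.mono_set hsub) (hF 1) (isPreconnected_strip _ _)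
      (ofReal_mem_strip (y := 7 / 8) (by norm_num) (by norm_num))
      (eventually_eq_of_eqOn_strip (x := 3 / 4) (by norm_num) (by norm_num : (7 / 8 : ℝ) < 1)
        fun s hs => ?_) (by constructor <;> simp)
    rw [hZ2 s hs.1, hFD s ⟨by linarith [hs.1], hs.2⟩]
  have hP := (hdec 2).hasDerivAt_powerTransform_zero (by norm_num)
  have hPint : ∫ t in Set.Ioi (0 : ℝ), (freeTail a (w + t) : ℂ)
      = ((-(2 * Real.log (1 - Real.exp (-(2 * Real.pi * (a * √w))))) : ℝ) : ℂ) := by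
    rw [integral_complex_ofReal, integral_freeTail ha hw]
  have hdiff : ∀ s ∈ Metric.ball (0 : ℂ) (1 / 4), DifferentiableAt ℂ (fun s : ℂ =>
      (w : ℂ) ^ (1 - s - (1 / 2 : ℝ)) *
      (Gamma (1 - s) * Gamma ((1 / 2 : ℝ) - (1 - s)) / Gamma (1 / 2 : ℝ))) s := fun s hs => by
    have hn : ‖s‖ < 1 / 4 := by simpa using hs
    have hre := abs_lt.1 ((abs_re_le_norm s).trans_lt hn)
    refine DifferentiableAt.mul (DifferentiableAt.const_cpow (by fun_prop) (Or.inl hw'))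
      (DifferentiableAt.div_const (DifferentiableAt.mul ?_ ?_) _)
    · refine DifferentiableAt.comp s (g := Gamma) (f := fun s => 1 - s)
        (differentiableAt_Gamma _ fun m h => ?_) (by fun_prop)
      have := congrArg re h
      simp at this
      have : (0 : ℝ) ≤ m := Nat.cast_nonneg m
      linarith
    · refine DifferentiableAt.comp s (g := Gamma) (f := fun s => ((1 / 2 : ℝ) : ℂ) - (1 - s))
        (differentiableAt_Gamma _ fun m h => ?_) (by fun_prop)
      have h1 := congrArg re h
      simp at h1
      rcases m with _ | m
      · simp at h1; linarith
      · have : (0 : ℝ) ≤ m := Nat.cast_nonneg m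
        push_cast at h1
        linarith
  have hFdiff : ∀ s ∈ Metric.ball (0 : ℂ) (1 / 4), DifferentiableAt ℂ F s := fun s hs => by
    have hn : ‖s‖ < 1 / 4 := by simpa using hs
    have hre := abs_lt.1 ((abs_re_le_norm s).trans_lt hn)
    refine DifferentiableAt.add (DifferentiableAt.const_mul (DifferentiableAt.mul (by fun_prop)
      (hdiff s hs)) _) ((hdec 2).differentiableAt_powerTransform (by linarith) (by linarith))
  have hFan : AnalyticAt ℂ F 0 :=
    DifferentiableOn.analyticAt (fun z hz => (hFdiff z hz).differentiableWithinAt)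
      (Metric.ball_mem_nhds (0 : ℂ) (by norm_num))
  obtain ⟨E, hE1, hE2, hE3, hE4⟩ := exists_analytic_at_zero hZ1 hFan hZF
  have hne : ∀ s : ℂ, 3 / 4 < s.re → s ≠ 0 := by
    rintro s hs rfl
    rw [zero_re] at hs
    linarith
  refine ⟨E, hE1, hE2, ?_, fun s hs => ?_, fun s hs => ?_⟩
  · have hs1 : HasDerivAt (fun s : ℂ => sin (Real.pi * s) / Real.pi) 1 0 := by
      have := (((hasDerivAt_id (0 : ℂ)).const_mul (Real.pi : ℂ)).csin).div_const (Real.pi : ℂ)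
      refine this.congr_deriv ?_
      simp [hpi]
    have hg := ((hs1.mul (hdiff 0 (Metric.mem_ball_self (by norm_num))).hasDerivAt).const_mul
      (Real.pi * a : ℂ)).add hP
    -- At `s = 0` the gamma quotient is `Γ(-1/2)/Γ(1/2) = -2`, whence the leading term `-2πa√w`.
    have hGam : Gamma ((1 / 2 : ℝ) - (1 - 0)) = -2 * Gamma (1 / 2 : ℝ) := by
      have h := Gamma_add_one (-(1 / 2 : ℂ)) (by norm_num)
      have e1 : (-(1 / 2 : ℂ)) + 1 = ((1 / 2 : ℝ) : ℂ) := by push_cast; norm_num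
      have e2 : ((1 / 2 : ℝ) : ℂ) - (1 - 0) = -(1 / 2 : ℂ) := by push_cast; norm_num
      rw [e1] at h
      rw [e2, h]
      ring
    have hroot : (w : ℂ) ^ (1 - (0 : ℂ) - (1 / 2 : ℝ)) = (√w : ℝ) := by
      rw [Real.sqrt_eq_rpow, ofReal_cpow hw.le]
      congr 1
      push_cast
      norm_num
    rw [hE3]
    refine (hg.congr_deriv ?_).deriv
    rw [hPint, hGam, hroot]
    simp only [mul_zero, Complex.sin_zero, zero_div, zero_mul, add_zero, one_mul, sub_zero,
      Gamma_one]
    generalize Gamma ((1 / 2 : ℝ) : ℂ) = γ at hG2 ⊢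
    push_cast
    field_simp
    ring
  · rw [hE4 s (hne s hs), hZ2 s hs]
    refine (hD1 s (by linarith)).1.congr_fun fun n => ?_
    simp
  · rw [hE4 s (hne s hs.1), hZ2 s hs.1, hD2 s (by linarith [hs.1]) hs.2]

end

section

/-! ### Moments of the free zeta function -/

theorem abs_freq_le {a w : ℝ} (hw : 0 < w) (n : ℤ) :
    1 + |freq a n| ≤ (2 + 2 / w) * (freq a n ^ 2 + w) := by
  have h1 : 0 ≤ freq a n ^ 2 / w := by positivity
  have h2 : (2 + 2 / w) * (freq a n ^ 2 + w)
      = 2 * freq a n ^ 2 + 2 * (freq a n ^ 2 / w) + 2 * w + 2 := by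
    field_simp
    ring
  rw [h2, ← sq_abs] at *
  nlinarith [sq_nonneg (|freq a n| - 1)]

theorem abs_freq_le_rpow {a w : ℝ} (hw : 0 < w) (n : ℤ) :
    |freq a n| ≤ (freq a n ^ 2 + w) ^ (1 / 2 : ℝ) := by
  rw [← Real.sqrt_eq_rpow]
  exact Real.abs_le_sqrt (by linarith)

theorem freq_neg (a : ℝ) (n : ℤ) : freq a (-n) = -freq a n := by
  simp [freq, neg_div]

/-- Writing `ξ² = (ξ² + w) - w` expresses the moment of order `l + 2` at `s` by the moment of order
`l` at `s - 1` and at `s`. Order zero is the free zeta function, and order one vanishes under `n ↦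
-n`. -/
theorem exists_moment {a w : ℝ} (ha : 0 < a) (hw : 0 < w) (l : ℕ) :
    ∃ M : ℂ → ℂ, MeromorphicOn M Set.univ ∧ ∀ s : ℂ, 3 / 4 + (l : ℝ) / 2 < s.re →
      HasSum (fun n : ℤ => (freq a n : ℂ) ^ l * ((freq a n ^ 2 + w : ℝ) : ℂ) ^ (-s)) (M s) := by
  obtain ⟨E, hE1, -, -, hE2, -⟩ := exists_freeZeta ha hw
  have hpos : ∀ n : ℤ, 0 < freq a n ^ 2 + w := fun n => by positivity
  induction l using Nat.twoStepInduction with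
  | zero =>
    refine ⟨E, hE1, fun s hs => ?_⟩
    have := hE2 s (by simpa using hs)
    simpa using this
  | one =>
    refine ⟨fun _ => 0, MeromorphicOn.const 0, fun s hs => ?_⟩
    -- Since `|ξ| ≤ (ξ² + w)^(1/2)`, the series is dominated by the free one at exponent `Re s -
    -- 1/2`.
    have hsum : Summable fun n : ℤ =>
        (freq a n : ℂ) ^ 1 * ((freq a n ^ 2 + w : ℝ) : ℂ) ^ (-s) := by
      have h1 := (hE2 ((s.re - 1 / 2 : ℝ) : ℂ) (by
        rw [ofReal_re]; push_cast at hs; linarith)).summable.norm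
      refine Summable.of_norm_bounded h1 fun n => ?_
      rw [norm_mul, norm_cpow_eq_rpow_re_of_pos (hpos n), norm_cpow_eq_rpow_re_of_pos (hpos n),
        pow_one, norm_real, neg_re, neg_re, ofReal_re,
        show -(s.re - 1 / 2) = 1 / 2 + -s.re by ring, Real.rpow_add (hpos n)]
      gcongr
      exact abs_freq_le_rpow hw n
    have h2 := hsum.hasSum
    have h3 : HasSum (fun n : ℤ => -((freq a n : ℂ) ^ 1 * ((freq a n ^ 2 + w : ℝ) : ℂ) ^ (-s)))
        (∑' n : ℤ, (freq a n : ℂ) ^ 1 * ((freq a n ^ 2 + w : ℝ) : ℂ) ^ (-s)) := by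
      refine HasSum.congr_fun ((Equiv.neg ℤ).hasSum_iff.2 h2) fun n => ?_
      simp [freq_neg]
    have h4 := h2.neg.unique h3
    have h5 : (∑' n : ℤ, (freq a n : ℂ) ^ 1 * ((freq a n ^ 2 + w : ℝ) : ℂ) ^ (-s)) = 0 := by
      linear_combination (-1 / 2 : ℂ) * h4
    rwa [h5] at h2
  | more l ih _ =>
    obtain ⟨M, hM1, hM2⟩ := ih
    refine ⟨fun s => M (s - 1) - w * M s, ?_, fun s hs => ?_⟩
    · have h1 : MeromorphicOn (fun s => M (s - 1)) Set.univ := fun s _ =>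
        (hM1 (s - 1) (Set.mem_univ _)).comp_analyticAt (f := M) (g := fun s => s - 1) (by fun_prop)
      exact h1.fun_sub ((MeromorphicOn.const (w : ℂ)).fun_mul hM1)
    · push_cast at hs
      have h1 := hM2 (s - 1) (by simp; linarith)
      have h2 := hM2 s (by linarith)
      refine (h1.sub (h2.mul_left (w : ℂ))).congr_fun fun n => ?_
      have hne : ((freq a n ^ 2 + w : ℝ) : ℂ) ≠ 0 := by exact_mod_cast (hpos n).ne'
      rw [show -(s - 1) = -s + 1 by ring, cpow_add _ _ hne, cpow_one]
      push_cast
      ring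

theorem freq_pow_mul_symb_pow_le {a w : ℝ} (hw : 0 < w) {l j : ℕ} (h : l ≤ j) (n : ℤ) :
    |freq a n| ^ l * symb a w n ^ j ≤ (2 + 2 / w) ^ j := by
  have h1 : |freq a n| ^ l ≤ (1 + |freq a n|) ^ j :=
    (pow_le_pow_left₀ (abs_nonneg _) (by linarith) l).trans
      (pow_le_pow_right₀ (by linarith [abs_nonneg (freq a n)]) h)
  have h2 := abs_freq_le (a := a) hw n
  have h3 := symb_pos (a := a) hw n
  have h4 : (freq a n ^ 2 + w) * symb a w n = 1 := by
    rw [symb, mul_inv_cancel₀]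
    positivity
  calc _ ≤ (1 + |freq a n|) ^ j * symb a w n ^ j := by gcongr
    _ ≤ ((2 + 2 / w) * (freq a n ^ 2 + w)) ^ j * symb a w n ^ j := by gcongr
    _ = (2 + 2 / w) ^ j * ((freq a n ^ 2 + w) * symb a w n) ^ j := by
        rw [← mul_pow, ← mul_pow, mul_assoc]
    _ = _ := by rw [h4, one_pow, mul_one]

theorem symb_anti {a w : ℝ} (hw : 0 < w) {t : ℝ} (ht : 0 ≤ t) (n : ℤ) :
    symb a (w + t) n ≤ symb a w n := by
  simp only [symb]
  gcongr
  linarith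

theorem symb_pow_eq {a w : ℝ} {j : ℕ} (hw : 0 < w) {t : ℝ} (ht : 0 ≤ t) (n : ℤ) :
    ((freq a n ^ 2 + w) + t) ^ (-((j : ℝ) + 1)) = symb a (w + t) n ^ (j + 1) := by
  rw [symb, ← add_assoc, Real.rpow_neg (by positivity), inv_pow,
    ← Real.rpow_natCast (freq a n ^ 2 + w + t) (j + 1), Nat.cast_succ]

/-- The beta integral with `p = j + 1` sends `(ν + t)^(-(j+1))` to a gamma quotient times
`ν^(-(s+j))`, so the transform is that quotient times the moment of order `l` at `s + j`. The
condition `l ≤ j` keeps `s + j` in the half-plane of convergence. -/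
theorem exists_moment_transform {a w : ℝ} (ha : 0 < a) (hw : 0 < w) {l j : ℕ} (hlj : l ≤ j) :
    ∃ (S : ℝ → ℂ) (M : ℂ → ℂ), Decay (1 / 2) S ∧ MeromorphicOn M Set.univ ∧
      (∀ t, 0 ≤ t → HasSum (fun n => (freq a n : ℂ) ^ l * (symb a (w + t) n : ℂ) ^ (j + 1))
        (S t)) ∧
      ∀ s ∈ strip (3 / 4) 1, powerTransform S s = M s := by
  set C := (2 + 2 / w) ^ j with hC
  have hC0 : 0 ≤ C := by positivity
  have hterm : ∀ t, 0 ≤ t → ∀ n, ‖(freq a n : ℂ) ^ l * (symb a (w + t) n : ℂ) ^ (j + 1)‖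
      ≤ C * symb a (w + t) n := fun t ht n => by
    have h0 := symb_pos (a := a) (by positivity : 0 < w + t) n
    rw [norm_mul, norm_pow, norm_pow, norm_real, norm_real, Real.norm_of_nonneg h0.le, pow_succ,
      ← mul_assoc]
    refine mul_le_mul_of_nonneg_right (le_trans ?_ (freq_pow_mul_symb_pow_le (a := a) hw hlj n))
      h0.le
    rw [Real.norm_eq_abs]
    gcongr
    exact symb_anti hw ht n
  have hS : ∀ t, 0 ≤ t → HasSum (fun n => (freq a n : ℂ) ^ l * (symb a (w + t) n : ℂ) ^ (j + 1))
      (∑' n, (freq a n : ℂ) ^ l * (symb a (w + t) n : ℂ) ^ (j + 1)) := fun t ht =>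
    (Summable.of_norm_bounded ((hasSum_freeTrace ha (by positivity)).summable.mul_left C)
      (hterm t ht)).hasSum
  have hT : ∀ t, 0 ≤ t → HasSum (fun n => (freq a n : ℂ) ^ l *
      ((((freq a n ^ 2 + w) + t) ^ (-((j : ℝ) + 1)) : ℝ) : ℂ))
      (∑' n, (freq a n : ℂ) ^ l * (symb a (w + t) n : ℂ) ^ (j + 1)) := fun t ht =>
    (hS t ht).congr_fun fun n => by rw [symb_pow_eq hw ht]; push_cast; rfl
  obtain ⟨M, hM1, hM2⟩ := exists_moment ha hw l
  have hpos : ∀ n : ℤ, 0 < freq a n ^ 2 + w := fun n => by positivity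
  refine ⟨fun t => ∑' n, (freq a n : ℂ) ^ l * (symb a (w + t) n : ℂ) ^ (j + 1),
    fun s => sin (Real.pi * s) / Real.pi * (Gamma (1 - s) * Gamma (((j : ℝ) + 1 : ℝ) - (1 - s)) /
      Gamma ((j : ℝ) + 1 : ℝ)) * M (s + j), ?_, ?_, hS, fun s hs => ?_⟩
  · refine Decay.of_bound (w := w) (C := C * (Real.pi * a * cothPi (a * √w))) ?_ (by norm_num) hw
      fun t ht => ?_
    · refine continuousOn_of_hasSum (fun n _ => hpos n) (by positivity) ?_ hT
      refine Summable.of_nonneg_of_le (fun n => mul_nonneg (norm_nonneg _)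
        (Real.rpow_nonneg (hpos n).le _)) (fun n => ?_)
        ((hasSum_freeTrace ha hw).summable.mul_left C)
      have h1 := hterm 0 le_rfl n
      have h2 := symb_pow_eq (a := a) (j := j) hw le_rfl n
      simp only [add_zero] at h1 h2
      rw [h2]
      rw [norm_mul, norm_pow _ (j + 1), norm_real, Real.norm_of_nonneg (symb_pos hw n).le] at h1
      exact h1
    · have h1 := (hS t ht).norm_le_of_bounded ((hasSum_freeTrace ha
        (by positivity : 0 < w + t)).mul_left C) (hterm t ht)
      refine h1.trans ?_
      rw [mul_assoc]
      exact mul_le_mul_of_nonneg_left (freeTrace_le ha hw (by linarith)) hC0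
  · have h2 : MeromorphicOn (fun s : ℂ => Gamma (1 - s)) Set.univ := fun s _ =>
      (Meromorphic.Gamma (1 - s)).comp_analyticAt (f := Gamma) (g := fun s => 1 - s) (by fun_prop)
    have h3 : MeromorphicOn (fun s : ℂ => Gamma (((j : ℝ) + 1 : ℝ) - (1 - s))) Set.univ :=
      fun s _ => (Meromorphic.Gamma _).comp_analyticAt (f := Gamma)
        (g := fun s => (((j : ℝ) + 1 : ℝ) : ℂ) - (1 - s)) (by fun_prop)
    have h4 : MeromorphicOn (fun s => M (s + j)) Set.univ := fun s _ =>
      (hM1 (s + j) (Set.mem_univ _)).comp_analyticAt (f := M) (g := fun s => s + j) (by fun_prop)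
    have h1 : MeromorphicOn (fun s : ℂ => sin (Real.pi * s) / Real.pi) Set.univ := fun s _ =>
      (Differentiable.analyticAt (by fun_prop) s).meromorphicAt
    exact (h1.fun_mul ((h2.fun_mul h3).fun_div (MeromorphicOn.const _))).fun_mul h4
  · have hs1 := hs.1
    have hs2 := hs.2
    have hlj' : (l : ℝ) ≤ j := by exact_mod_cast hlj
    have hj : 3 / 4 + (l : ℝ) / 2 < s.re + j := by
      have : (0 : ℝ) ≤ j := Nat.cast_nonneg j
      linarith
    have hm := hM2 (s + j) (by simpa using hj)
    have hexp : (1 - s - (((j : ℝ) + 1 : ℝ) : ℂ)) = -(s + j) := by push_cast; ring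
    have h := hasSum_mellin hpos (c := fun n => (freq a n : ℂ) ^ l) (p := (j : ℝ) + 1)
      (u := 1 - s) (by simp; linarith) (by
        have : (0 : ℝ) ≤ j := Nat.cast_nonneg j
        simp; linarith) (by
        refine hm.summable.norm.congr fun n => ?_
        rw [norm_mul, norm_cpow_eq_rpow_re_of_pos (hpos n), ← hexp, sub_re, ofReal_re]) hT
    simp only [hexp] at h
    have h' := hm.mul_right (Gamma (1 - s) * Gamma ((((j : ℝ) + 1 : ℝ) : ℂ) - (1 - s)) /
      Gamma ((j : ℝ) + 1 : ℝ))
    have e := h.unique (h'.congr_fun fun n => (mul_assoc _ _ _).symm)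
    rw [powerTransform, e]
    ring

end

section

/-! ### The parametrix -/

section Parametrix

variable {N : ℕ} {a : ℝ}

/-- The derivative of a smooth vector-valued function. -/
def derivVec : smoothVec N a →ₗ[ℂ] smoothVec N a where
  toFun φ := ⟨fun x i => deriv (fun y => φ.1 y i) x, fun i => (φ.2 i).deriv⟩
  map_add' φ ψ := by
    ext x i
    exact deriv_fun_add ((φ.2 i).differentiable x) ((ψ.2 i).differentiable x)
  map_smul' c φ := by
    ext x i
    exact deriv_const_mul c ((φ.2 i).differentiable x)

/-- Multiplication of a smooth vector-valued function by the potential. -/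
def potVec {Q : ℝ → Matrix (Fin N) (Fin N) ℂ} (hQ : IsPotential a Q) :
    smoothVec N a →ₗ[ℂ] smoothVec N a where
  toFun φ := ⟨fun x => Q x *ᵥ φ.1 x, mulVec_mem_smoothVec hQ φ.2⟩
  map_add' φ ψ := by
    apply Subtype.ext
    funext x
    exact Matrix.mulVec_add (Q x) (φ.1 x) (ψ.1 x)
  map_smul' c φ := by
    apply Subtype.ext
    funext x
    exact Matrix.mulVec_smul (Q x) c (φ.1 x)

/-- Multiplication of a smooth vector-valued function by `e^{inx/a}`. -/
def modVec (ha : 0 < a) (n : ℤ) : smoothVec N a →ₗ[ℂ] smoothVec N a where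
  toFun φ := ⟨fun x i => φ.1 x i * emode a n x, fun i => (φ.2 i).mul (smoothPer_emode ha n)⟩
  map_add' φ ψ := by
    ext x i
    exact add_mul _ _ _
  map_smul' c φ := by
    ext x i
    exact mul_assoc _ _ _

/-- The operator `u ↦ u'' - Q u + 2 i ξ u'`, which satisfies
`(L - ξ²) (e^{iξx} u) = - e^{iξx} (u'' - Q u + 2 i ξ u')`. -/
def stepVec {Q : ℝ → Matrix (Fin N) (Fin N) ℂ} (hQ : IsPotential a Q) (ξ : ℝ) :
    smoothVec N a →ₗ[ℂ] smoothVec N a :=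
  (derivVec ∘ₗ derivVec - potVec hQ) + (ξ : ℂ) • ((2 * I) • derivVec)

variable {Q : ℝ → Matrix (Fin N) (Fin N) ℂ} (hQ : IsPotential a Q)

theorem hasDerivAt_mul_emode (n : ℤ) {f : ℝ → ℂ} {f' : ℂ} {x : ℝ} (hf : HasDerivAt f f' x) :
    HasDerivAt (fun y => f y * emode a n y) ((f' + I * (freq a n : ℂ) * f x) * emode a n x) x := by
  refine (hf.mul (hasDerivAt_emode a n x)).congr_deriv ?_
  simp only [freq]
  push_cast
  ring

theorem smoothOp_modVec (ha : 0 < a) (n : ℤ) (u : smoothVec N a) :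
    smoothOp hQ (modVec ha n u) =
      modVec ha n (((freq a n ^ 2 : ℝ) : ℂ) • u - stepVec hQ (freq a n) u) := by
  apply Subtype.ext
  funext x i
  change schrodinger Q (modVec ha n u).1 x i = _
  rw [schrodinger_apply (modVec ha n u).2]
  set f : ℝ → ℂ := fun y => u.1 y i with hf
  have hfd : ∀ y, HasDerivAt f (deriv f y) y := fun y => ((u.2 i).differentiable y).hasDerivAt
  have hfd2 : HasDerivAt (deriv f) (deriv (deriv f) x) x :=
    ((u.2 i).deriv.differentiable x).hasDerivAt
  have h1 : deriv (fun y => (modVec ha n u).1 y i) =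
      fun y => (deriv f y + I * (freq a n : ℂ) * f y) * emode a n y :=
    funext fun y => (hasDerivAt_mul_emode n (hfd y)).deriv
  have h2 := (hasDerivAt_mul_emode (a := a) n
    (hfd2.add ((hfd x).const_mul (I * (freq a n : ℂ))))).deriv
  rw [h1]
  have h3 : (Q x *ᵥ (modVec ha n u).1 x) i = (Q x *ᵥ u.1 x) i * emode a n x := by
    simp only [modVec, Matrix.mulVec, dotProduct, LinearMap.coe_mk, AddHom.coe_mk]
    rw [Finset.sum_mul]
    exact Finset.sum_congr rfl fun j _ => (mul_assoc _ _ _).symm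
  rw [h3, show deriv (fun y => (deriv f y + I * (freq a n : ℂ) * f y) * emode a n y) x = _ from h2]
  change _ = ((((freq a n ^ 2 : ℝ) : ℂ) * f x) - ((deriv (deriv f) x - (Q x *ᵥ u.1 x) i)
    + (freq a n : ℂ) * ((2 * I) * deriv f x))) * emode a n x
  simp only [Pi.add_apply]
  push_cast
  linear_combination (-(freq a n : ℂ) ^ 2 * f x * emode a n x) * I_sq

/-- The step operator is affine in `ξ`, so its powers are polynomials in `ξ` whose coefficients do
not involve `ξ`. This separates the frequency from the potential in the parametrix. -/
theorem exists_stepVec_pow (j : ℕ) (u : smoothVec N a) : ∃ b : ℕ → smoothVec N a, ∀ ξ : ℝ,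
    (stepVec hQ ξ ^ j) u = ∑ l ∈ Finset.range (j + 1), ((ξ : ℂ) ^ l) • b l := by
  induction j with
  | zero => exact ⟨fun _ => u, fun ξ => by simp⟩
  | succ j ih =>
    obtain ⟨b, hb⟩ := ih
    let A₀ : smoothVec N a →ₗ[ℂ] smoothVec N a := derivVec ∘ₗ derivVec - potVec hQ
    let A₁ : smoothVec N a →ₗ[ℂ] smoothVec N a := (2 * I) • derivVec
    -- The induction hypothesis does not constrain `b` beyond index `j`, so its contribution to the
    -- new top index must be cut off.
    let b₀ : ℕ → smoothVec N a := fun l => if l ≤ j then A₀ (b l) else 0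
    let b₁ : ℕ → smoothVec N a := fun l => match l with
      | 0 => 0
      | l + 1 => A₁ (b l)
    refine ⟨fun l => b₀ l + b₁ l, fun ξ => ?_⟩
    have h0 : ∑ l ∈ Finset.range (j + 1 + 1), ((ξ : ℂ) ^ l) • b₀ l
        = ∑ l ∈ Finset.range (j + 1), ((ξ : ℂ) ^ l) • A₀ (b l) := by
      rw [Finset.sum_range_succ]
      have : b₀ (j + 1) = 0 := if_neg (by omega)
      rw [this, smul_zero, add_zero]
      refine Finset.sum_congr rfl fun l hl => ?_
      rw [show b₀ l = A₀ (b l) from if_pos (by have := Finset.mem_range.1 hl; omega)]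
    have h1 : ∑ l ∈ Finset.range (j + 1 + 1), ((ξ : ℂ) ^ l) • b₁ l
        = (ξ : ℂ) • ∑ l ∈ Finset.range (j + 1), ((ξ : ℂ) ^ l) • A₁ (b l) := by
      rw [Finset.sum_range_succ', Finset.smul_sum]
      have : b₁ 0 = 0 := rfl
      rw [this, smul_zero, add_zero]
      refine Finset.sum_congr rfl fun l hl => ?_
      rw [smul_smul, ← pow_succ']
    simp only [smul_add, Finset.sum_add_distrib]
    rw [h0, h1, pow_succ', Module.End.mul_apply, hb]
    change A₀ _ + (ξ : ℂ) • A₁ _ = _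
    simp only [map_sum, map_smul]

variable [hT : Fact (0 < 2 * Real.pi * a)] {m w : ℝ} (hb : ‖potOp hQ‖ ≤ m / 2) (hw : 0 < w)
  (hmw : m ≤ w)

include hb hmw in
-- Conjugation by `e^{iξx}` turns `L + w` into `ξ² + w` minus the step operator. Dividing by `ξ² +
-- w` leaves a remainder of the same form, so the identity can be iterated.
theorem res_modVec (n : ℤ) (u : smoothVec N a) :
    res hQ hw (smoothL2 (modVec (pos_of_fact hT) n u)) = (symb a w n : ℂ) •
      (smoothL2 (modVec (pos_of_fact hT) n u) +
        res hQ hw (smoothL2 (modVec (pos_of_fact hT) n (stepVec hQ (freq a n) u)))) := by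
  have h := res_smoothOp hQ hb hw hmw (modVec (pos_of_fact hT) n u)
  rw [smoothOp_modVec, map_sub, map_sub, map_smul, map_smul, map_add, map_sub, map_smul,
    map_smul] at h
  have h1 : (symb a w n : ℂ) * (((freq a n ^ 2 : ℝ) : ℂ) + w) = 1 := by
    have h : symb a w n * (freq a n ^ 2 + w) = 1 := inv_mul_cancel₀ (by positivity)
    exact_mod_cast h
  have aux : ∀ A Y B E : CircleL2 N a, A - Y + B = E → E + Y = A + B := by
    rintro A Y B E rfl
    abel
  rw [aux _ _ _ _ h, ← add_smul, smul_smul, h1, one_smul]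

include hb hmw in
theorem res_modVec_iterate (n : ℤ) (u : smoothVec N a) (K : ℕ) :
    res hQ hw (smoothL2 (modVec (pos_of_fact hT) n u)) =
      ∑ j ∈ Finset.range K, ((symb a w n : ℂ) ^ (j + 1)) •
        smoothL2 (modVec (pos_of_fact hT) n ((stepVec hQ (freq a n) ^ j) u)) +
      ((symb a w n : ℂ) ^ K) •
        res hQ hw (smoothL2 (modVec (pos_of_fact hT) n ((stepVec hQ (freq a n) ^ K) u))) := by
  induction K with
  | zero => simp
  | succ K ih =>
    rw [ih, Finset.sum_range_succ, res_modVec hQ hb hw hmw n ((stepVec hQ (freq a n) ^ K) u),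
      smul_smul, ← pow_succ, smul_add, add_assoc, pow_succ' (stepVec hQ (freq a n)) K,
      Module.End.mul_apply]

theorem exists_norm_modVec_le (u : smoothVec N a) :
    ∃ C : ℝ, 0 ≤ C ∧ ∀ n, ‖smoothL2 (modVec (pos_of_fact hT) n u)‖ ≤ C := by
  have ha := pos_of_fact hT
  choose C hC using fun i => (u.2 i).bounded ha
  have hC0 : ∀ i, 0 ≤ C i := fun i => (norm_nonneg _).trans (hC i 0)
  refine ⟨√(∑ i, C i ^ 2), Real.sqrt_nonneg _, fun n => norm_smoothL2_le (Real.sqrt_nonneg _)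
    fun x => ?_⟩
  rw [EuclideanSpace.norm_eq]
  refine Real.sqrt_le_sqrt (Finset.sum_le_sum fun i _ => ?_)
  change ‖u.1 x i * emode a n x‖ ^ 2 ≤ _
  rw [norm_mul, norm_emode, mul_one]
  exact pow_le_pow_left₀ (norm_nonneg _) (hC i x) 2

/-- The constant function `v_i`. -/
def constVec (N : ℕ) (a : ℝ) (i : Fin N) : smoothVec N a :=
  ⟨fun _ => Pi.single i 1, fun _ => SmoothPer.const a _⟩

theorem smoothL2_modVec_constVec (n : ℤ) (i : Fin N) :
    smoothL2 (modVec (pos_of_fact hT) n (constVec N a i)) = circleBasis N a (n, i) := by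
  rw [← smoothL2_expSmooth]
  congr 1
  ext x j
  change (Pi.single i (1 : ℂ) : Fin N → ℂ) j * emode a n x
    = (Pi.single i (emode a n x) : Fin N → ℂ) j
  rcases eq_or_ne j i with rfl | h <;> simp [*]

omit hT in
theorem one_add_abs_freq_pow_le (hm : 0 < m) (hmw : m ≤ w) (n : ℤ) (M : ℕ) :
    (1 + |freq a n|) ^ (2 * M) * symb a w n ^ M ≤ (2 + 2 / m) ^ M := by
  have hw : 0 < w := hm.trans_le hmw
  have h1 : (1 + |freq a n|) ^ 2 ≤ (2 + 2 / m) * (freq a n ^ 2 + w) := by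
    have h2 : (2 + 2 / m) * (freq a n ^ 2 + m)
        = 2 * freq a n ^ 2 + 2 * (freq a n ^ 2 / m) + 2 * m + 2 := by
      field_simp
      ring
    have h3 : (2 + 2 / m) * (freq a n ^ 2 + m) ≤ (2 + 2 / m) * (freq a n ^ 2 + w) := by gcongr
    have h4 : 0 ≤ freq a n ^ 2 / m := by positivity
    have h5 := sq_abs (freq a n)
    nlinarith [sq_nonneg (|freq a n| - 1)]
  have h4 : (freq a n ^ 2 + w) * symb a w n = 1 := by
    rw [symb, mul_inv_cancel₀]
    positivity
  have h0 := symb_pos (a := a) hw n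
  calc _ = ((1 + |freq a n|) ^ 2 * symb a w n) ^ M := by rw [pow_mul, mul_pow]
    _ ≤ ((2 + 2 / m) * (freq a n ^ 2 + w) * symb a w n) ^ M := by gcongr
    _ = _ := by rw [mul_assoc, h4, mul_one]

include hb in
-- A step gains a factor `g_n`, of order `ξ⁻²`, and costs at most one power of `ξ`. After `2M` steps
-- the remainder is of size `ξ^(2M) g_n^(2M)`, hence at most a multiple of `g_n^M`, uniformly in `w
-- ≥ m`.
theorem exists_trace_expansion (hm : 0 < m) (M : ℕ) : ∃ (β : ℕ → ℕ → ℂ) (C : ℝ), 0 ≤ C ∧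
    ∀ (w : ℝ) (hw : 0 < w), m ≤ w → ∀ n : ℤ,
      ‖∑ i, ⟪circleBasis N a (n, i), res hQ hw (circleBasis N a (n, i))⟫ -
        ∑ j ∈ Finset.range (2 * M), ∑ l ∈ Finset.range (j + 1),
          β j l * ((freq a n : ℂ) ^ l * (symb a w n : ℂ) ^ (j + 1))‖ ≤ C * symb a w n ^ M := by
  have ha := pos_of_fact hT
  choose b hbe using fun (i : Fin N) (j : ℕ) => exists_stepVec_pow hQ j (constVec N a i)
  choose C hC0 hC using fun (i : Fin N) (l : ℕ) => exists_norm_modVec_le (b i (2 * M) l)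
  set B := ∑ i, ∑ l ∈ Finset.range (2 * M + 1), C i l with hB
  have hB0 : 0 ≤ B := Finset.sum_nonneg fun i _ => Finset.sum_nonneg fun l _ => hC0 i l
  -- Pairing `e^{iξx} u` with `e^{iξx} v_i` gives the mean of the `i`-th component of `u`, so these
  -- coefficients depend on neither `n` nor `w`.
  refine ⟨fun j l => ∑ i, fcoef a 0 fun x => (b i j l).1 x i, 2 * m⁻¹ * (2 + 2 / m) ^ M * B,
    by positivity, fun w hw hmw n => ?_⟩
  have hcoef : ∀ i j, ⟪circleBasis N a (n, i), smoothL2 (modVec ha n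
      ((stepVec hQ (freq a n) ^ j) (constVec N a i)))⟫
      = ∑ l ∈ Finset.range (j + 1), (freq a n : ℂ) ^ l * fcoef a 0 (fun x => (b i j l).1 x i) := by
    intro i j
    rw [hbe, map_sum, map_sum, inner_sum]
    refine Finset.sum_congr rfl fun l _ => ?_
    rw [map_smul, map_smul, inner_smul_right, inner_circleBasis_smoothL2]
    congr 1
    change fcoef a n (fun x => (b i j l).1 x i * emode a n x) = _
    rw [fcoef_mul_emode, sub_self]
  have hmain : ∑ i, ⟪circleBasis N a (n, i), res hQ hw (circleBasis N a (n, i))⟫ -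
        ∑ j ∈ Finset.range (2 * M), ∑ l ∈ Finset.range (j + 1),
          (∑ i, fcoef a 0 fun x => (b i j l).1 x i) *
            ((freq a n : ℂ) ^ l * (symb a w n : ℂ) ^ (j + 1))
      = ∑ i, (symb a w n : ℂ) ^ (2 * M) * ⟪circleBasis N a (n, i), res hQ hw (smoothL2
          (modVec ha n ((stepVec hQ (freq a n) ^ (2 * M)) (constVec N a i))))⟫ := by
    have h1 : ∀ i, ⟪circleBasis N a (n, i), res hQ hw (circleBasis N a (n, i))⟫
        = ∑ j ∈ Finset.range (2 * M), (symb a w n : ℂ) ^ (j + 1) *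
            ∑ l ∈ Finset.range (j + 1), (freq a n : ℂ) ^ l *
              fcoef a 0 (fun x => (b i j l).1 x i)
          + (symb a w n : ℂ) ^ (2 * M) * ⟪circleBasis N a (n, i), res hQ hw (smoothL2
            (modVec ha n ((stepVec hQ (freq a n) ^ (2 * M)) (constVec N a i))))⟫ := fun i => by
      conv_lhs => rw [← smoothL2_modVec_constVec n i,
        res_modVec_iterate hQ hb hw hmw n (constVec N a i) (2 * M)]
      rw [inner_add_right, inner_sum, inner_smul_right]
      simp only [inner_smul_right]
      rw [smoothL2_modVec_constVec n i]
      simp only [hcoef]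
    rw [Finset.sum_congr rfl fun i _ => h1 i, Finset.sum_add_distrib, Finset.sum_comm,
      add_sub_right_comm, add_eq_right, sub_eq_zero]
    refine Finset.sum_congr rfl fun j _ => ?_
    rw [← Finset.mul_sum, Finset.sum_comm, Finset.mul_sum]
    refine Finset.sum_congr rfl fun l _ => ?_
    rw [← Finset.mul_sum]
    ring
  have hg := symb_pos (a := a) hw n
  rw [hmain]
  have hterm : ∀ i, ‖(symb a w n : ℂ) ^ (2 * M) * ⟪circleBasis N a (n, i), res hQ hw (smoothL2
      (modVec ha n ((stepVec hQ (freq a n) ^ (2 * M)) (constVec N a i))))⟫‖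
      ≤ 2 * m⁻¹ * (2 + 2 / m) ^ M * symb a w n ^ M *
        ∑ l ∈ Finset.range (2 * M + 1), C i l := fun i => by
    have h1 : ‖smoothL2 (modVec ha n ((stepVec hQ (freq a n) ^ (2 * M)) (constVec N a i)))‖
        ≤ (1 + |freq a n|) ^ (2 * M) * ∑ l ∈ Finset.range (2 * M + 1), C i l := by
      rw [hbe, map_sum, map_sum, Finset.mul_sum]
      refine norm_sum_le_of_le _ fun l hl => ?_
      rw [map_smul, map_smul, norm_smul, norm_pow, norm_real, Real.norm_eq_abs]
      have h2 : |freq a n| ^ l ≤ (1 + |freq a n|) ^ (2 * M) :=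
        (pow_le_pow_left₀ (abs_nonneg _) (by linarith) l).trans
          (pow_le_pow_right₀ (by linarith [abs_nonneg (freq a n)])
            (Nat.lt_succ_iff.1 (Finset.mem_range.1 hl)))
      exact mul_le_mul h2 (hC i l n) (norm_nonneg _) (by positivity)
    have h3 : ‖⟪circleBasis N a (n, i), res hQ hw (smoothL2
        (modVec ha n ((stepVec hQ (freq a n) ^ (2 * M)) (constVec N a i))))⟫‖
        ≤ 2 * m⁻¹ * ((1 + |freq a n|) ^ (2 * M) * ∑ l ∈ Finset.range (2 * M + 1), C i l) := by
      refine (norm_inner_le_norm _ _).trans ?_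
      rw [(circleBasis N a).orthonormal.1, one_mul]
      refine (ContinuousLinearMap.le_opNorm _ _).trans ?_
      refine mul_le_mul ((norm_res_le hQ hb hw hmw).trans ?_) h1 (norm_nonneg _) (by positivity)
      gcongr
    rw [norm_mul, norm_pow, norm_real, Real.norm_of_nonneg hg.le]
    have h4 := one_add_abs_freq_pow_le (a := a) hm hmw n M
    have hS : 0 ≤ ∑ l ∈ Finset.range (2 * M + 1), C i l := Finset.sum_nonneg fun l _ => hC0 i l
    calc _ ≤ symb a w n ^ (2 * M) *
          (2 * m⁻¹ * ((1 + |freq a n|) ^ (2 * M) * ∑ l ∈ Finset.range (2 * M + 1), C i l)) := by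
          gcongr
      _ = 2 * m⁻¹ * ((1 + |freq a n|) ^ (2 * M) * symb a w n ^ M) * symb a w n ^ M *
          ∑ l ∈ Finset.range (2 * M + 1), C i l := by
          rw [two_mul M, pow_add (symb a w n)]
          ring
      _ ≤ _ := by gcongr
  refine (norm_sum_le_of_le _ fun i _ => hterm i).trans_eq ?_
  rw [← Finset.mul_sum, hB]
  ring

end Parametrix

end

section

/-! ### Continuation of the spectral zeta function -/

section Zeta

variable {N : ℕ} {a : ℝ} {Q : ℝ → Matrix (Fin N) (Fin N) ℂ}

/-- The trace of `(L + w)⁻¹`. -/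
def traceRes (a : ℝ) (Q : ℝ → Matrix (Fin N) (Fin N) ℂ) (w : ℝ) : ℝ :=
  ∑' μ : ℝ, multiplicity a Q μ * (μ + w)⁻¹

variable [hT : Fact (0 < 2 * Real.pi * a)] (hQ : IsPotential a Q) {m w : ℝ}
  (hb : ‖potOp hQ‖ ≤ m / 2)

section

variable (hw : 0 < w) (hmw : m ≤ w)

include hb hmw

/-- From `B - G = -GVB`: the outer `G` gives `g_n`, and `‖V‖ ‖B‖ ≤ (m/2)(2/w)`. The extra `1/w`
improves the decay of the trace difference from `w^(-1/2)` to `w^(-3/2)`, which brings `s = 0` into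
the domain of its transform. -/
theorem norm_inner_res_sub_le (p) :
    ‖⟪circleBasis N a p, res hQ hw (circleBasis N a p)⟫ - symb a w p.1‖
      ≤ m / w * symb a w p.1 := by
  have h1 := congrArg (fun T : CircleL2 N a →L[ℂ] CircleL2 N a =>
    ⟪circleBasis N a p, T (circleBasis N a p)⟫) (perturbed_left (norm_GV_lt hQ hb hw hmw))
  have h2 : ⟪circleBasis N a p, res hQ hw (circleBasis N a p) +
      freeRes N a hw (potOp hQ (res hQ hw (circleBasis N a p)))⟫
      = ⟪circleBasis N a p, freeRes N a hw (circleBasis N a p)⟫ := h1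
  have h0 := symb_pos (a := a) hw p.1
  have hn := (circleBasis N a).orthonormal.1
  rw [inner_add_right, inner_freeRes, inner_freeRes, inner_self_eq_norm_sq_to_K, hn] at h2
  have h3 : ⟪circleBasis N a p, res hQ hw (circleBasis N a p)⟫ - symb a w p.1
      = -(symb a w p.1 * ⟪circleBasis N a p, potOp hQ (res hQ hw (circleBasis N a p))⟫) := by
    simp only [RCLike.ofReal_one, one_pow, mul_one] at h2
    linear_combination h2
  rw [h3, norm_neg, norm_mul, norm_real, Real.norm_of_nonneg h0.le, mul_comm]
  refine mul_le_mul_of_nonneg_right ?_ h0.le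
  refine (norm_inner_le_norm _ _).trans ?_
  rw [hn, one_mul]
  calc _ ≤ ‖potOp hQ‖ * ‖res hQ hw (circleBasis N a p)‖ := ContinuousLinearMap.le_opNorm _ _
    _ ≤ m / 2 * (2 * w⁻¹ * 1) := by
        refine mul_le_mul hb ((ContinuousLinearMap.le_opNorm _ _).trans ?_) (norm_nonneg _)
          ((norm_nonneg _).trans hb)
        rw [hn]
        gcongr
        exact norm_res_le hQ hb hw hmw
    _ = _ := by field_simp

theorem inner_res_eq_re (p) : ⟪circleBasis N a p, res hQ hw (circleBasis N a p)⟫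
    = ((⟪circleBasis N a p, res hQ hw (circleBasis N a p)⟫).re : ℂ) := by
  have hsymm := ContinuousLinearMap.isSelfAdjoint_iff_isSymmetric.1
    (isSelfAdjoint_res hQ hb hw hmw)
  have h : ⟪res hQ hw (circleBasis N a p), circleBasis N a p⟫
      = ⟪circleBasis N a p, res hQ hw (circleBasis N a p)⟫ := hsymm _ _
  refine (conj_eq_iff_re.1 ?_).symm
  rw [inner_conj_symm, h]

theorem hasSum_traceRes (hm : 0 < m) :
    HasSum (fun p => ⟪circleBasis N a p, res hQ hw (circleBasis N a p)⟫) (traceRes a Q w : ℂ) ∧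
      HasSum (fun μ : ℝ => (multiplicity a Q μ : ℝ) * (μ + w)⁻¹) (traceRes a Q w) := by
  have ha := pos_of_fact hT
  have hfree := hasSum_prod_fin (hasSum_freeTrace ha hw) N
  have hs1 : Summable fun p => ⟪circleBasis N a p, res hQ hw (circleBasis N a p)⟫
      - (symb a w p.1 : ℂ) :=
    Summable.of_norm_bounded (hfree.summable.mul_left (m / w))
      (norm_inner_res_sub_le hQ hb hw hmw)
  have hs2 := hs1.add (ofRealCLM.hasSum hfree).summable
  have hs : Summable fun p => ⟪circleBasis N a p, res hQ hw (circleBasis N a p)⟫ :=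
    hs2.congr fun p => by simp
  have hre := Complex.hasSum_re hs.hasSum
  have h1 := hasSum_resolvent_trace hQ hb hm hw hmw hre
  have e : traceRes a Q w = (∑' p, ⟪circleBasis N a p, res hQ hw (circleBasis N a p)⟫).re :=
    h1.tsum_eq
  refine ⟨?_, e ▸ h1⟩
  rw [e]
  exact (ofRealCLM.hasSum hre).congr_fun fun p => inner_res_eq_re hQ hb hw hmw p

include hw in
theorem abs_traceRes_sub_le (hm : 0 < m) :
    |traceRes a Q w - N * freeTrace a w| ≤ m / w * (N * freeTrace a w) := by
  have hfree := hasSum_prod_fin (hasSum_freeTrace (pos_of_fact hT) hw) N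
  have h := ((hasSum_traceRes hQ hb hw hmw hm).1.sub (ofRealCLM.hasSum hfree)).norm_le_of_bounded
    (hfree.mul_left (m / w)) (norm_inner_res_sub_le hQ hb hw hmw)
  rw [← Real.norm_eq_abs, ← norm_real]
  rw [ofRealCLM_apply, ← ofReal_sub] at h
  exact h

end

include hb

theorem pos_of_multiplicity_ne_zero {μ : ℝ} (h : (multiplicity a Q μ : ℝ) ≠ 0) :
    m / 2 ≤ μ + m := by
  refine specSpace_pos hQ hb fun h' => h ?_
  rw [← finrank_specSpace, h', finrank_bot, Nat.cast_zero]

theorem continuousOn_traceRes (hm : 0 < m) :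
    ContinuousOn (fun t => (traceRes a Q (m + t) : ℂ)) (Set.Ici 0) := by
  refine continuousOn_of_hasSum (c := fun μ : ℝ => (multiplicity a Q μ : ℂ))
    (ν := fun μ => μ + m) (p := 1) (fun μ h => ?_) zero_le_one ?_ fun t ht => ?_
  · have := pos_of_multiplicity_ne_zero hQ hb (μ := μ) (by exact_mod_cast h)
    linarith
  · have := (hasSum_traceRes hQ hb hm le_rfl hm).2.summable
    simpa [Real.rpow_neg_one] using this
  · have := ofRealCLM.hasSum (hasSum_traceRes hQ hb (by positivity : 0 < m + t)
      (by linarith) hm).2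
    refine HasSum.congr_fun this fun μ => ?_
    simp only [Real.rpow_neg_one, ofRealCLM_apply]
    push_cast
    rw [add_assoc]

theorem decay_traceRes_sub (hm : 0 < m) :
    Decay (3 / 2) fun t => ((traceRes a Q (m + t) : ℂ) - N * freeTrace a (m + t)) := by
  have ha := pos_of_fact hT
  refine Decay.of_bound ((continuousOn_traceRes hQ hb hm).sub
    ((decay_freeTrace ha hm).const_mul N).1) (by norm_num) hm
    (C := m * (N * (Real.pi * a * cothPi (a * √m)))) fun t ht => ?_
  have hw : 0 < m + t := by positivity
  have h := abs_traceRes_sub_le hQ hb hw (by linarith) hm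
  have e : ‖(traceRes a Q (m + t) : ℂ) - N * freeTrace a (m + t)‖
      = |traceRes a Q (m + t) - N * freeTrace a (m + t)| := by
    rw [← Real.norm_eq_abs, ← norm_real]
    push_cast
    rfl
  rw [e]
  refine h.trans ?_
  calc _ ≤ m / (m + t) * (N * (Real.pi * a * cothPi (a * √m) * (m + t) ^ (-(1 / 2 : ℝ)))) := by
        gcongr
        exact freeTrace_le ha hm (by linarith)
    _ = m * (N * (Real.pi * a * cothPi (a * √m))) * ((m + t) ^ (-(1 / 2 : ℝ)) * (m + t)⁻¹) := by
        ring
    _ = _ := by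
        rw [← Real.rpow_neg_one (m + t), ← Real.rpow_add hw]
        norm_num

theorem decay_traceRes (hm : 0 < m) : Decay (1 / 2) fun t => (traceRes a Q (m + t) : ℂ) := by
  have h := ((decay_traceRes_sub hQ hb hm).mono (by norm_num : (1 / 2 : ℝ) ≤ 3 / 2)).add
    ((decay_freeTrace (pos_of_fact hT) hm).const_mul N)
  simpa using h

theorem exists_continuation (hm : 0 < m) (K : ℕ) : ∃ F : ℂ → ℂ,
    MeromorphicOn F (strip (-K) 1) ∧
      ∀ s ∈ strip (3 / 4) 1, F s = powerTransform (fun t => traceRes a Q (m + t)) s := by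
  have ha := pos_of_fact hT
  -- The remainder decays with exponent `M - 1/2`, so its transform is holomorphic for `3/2 - M < Re
  -- s < 1`, where `3/2 - M = -K - 1/2`.
  set M := K + 2 with hM
  obtain ⟨β, C, hC0, hβ⟩ := exists_trace_expansion hQ hb hm M
  have hSM : ∀ j l : ℕ, ∃ (S : ℝ → ℂ) (G : ℂ → ℂ), MeromorphicOn G Set.univ ∧
      (l ≤ j → Decay (1 / 2) S ∧
      (∀ t, 0 ≤ t → HasSum (fun n => (freq a n : ℂ) ^ l * (symb a (m + t) n : ℂ) ^ (j + 1))
        (S t)) ∧ ∀ s ∈ strip (3 / 4) 1, powerTransform S s = G s) := fun j l => by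
    by_cases h : l ≤ j
    · obtain ⟨S, G, h1, h2, h3⟩ := exists_moment_transform ha hm h
      exact ⟨S, G, h2, fun _ => ⟨h1, h3⟩⟩
    -- Pairs with `j < l` never occur in the sums; dummy values let the choice range over all pairs.
    · exact ⟨0, 0, MeromorphicOn.const 0, fun h' => absurd h' h⟩
  choose S G hG hSG using hSM
  have hle : ∀ {j l : ℕ}, l ∈ Finset.range (j + 1) → l ≤ j := fun h =>
    Nat.lt_succ_iff.1 (Finset.mem_range.1 h)
  let P : ℝ → ℂ := fun t => ∑ j ∈ Finset.range (2 * M), ∑ l ∈ Finset.range (j + 1), β j l * S j l t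
  have hPd : Decay (1 / 2) P :=
    Decay.sum fun j _ => Decay.sum fun l hl => (hSG j l (hle hl)).1.const_mul _
  have hTd := decay_traceRes hQ hb hm
  let R : ℝ → ℂ := fun t => traceRes a Q (m + t) - P t
  have hRd : Decay ((M : ℝ) - 1 / 2) R := by
    refine Decay.of_bound (hTd.1.sub hPd.1) (by rw [hM]; push_cast; linarith) hm
      (C := C * (Real.pi * a * cothPi (a * √m))) fun t ht => ?_
    have hw : 0 < m + t := by positivity
    have h1 : HasSum (fun n : ℤ => ∑ i, ⟪circleBasis N a (n, i), res hQ hw (circleBasis N a (n, i))⟫)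
        (traceRes a Q (m + t) : ℂ) :=
      (hasSum_traceRes hQ hb hw (by linarith) hm).1.prod_fiberwise fun n => hasSum_fintype _
    have h2 : HasSum (fun n : ℤ => ∑ j ∈ Finset.range (2 * M), ∑ l ∈ Finset.range (j + 1),
        β j l * ((freq a n : ℂ) ^ l * (symb a (m + t) n : ℂ) ^ (j + 1))) (P t) :=
      hasSum_sum fun j _ => hasSum_sum fun l hl => ((hSG j l (hle hl)).2.1 t ht).mul_left _
    have h3 := (h1.sub h2).norm_le_of_bounded (((hasSum_freeTrace ha hw).mul_left
      ((m + t)⁻¹ ^ (M - 1))).mul_left C) fun n => by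
        refine (hβ _ hw (by linarith) n).trans ?_
        have h4 := symb_pos (a := a) hw n
        have h5 := symb_le (a := a) hw n
        -- One factor `g_n` is kept for the sum over `n`, which gives `w^(-1/2)`; the other `M - 1`
        -- factors are bounded by `w⁻¹`.
        rw [show M = (M - 1) + 1 by omega, pow_succ, Nat.add_sub_cancel]
        gcongr
    refine h3.trans ?_
    rw [mul_assoc C]
    refine mul_le_mul_of_nonneg_left ?_ hC0
    calc _ ≤ (m + t)⁻¹ ^ (M - 1) * (Real.pi * a * cothPi (a * √m) * (m + t) ^ (-(1 / 2 : ℝ))) := by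
          gcongr
          exact freeTrace_le ha hm (by linarith)
      _ = Real.pi * a * cothPi (a * √m) * ((m + t) ^ (-((M - 1 : ℕ) : ℝ)) *
          (m + t) ^ (-(1 / 2 : ℝ))) := by
          rw [Real.rpow_neg hw.le ((M - 1 : ℕ) : ℝ), Real.rpow_natCast, inv_pow]
          ring
      _ = _ := by
          rw [← Real.rpow_add hw, Nat.cast_sub (by omega)]
          congr 2
          push_cast
          ring
  have hRm := hRd.meromorphicOn_powerTransform
  refine ⟨fun s => ∑ j ∈ Finset.range (2 * M), ∑ l ∈ Finset.range (j + 1), β j l * G j l s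
    + powerTransform R s, ?_, fun s hs => ?_⟩
  · refine MeromorphicOn.fun_add (MeromorphicOn.fun_sum fun j =>
      MeromorphicOn.fun_sum fun l => (MeromorphicOn.const _).fun_mul
        ((hG j l).mono_set (Set.subset_univ _))) (hRm.mono_set (strip_mono ?_))
    rw [hM]
    push_cast
    linarith
  · have hs1 : 1 - (1 / 2 : ℝ) < s.re := by linarith [hs.1]
    have hR' : Decay (1 / 2) R := hRd.mono (by rw [hM]; push_cast; linarith)
    have e : (fun t => (traceRes a Q (m + t) : ℂ)) = fun t => P t + R t :=
      funext fun t => (add_sub_cancel _ _).symm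
    rw [e, Decay.powerTransform_add hPd hR' hs.2 hs1, Decay.powerTransform_sum
      (fun j _ => Decay.sum fun l hl => (hSG j l (hle hl)).1.const_mul _) hs.2 hs1]
    refine congrArg (· + powerTransform R s) (Finset.sum_congr rfl fun j _ => ?_)
    rw [Decay.powerTransform_sum (fun l hl => (hSG j l (hle hl)).1.const_mul _) hs.2 hs1]
    refine Finset.sum_congr rfl fun l hl => ?_
    rw [Decay.powerTransform_const_mul, (hSG j l (hle hl)).2.2 s hs]

/-- On a strip left of `Re s = 1` the zeta function is `N` times the free one plus the transform of
the trace difference. That transform is holomorphic for `-1/2 < Re s < 1`, so the equality persists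
near `0` and can be differentiated there. -/
theorem exists_spectralZeta (hm : 0 < m) : ∃ Z : ℂ → ℂ, IsSpectralZeta a Q (-m) Z ∧
    deriv Z 0 = N * ((-(2 * Real.pi * a * √m)
        - 2 * Real.log (1 - Real.exp (-(2 * Real.pi * (a * √m)))) : ℝ) : ℂ)
      + ∫ t in Set.Ioi (0 : ℝ), ((traceRes a Q (m + t) : ℂ) - N * freeTrace a (m + t)) := by
  have ha := pos_of_fact hT
  have hTd := decay_traceRes hQ hb hm
  have hd := decay_traceRes_sub hQ hb hm
  obtain ⟨D, hD1, hD2⟩ := exists_dirichlet (c := fun μ : ℝ => (multiplicity a Q μ : ℝ))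
    (ν := fun μ => μ + m) (ν₀ := m / 2) (r := 1 / 2) (T := fun t => traceRes a Q (m + t))
    (fun μ => Nat.cast_nonneg _) (by positivity)
    (fun μ h => pos_of_multiplicity_ne_zero hQ hb h)
    (fun t ht => (hasSum_traceRes hQ hb (by positivity : 0 < m + t) (by linarith) hm).2.congr_fun
      fun μ => by rw [add_assoc]) (by norm_num) (by norm_num) hTd
  choose F hF1 hF2 using exists_continuation hQ hb hm
  have hFD : ∀ K, ∀ s ∈ strip (3 / 4) 1, F K s = D s := fun K s hs => by
    rw [hF2 K s hs, hD2 s (by linarith [hs.1]) hs.2]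
  obtain ⟨Z, hZ1, hZ2⟩ := exists_meromorphic_glue (x := 3 / 4) (y := 7 / 8) (by norm_num)
    (by norm_num) (by norm_num) (fun s hs => (hD1 s (by linarith)).2) hF1 hFD
  obtain ⟨E, hE1, hE2, hE3, -, hE4⟩ := exists_freeZeta ha hm
  have hA0 : AnalyticAt ℂ (powerTransform fun t =>
      ((traceRes a Q (m + t) : ℂ) - N * freeTrace a (m + t))) 0 :=
    DifferentiableOn.analyticAt (s := strip (1 - 3 / 2) 1) (fun z hz =>
      (hd.differentiableAt_powerTransform hz.2 hz.1).differentiableWithinAt)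
      ((isOpen_strip _ _).mem_nhds (by constructor <;> norm_num))
  let A : ℂ → ℂ := fun s => N * E s + powerTransform (fun t =>
      ((traceRes a Q (m + t) : ℂ) - N * freeTrace a (m + t))) s
  have hA : AnalyticAt ℂ A 0 := (analyticAt_const.mul hE2).add hA0
  have hAm : MeromorphicOn A (strip (1 - 3 / 2) 1) :=
    ((MeromorphicOn.const (N : ℂ)).fun_mul (hE1.mono_set (Set.subset_univ _))).fun_add
      hd.meromorphicOn_powerTransform
  have hAD : ∀ s ∈ strip (7 / 8) 1, Z s = A s := fun s hs => by
    have h1 : s ∈ strip (3 / 4) 1 := ⟨by linarith [hs.1], hs.2⟩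
    have hs1 : 1 - (1 / 2 : ℝ) < s.re := by linarith [hs.1]
    rw [hZ2 s hs.1, hD2 s hs1 hs.2]
    simp only [A]
    rw [hE4 s h1, ← Decay.powerTransform_const_mul, ← Decay.powerTransform_add
      ((decay_freeTrace ha hm).const_mul _) (hd.mono (by norm_num)) hs.2 hs1]
    simp only [add_sub_cancel]
  have hZA : ∀ᶠ s in 𝓝[≠] (0 : ℂ), Z s = A s :=
    eventually_eq_of_preconnected (hZ1.mono_set (Set.subset_univ _)) hAm
      (isPreconnected_strip _ _) (ofReal_mem_strip (y := 15 / 16) (by norm_num) (by norm_num))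
      (eventually_eq_of_eqOn_strip (by norm_num) (by norm_num : (15 / 16 : ℝ) < 1) hAD)
      (by constructor <;> norm_num)
  obtain ⟨Z', h1, h2, h3, h4⟩ := exists_analytic_at_zero hZ1 hA hZA
  refine ⟨Z', ⟨⟨1, fun s hs => ?_⟩, h1, h2⟩, ?_⟩
  · have h0 : s ≠ 0 := by
      rintro rfl
      rw [zero_re] at hs
      linarith
    rw [h4 s h0, hZ2 s (by linarith)]
    refine (hD1 s (by linarith)).1.congr_fun fun μ => ?_
    rw [sub_neg_eq_add, ofReal_natCast]
  · rw [h3, ← hE3]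
    exact ((hE2.differentiableAt.hasDerivAt.const_mul (N : ℂ)).add
      (hd.hasDerivAt_powerTransform_zero (by norm_num))).deriv

end Zeta

end

section

/-! ### Integrals of products of free resolvent symbols -/

/-- By positivity the convergent sum of the integrals controls the integral of the sum, so
integrability of the limit is obtained and not assumed. -/
theorem integral_hasSum_of_nonneg {ι : Type*} [Countable ι] {F : ι → ℝ → ℝ} {f : ℝ → ℝ} {s : Set ℝ}
    {I : ℝ} (hs : MeasurableSet s) (h0 : ∀ i, ∀ t ∈ s, 0 ≤ F i t)
    (hF : ∀ i, IntegrableOn (F i) s) (hI : HasSum (fun i => ∫ t in s, F i t) I)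
    (hf : ∀ t ∈ s, HasSum (fun i => F i t) (f t)) :
    IntegrableOn f s ∧ ∫ t in s, f t = I := by
  have hae : ∀ i, 0 ≤ᵐ[volume.restrict s] F i := fun i =>
    (ae_restrict_iff' hs).2 (Eventually.of_forall fun t ht => h0 i t ht)
  have hmeas : ∀ i, AEMeasurable (fun t => ENNReal.ofReal (F i t)) (volume.restrict s) := fun i =>
    (hF i).aestronglyMeasurable.aemeasurable.ennreal_ofReal
  have hI0 : ∀ i, 0 ≤ ∫ t in s, F i t := fun i => integral_nonneg_of_ae (hae i)
  have hl : ∫⁻ t in s, ∑' i, ENNReal.ofReal (F i t) ≠ ⊤ := by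
    rw [lintegral_tsum hmeas]
    simp_rw [← fun i => ofReal_integral_eq_lintegral_ofReal (hF i) (hae i)]
    rw [← ENNReal.ofReal_tsum_of_nonneg hI0 hI.summable]
    exact ENNReal.ofReal_ne_top
  have hint := integrable_toReal_of_lintegral_ne_top (AEMeasurable.tsum hmeas) hl
  have e : ∀ t ∈ s, (∑' i, ENNReal.ofReal (F i t)).toReal = f t := fun t ht => by
    rw [← ENNReal.ofReal_tsum_of_nonneg (fun i => h0 i t ht) (hf t ht).summable, (hf t ht).tsum_eq,
      ENNReal.toReal_ofReal ((hf t ht).nonneg fun i => h0 i t ht)]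
  refine ⟨IntegrableOn.congr_fun hint e hs, ?_⟩
  have hn : ∀ i, ∫ t in s, ‖F i t‖ = ∫ t in s, F i t := fun i =>
    setIntegral_congr_fun hs fun t ht => Real.norm_of_nonneg (h0 i t ht)
  have h1 := hasSum_integral_of_summable_integral_norm hF (by simpa only [hn] using hI.summable)
  rw [← h1.unique hI]
  exact setIntegral_congr_fun hs fun t ht => (hf t ht).tsum_eq.symm

theorem tendsto_inv_add (c : ℝ) : Tendsto (fun t : ℝ => (c + t)⁻¹) atTop (𝓝 0) :=
  (tendsto_atTop_add_const_left _ _ tendsto_id).inv_tendsto_atTop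

theorem hasDerivAt_inv_add {c t : ℝ} (hc : 0 < c) (ht : 0 ≤ t) :
    HasDerivAt (fun t : ℝ => (c + t)⁻¹) (-((c + t)⁻¹ ^ 2)) t := by
  have h := ((hasDerivAt_id t).const_add c).inv (by positivity : c + id t ≠ 0)
  refine h.congr_deriv ?_
  simp only [id]
  field_simp

theorem integral_inv_add_sq {c : ℝ} (hc : 0 < c) :
    IntegrableOn (fun t : ℝ => (c + t)⁻¹ ^ 2) (Set.Ioi 0) ∧
      ∫ t in Set.Ioi (0 : ℝ), (c + t)⁻¹ ^ 2 = c⁻¹ := by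
  have hd : ∀ t ∈ Set.Ici (0 : ℝ), HasDerivAt (fun t : ℝ => -(c + t)⁻¹) ((c + t)⁻¹ ^ 2) t :=
    fun t ht => by simpa using (hasDerivAt_inv_add hc ht).fun_neg
  have hp : ∀ t ∈ Set.Ioi (0 : ℝ), 0 ≤ (c + t)⁻¹ ^ 2 := fun t _ => by positivity
  have hl : Tendsto (fun t : ℝ => -(c + t)⁻¹) atTop (𝓝 0) := by
    simpa using (tendsto_inv_add c).neg
  refine ⟨integrableOn_Ioi_deriv_of_nonneg' hd hp hl, ?_⟩
  rw [integral_Ioi_of_hasDerivAt_of_nonneg' hd hp hl]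
  simp

/-- The symmetric integrand is minus the derivative of `(c + t)⁻¹ (d + t)⁻¹`. This is the reason for
symmetrising the second-order trace. -/
theorem integral_inv_add_mul {c d : ℝ} (hc : 0 < c) (hd : 0 < d) :
    IntegrableOn (fun t : ℝ => (c + t)⁻¹ ^ 2 * (d + t)⁻¹ + (c + t)⁻¹ * (d + t)⁻¹ ^ 2) (Set.Ioi 0) ∧
      ∫ t in Set.Ioi (0 : ℝ), ((c + t)⁻¹ ^ 2 * (d + t)⁻¹ + (c + t)⁻¹ * (d + t)⁻¹ ^ 2)
        = c⁻¹ * d⁻¹ := by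
  have hd' : ∀ t ∈ Set.Ici (0 : ℝ), HasDerivAt (fun t : ℝ => -((c + t)⁻¹ * (d + t)⁻¹))
      ((c + t)⁻¹ ^ 2 * (d + t)⁻¹ + (c + t)⁻¹ * (d + t)⁻¹ ^ 2) t := fun t ht => by
    refine ((hasDerivAt_inv_add hc ht).fun_mul (hasDerivAt_inv_add hd ht)).fun_neg.congr_deriv ?_
    ring
  have hp : ∀ t ∈ Set.Ioi (0 : ℝ),
      0 ≤ (c + t)⁻¹ ^ 2 * (d + t)⁻¹ + (c + t)⁻¹ * (d + t)⁻¹ ^ 2 := fun t ht => by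
    have ht' : (0 : ℝ) < t := ht
    positivity
  have hl : Tendsto (fun t : ℝ => -((c + t)⁻¹ * (d + t)⁻¹)) atTop (𝓝 0) := by
    simpa using ((tendsto_inv_add c).mul (tendsto_inv_add d)).neg
  refine ⟨integrableOn_Ioi_deriv_of_nonneg' hd' hp hl, ?_⟩
  rw [integral_Ioi_of_hasDerivAt_of_nonneg' hd' hp hl]
  simp

theorem symb_add (a m t : ℝ) (n : ℤ) : symb a (m + t) n = ((freq a n ^ 2 + m) + t)⁻¹ := by
  rw [symb, add_assoc]

/-! ### Second-order expansion of the trace -/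

/-- Since `e` is an eigenvector of `G`, both outer factors of the remainder become the scalar `g`,
and `VGVBV` has norm at most `v³ γ β`. -/
theorem abs_inner_third_order_le {H : Type*} [NormedAddCommGroup H] [InnerProductSpace ℂ H]
    {V G B : H →L[ℂ] H} {e : H} {g v γ β : ℝ} (hn : ‖e‖ = 1) (hGe : G e = (g : ℂ) • e)
    (hG : ∀ x, ⟪e, G x⟫ = g * ⟪e, x⟫)
    (hB : B = G - G * V * G + G * V * G * V * G - G * V * G * V * B * V * G)
    (hv : ‖V‖ ≤ v) (hγ : ‖G‖ ≤ γ) (hβ : ‖B‖ ≤ β) :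
    |(⟪e, B e⟫).re - g + g ^ 2 * (⟪e, V e⟫).re - g ^ 2 * (⟪e, V (G (V e))⟫).re|
      ≤ g ^ 2 * (v ^ 3 * γ * β) := by
  have h2 : ⟪e, B e⟫ = ⟪e, G e - G (V (G e)) + G (V (G (V (G e)))) -
      G (V (G (V (B (V (G e))))))⟫ := congrArg (fun T : H →L[ℂ] H => ⟪e, T e⟫) hB
  rw [inner_sub_right, inner_add_right, inner_sub_right, hG, hG, hG, hG, hGe] at h2
  simp only [map_smul, inner_smul_right] at h2
  have he : ⟪e, e⟫ = 1 := by
    rw [inner_self_eq_norm_sq_to_K, hn]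
    simp
  rw [he] at h2
  have h3 : ⟪e, B e⟫ - g + ((g ^ 2 : ℝ) : ℂ) * ⟪e, V e⟫ - ((g ^ 2 : ℝ) : ℂ) * ⟪e, V (G (V e))⟫
      = -(((g ^ 2 : ℝ) : ℂ) * ⟪e, V (G (V (B (V e))))⟫) := by
    rw [h2]
    push_cast
    ring
  have h4 := congrArg re h3
  simp only [sub_re, add_re, ofReal_re, re_ofReal_mul, neg_re] at h4
  rw [h4, abs_neg, abs_mul, abs_of_nonneg (by positivity : 0 ≤ g ^ 2)]
  refine mul_le_mul_of_nonneg_left ((abs_re_le_norm _).trans ((norm_inner_le_norm _ _).trans ?_))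
    (by positivity)
  have hv0 : 0 ≤ v := (norm_nonneg _).trans hv
  have hγ0 : 0 ≤ γ := (norm_nonneg _).trans hγ
  have hβ0 : 0 ≤ β := (norm_nonneg _).trans hβ
  rw [hn, one_mul]
  calc _ ≤ v * (γ * (v * (β * (v * ‖e‖)))) :=
        V.le_of_opNorm_le_of_le hv (G.le_of_opNorm_le_of_le hγ (V.le_of_opNorm_le_of_le hv
          (B.le_of_opNorm_le_of_le hβ (V.le_of_opNorm_le hv e))))
    _ = _ := by rw [hn]; ring

section Expansion

variable {N : ℕ} {a : ℝ} {Q : ℝ → Matrix (Fin N) (Fin N) ℂ}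

theorem hsCoef_neg (hQ : IsPotential a Q) (k : ℤ) : hsCoef a Q (-k) = hsCoef a Q k := by
  simp only [hsCoef]
  rw [Finset.sum_comm]
  refine Finset.sum_congr rfl fun j _ => Finset.sum_congr rfl fun i _ => ?_
  rw [fourierCoef_apply, hQ.fcoef_neg, norm_conj]

/-- The involution `(n, k) ↦ (n + k, -k)` of pairs of integers. -/
def shiftPair : ℤ × ℤ ≃ ℤ × ℤ :=
  Function.Involutive.toPerm (fun p => (p.1 + p.2, -p.2)) fun p => by simp

/-- The sum of `h_k g_n² g_{n+k}` over all `n` and `k`. -/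
def secondTrace (a : ℝ) (Q : ℝ → Matrix (Fin N) (Fin N) ℂ) (w : ℝ) : ℝ :=
  ∑' p : ℤ × ℤ, symb a w p.1 ^ 2 * (symb a w (p.1 + p.2) * hsCoef a Q p.2)

theorem hasSum_symb_sq_free {w : ℝ} (ha : 0 < a) (hw : 0 < w) :
    HasSum (fun n => symb a w n ^ 2) (∑' n, symb a w n ^ 2) := by
  refine (Summable.of_nonneg_of_le (fun n => by positivity) (fun n => ?_)
    ((hasSum_freeTrace ha hw).summable.mul_left w⁻¹)).hasSum
  rw [sq]
  exact mul_le_mul_of_nonneg_right (symb_le hw n) (symb_pos hw n).le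

theorem hasSum_secondTrace {w : ℝ} (ha : 0 < a) (hQ : IsPotential a Q) (hw : 0 < w) :
    HasSum (fun p : ℤ × ℤ => symb a w p.1 ^ 2 * (symb a w (p.1 + p.2) * hsCoef a Q p.2))
      (secondTrace a Q w) := by
  have h := (hasSum_symb_sq_free ha hw).summable.mul_of_nonneg
    ((summable_hsCoef ha hQ).mul_left w⁻¹) (fun n => by positivity)
    fun k => mul_nonneg (by positivity) (hsCoef_nonneg a Q k)
  have h0 := fun n => (symb_pos (a := a) hw n).le
  refine (Summable.of_nonneg_of_le (fun p => ?_) (fun p => ?_) h).hasSum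
  · exact mul_nonneg (by positivity) (mul_nonneg (h0 _) (hsCoef_nonneg a Q _))
  · exact mul_le_mul_of_nonneg_left (mul_le_mul_of_nonneg_right (symb_le hw _)
      (hsCoef_nonneg a Q _)) (by positivity)

/-- The average of the sum with its image under `shiftPair`, which exchanges `g_n` and `g_{n+k}` and
preserves `h_k` because `h` is even. -/
theorem hasSum_secondTrace_symm {w : ℝ} (ha : 0 < a) (hQ : IsPotential a Q) (hw : 0 < w) :
    HasSum (fun p : ℤ × ℤ => hsCoef a Q p.2 * (symb a w p.1 ^ 2 * symb a w (p.1 + p.2) +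
      symb a w p.1 * symb a w (p.1 + p.2) ^ 2) / 2) (secondTrace a Q w) := by
  have h1 := hasSum_secondTrace ha hQ hw
  have h2 := shiftPair.hasSum_iff.2 h1
  refine HasSum.of_eq ((h1.add h2).div_const 2) (by ring) fun p => ?_
  have e : shiftPair p = (p.1 + p.2, -p.2) := rfl
  simp only [Function.comp, e, add_neg_cancel_right, hsCoef_neg hQ]
  ring

theorem integral_symb_sq {m : ℝ} (ha : 0 < a) (hm : 0 < m) :
    IntegrableOn (fun t => ∑' n, symb a (m + t) n ^ 2) (Set.Ioi 0) ∧
      ∫ t in Set.Ioi (0 : ℝ), ∑' n, symb a (m + t) n ^ 2 = freeTrace a m := by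
  have hc : ∀ n : ℤ, 0 < freq a n ^ 2 + m := fun n => by positivity
  refine integral_hasSum_of_nonneg measurableSet_Ioi (F := fun n t => symb a (m + t) n ^ 2)
    (fun n t _ => by positivity) (fun n => ?_) ?_ fun t ht => ?_
  · simp only [symb_add]
    exact (integral_inv_add_sq (hc n)).1
  · simp only [symb_add, fun n => (integral_inv_add_sq (hc n)).2]
    exact hasSum_freeTrace ha hm
  · have ht' : (0 : ℝ) < t := ht
    exact hasSum_symb_sq_free ha (by positivity)

theorem integral_secondTrace {m : ℝ} (ha : 0 < a) (hQ : IsPotential a Q) (hm : 0 < m) {Θ : ℝ}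
    (hΘ : HasSum (fun p : ℤ × ℤ => hsCoef a Q p.2 * (symb a m p.1 * symb a m (p.1 + p.2))) Θ) :
    IntegrableOn (fun t => secondTrace a Q (m + t)) (Set.Ioi 0) ∧
      ∫ t in Set.Ioi (0 : ℝ), secondTrace a Q (m + t) = Θ / 2 := by
  have hc : ∀ n : ℤ, 0 < freq a n ^ 2 + m := fun n => by positivity
  refine integral_hasSum_of_nonneg measurableSet_Ioi (F := fun (p : ℤ × ℤ) t =>
    hsCoef a Q p.2 * (symb a (m + t) p.1 ^ 2 * symb a (m + t) (p.1 + p.2) +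
      symb a (m + t) p.1 * symb a (m + t) (p.1 + p.2) ^ 2) / 2)
    (fun p t ht => ?_) (fun p => ?_) ?_ fun t ht => ?_
  · have ht' : (0 : ℝ) < t := ht
    have h1 := symb_pos (a := a) (by positivity : 0 < m + t) p.1
    have h2 := symb_pos (a := a) (by positivity : 0 < m + t) (p.1 + p.2)
    have h3 := hsCoef_nonneg a Q p.2
    positivity
  · simp only [symb_add]
    exact ((integral_inv_add_mul (hc _) (hc _)).1.const_mul _).div_const _
  · refine (hΘ.div_const 2).congr_fun fun p => ?_
    simp only [symb_add]
    rw [integral_div, integral_const_mul, (integral_inv_add_mul (hc _) (hc _)).2]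
    rfl
  · have ht' : (0 : ℝ) < t := ht
    exact hasSum_secondTrace_symm ha hQ (by positivity)

variable [hT : Fact (0 < 2 * Real.pi * a)] (hQ : IsPotential a Q)

theorem hasSum_weighted_hsCoef (n : ℤ) {y : ℤ → ℝ} {s : Fin N → ℝ}
    (h : ∀ i, HasSum (fun q : ℤ × Fin N => y q.1 *
      ‖⟪circleBasis N a q, potOp hQ (circleBasis N a (n, i))⟫‖ ^ 2) (s i)) :
    HasSum (fun k => y (n + k) * hsCoef a Q k) (∑ i, s i) := by
  have h1 : HasSum (fun q : ℤ × Fin N => ∑ i, y q.1 *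
      ‖⟪circleBasis N a q, potOp hQ (circleBasis N a (n, i))⟫‖ ^ 2) (∑ i, s i) :=
    hasSum_sum fun i _ => h i
  have h2 := h1.prod_fiberwise (fun l => hasSum_fintype _)
  refine HasSum.congr_fun ((Equiv.addLeft n).hasSum_iff.2 h2) fun k => ?_
  simp only [Function.comp, Equiv.coe_addLeft, inner_potOp_basis, add_sub_cancel_left, hsCoef]
  rw [Finset.mul_sum]
  refine Finset.sum_congr rfl fun j _ => ?_
  rw [Finset.mul_sum]

theorem hasSum_norm_sq_inner (f : CircleL2 N a) :
    HasSum (fun q => ‖⟪circleBasis N a q, f⟫‖ ^ 2) (‖f‖ ^ 2) := by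
  have h := Complex.hasSum_re ((circleBasis N a).hasSum_inner_mul_inner f f)
  have e : (⟪f, f⟫).re = ‖f‖ ^ 2 := by
    rw [inner_self_eq_norm_sq_to_K]
    exact_mod_cast rfl
  rw [e] at h
  refine h.congr_fun fun q => ?_
  rw [← inner_conj_symm f, conj_mul']
  norm_cast

theorem norm_potOp_basis_le {v : ℝ} (hv : ‖potOp hQ‖ ≤ v) (p) :
    ‖potOp hQ (circleBasis N a p)‖ ≤ v := by
  refine (ContinuousLinearMap.le_opNorm _ _).trans ?_
  rw [(circleBasis N a).orthonormal.1, mul_one]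
  exact hv

/-- The `N` basis vectors of frequency zero have images under `V` of norm at most `v`, and the
squared norms of these images add up to the sum of all the coefficients. -/
theorem tsum_hsCoef_le {v : ℝ} (hv : ‖potOp hQ‖ ≤ v) : ∑' k, hsCoef a Q k ≤ N * v ^ 2 := by
  have h := hasSum_weighted_hsCoef hQ 0 (y := fun _ => 1)
    (fun i => by simpa only [one_mul] using hasSum_norm_sq_inner (potOp hQ (circleBasis N a (0, i))))
  simp only [one_mul] at h
  rw [h.tsum_eq]
  calc _ ≤ ∑ _i : Fin N, v ^ 2 := Finset.sum_le_sum fun i _ =>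
        pow_le_pow_left₀ (norm_nonneg _) (norm_potOp_basis_le hQ hv _) 2
    _ = _ := by simp

theorem trace_fourierCoef_re_le {v : ℝ} (hv : ‖potOp hQ‖ ≤ v) :
    |(fourierCoef a Q 0).trace.re| ≤ N * v := by
  refine (abs_re_le_norm _).trans ?_
  rw [Matrix.trace]
  refine (norm_sum_le_of_le _ (f := fun i => (fourierCoef a Q 0).diag i) (n := fun _ => v)
    fun i _ => ?_).trans_eq (by simp)
  have h := inner_potOp_basis hQ 0 0 i i
  rw [sub_zero] at h
  rw [Matrix.diag_apply, ← h]
  refine (norm_inner_le_norm _ _).trans ?_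
  rw [(circleBasis N a).orthonormal.1, one_mul]
  exact norm_potOp_basis_le hQ hv _

omit hT in
theorem trace_fourierCoef_eq_re (hQ : IsPotential a Q) :
    (fourierCoef a Q 0).trace = ((fourierCoef a Q 0).trace.re : ℂ) := by
  refine (conj_eq_iff_re.1 ?_).symm
  rw [Matrix.trace, map_sum]
  refine Finset.sum_congr rfl fun i _ => ?_
  rw [Matrix.diag_apply, ← hQ.fcoef_neg, neg_zero, fourierCoef_apply]

variable {m w v : ℝ} (hv : ‖potOp hQ‖ ≤ v) (hvm : v ≤ m / 2) (hw : 0 < w) (hmw : m ≤ w)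

theorem hasSum_second_order (p) :
    HasSum (fun q => symb a w q.1 * ‖⟪circleBasis N a q, potOp hQ (circleBasis N a p)⟫‖ ^ 2)
      (⟪circleBasis N a p, potOp hQ (freeRes N a hw (potOp hQ (circleBasis N a p)))⟫).re := by
  rw [← potOp_symm]
  have h := Complex.hasSum_re ((circleBasis N a).hasSum_inner_mul_inner
    (potOp hQ (circleBasis N a p)) (freeRes N a hw (potOp hQ (circleBasis N a p))))
  refine h.congr_fun fun q => ?_
  rw [inner_freeRes, mul_left_comm, ← inner_conj_symm (potOp hQ (circleBasis N a p)), conj_mul']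
  norm_cast

include hv hvm hmw

theorem abs_inner_res_second_order_le (p) :
    |(⟪circleBasis N a p, res hQ hw (circleBasis N a p)⟫).re - symb a w p.1
      + symb a w p.1 ^ 2 * (⟪circleBasis N a p, potOp hQ (circleBasis N a p)⟫).re
      - symb a w p.1 ^ 2 *
        (⟪circleBasis N a p, potOp hQ (freeRes N a hw (potOp hQ (circleBasis N a p)))⟫).re|
      ≤ symb a w p.1 ^ 2 * (2 * v ^ 3 * (w⁻¹) ^ 2) := by
  have hb : ‖potOp hQ‖ ≤ m / 2 := hv.trans hvm
  refine (abs_inner_third_order_le ((circleBasis N a).orthonormal.1 p) (freeRes_basis hw p)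
    (fun x => inner_freeRes hw x p) (perturbed_third_order (norm_GV_lt hQ hb hw hmw)) hv
    (norm_freeRes_le hw) (norm_res_le hQ hb hw hmw)).trans_eq ?_
  ring

include hw in
-- In the remainder `w⁻²` is weakened to `m⁻²`, so that it depends on `w` only through `∑ g_n²`,
-- whose integral is known exactly.
theorem abs_traceRes_second_order_le (hm : 0 < m) :
    |traceRes a Q w - N * freeTrace a w
      + (fourierCoef a Q 0).trace.re * ∑' n, symb a w n ^ 2 - secondTrace a Q w|
      ≤ N * (2 * v ^ 3 * (m⁻¹) ^ 2) * ∑' n, symb a w n ^ 2 := by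
  have ha := pos_of_fact hT
  have hb : ‖potOp hQ‖ ≤ m / 2 := hv.trans hvm
  have h1 : HasSum (fun n : ℤ => ∑ i,
      (⟪circleBasis N a (n, i), res hQ hw (circleBasis N a (n, i))⟫).re) (traceRes a Q w) :=
    (Complex.hasSum_re (hasSum_traceRes hQ hb hw hmw hm).1).prod_fiberwise
      fun n => hasSum_fintype _
  have h2 := (hasSum_freeTrace ha hw).mul_left (N : ℝ)
  have h3 := (hasSum_symb_sq_free ha hw).mul_left (fourierCoef a Q 0).trace.re
  have h4 : HasSum (fun n : ℤ => symb a w n ^ 2 * ∑ i, (⟪circleBasis N a (n, i),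
      potOp hQ (freeRes N a hw (potOp hQ (circleBasis N a (n, i))))⟫).re) (secondTrace a Q w) :=
    (hasSum_secondTrace ha hQ hw).prod_fiberwise fun n =>
      (hasSum_weighted_hsCoef hQ n fun i => hasSum_second_order hQ hw (n, i)).mul_left _
  have h5 := ((h1.sub h2).add h3).sub h4
  have h6 := h5.norm_le_of_bounded
    ((hasSum_symb_sq_free ha hw).mul_left (N * (2 * v ^ 3 * (m⁻¹) ^ 2))) fun n => by
      have htr : (fourierCoef a Q 0).trace.re = ∑ i, (⟪circleBasis N a (n, i),
          potOp hQ (circleBasis N a (n, i))⟫).re := by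
        rw [Matrix.trace, re_sum]
        refine Finset.sum_congr rfl fun i _ => ?_
        rw [inner_potOp_basis, sub_self, Matrix.diag_apply]
      have hN : (N : ℝ) * symb a w n = ∑ _i : Fin N, symb a w n := by simp
      rw [htr, hN, mul_comm _ (symb a w n ^ 2), Finset.mul_sum, Finset.mul_sum,
        ← Finset.sum_sub_distrib, ← Finset.sum_add_distrib, ← Finset.sum_sub_distrib,
        Real.norm_eq_abs]
      refine (Finset.abs_sum_le_sum_abs _ _).trans ((Finset.sum_le_sum fun i _ =>
        abs_inner_res_second_order_le hQ hv hvm hw hmw (n, i)).trans ?_)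
      have hv0 : 0 ≤ v := (norm_nonneg _).trans hv
      simp only
      rw [Finset.sum_const, Finset.card_univ, Fintype.card_fin, nsmul_eq_mul]
      have : w⁻¹ ≤ m⁻¹ := by gcongr
      calc _ = N * (2 * v ^ 3 * w⁻¹ ^ 2) * symb a w n ^ 2 := by ring
        _ ≤ _ := by gcongr
  exact h6

end Expansion

end

section

/-! ### Expansion of the determinant -/

theorem abs_integral_expansion_le {α : Type*} [MeasurableSpace α] {ν : Measure α}
    {f g h : α → ℝ} {c K : ℝ} (hf : Integrable f ν) (hg : Integrable g ν) (hh : Integrable h ν)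
    (hle : ∀ᵐ t ∂ν, |f t + c * g t - h t| ≤ K * g t) :
    |(∫ t, f t ∂ν) + c * (∫ t, g t ∂ν) - ∫ t, h t ∂ν| ≤ K * ∫ t, g t ∂ν := by
  have e : (∫ t, f t ∂ν) + c * (∫ t, g t ∂ν) - ∫ t, h t ∂ν = ∫ t, f t + c * g t - h t ∂ν := by
    rw [← integral_const_mul, ← integral_add hf (hg.const_mul c)]
    exact (integral_sub (hf.add (hg.const_mul c)) hh).symm
  rw [e, ← integral_const_mul, ← Real.norm_eq_abs]
  exact norm_integral_le_of_norm_le (hg.const_mul K) hle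

variable {N : ℕ} {a : ℝ} {Q : ℝ → Matrix (Fin N) (Fin N) ℂ}

theorem IsPotential.const_smul (hQ : IsPotential a Q) (ε : ℝ) :
    IsPotential a fun x => (ε : ℂ) • Q x := by
  refine ⟨⟨fun i j => ?_, fun x => ?_⟩, fun x => ?_⟩
  · exact (hQ.1.1 i j).const_smul (ε : ℂ)
  · simp only [hQ.1.2 x]
  · rw [Matrix.IsHermitian, Matrix.conjTranspose_smul, (hQ.2 x).eq]
    simp

theorem fourierCoef_const_smul (c : ℂ) (n : ℤ) :
    fourierCoef a (fun x => c • Q x) n = c • fourierCoef a Q n := by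
  ext i j
  rw [Matrix.smul_apply, fourierCoef_apply, fourierCoef_apply, smul_eq_mul, ← fcoef_const_mul]
  rfl

theorem hsCoef_const_smul (ε : ℝ) (n : ℤ) :
    hsCoef a (fun x => (ε : ℂ) • Q x) n = ε ^ 2 * hsCoef a Q n := by
  simp only [hsCoef, fourierCoef_const_smul, Matrix.smul_apply, smul_eq_mul, norm_mul, mul_pow,
    norm_real, Real.norm_eq_abs, sq_abs, Finset.mul_sum]

theorem norm_const_smul_le {m ε : ℝ}
    (h : ∀ x, ‖Matrix.toEuclideanCLM (n := Fin N) (𝕜 := ℂ) (Q x)‖ ≤ m) (x : ℝ) :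
    ‖Matrix.toEuclideanCLM (n := Fin N) (𝕜 := ℂ) ((ε : ℂ) • Q x)‖ ≤ |ε| * m := by
  rw [map_smul, norm_smul, norm_real, Real.norm_eq_abs]
  exact mul_le_mul_of_nonneg_left (h x) (abs_nonneg _)

/-- The sum over `k` of the `k`-th Hilbert-Schmidt coefficients against the resolvent symbol. -/
def secondSum (a k : ℝ) (Q : ℝ → Matrix (Fin N) (Fin N) ℂ) : ℝ :=
  ∑' n, resolventSymbol a (-k ^ 2) n * hsCoef a Q n

theorem summable_resolventSymbol_mul {k : ℝ} (ha : 0 < a) (hk : 0 < k) (hQ : IsPotential a Q) :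
    Summable fun n => resolventSymbol a (-k ^ 2) n * hsCoef a Q n := by
  have hl : -k ^ 2 < 0 := neg_lt_zero.2 (by positivity)
  exact Summable.of_nonneg_of_le
    (fun n => mul_nonneg (resolventSymbol_pos hl a n).le (hsCoef_nonneg a Q n))
    (fun n => mul_le_mul_of_nonneg_right (resolventSymbol_le hl a n) (hsCoef_nonneg a Q n))
    ((summable_hsCoef ha hQ).mul_left _)

/-- Every nonzero frequency carries the factor `coth`. At frequency zero it is absent and `expTail`
appears instead, which accounts for the two terms in `hsCoef a Q 0`. -/
theorem hasSum_pair_symb {k : ℝ} (ha : 0 < a) (hk : 0 < k) (hQ : IsPotential a Q) :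
    HasSum (fun p : ℤ × ℤ => hsCoef a Q p.2 * (symb a (k ^ 2) p.1 * symb a (k ^ 2) (p.1 + p.2)))
      (2 * Real.pi * a / k * (cothPi (a * k) * secondSum a k Q -
        (cothPi (a * k) - 1) * (resolventSymbol a (-k ^ 2) 0 * hsCoef a Q 0)) +
        a ^ 4 * expTail (a * k) * hsCoef a Q 0) := by
  have hw : 0 < k ^ 2 := by positivity
  have hs : Summable fun p : ℤ × ℤ =>
      hsCoef a Q p.2 * (symb a (k ^ 2) p.1 * symb a (k ^ 2) (p.1 + p.2)) := by
    have h1 := (summable_symb ha hw).mul_of_nonneg ((summable_hsCoef ha hQ).mul_right (k ^ 2)⁻¹)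
      (fun n => (symb_pos hw n).le)
      (fun n => mul_nonneg (hsCoef_nonneg a Q n) (inv_pos.2 hw).le)
    refine Summable.of_nonneg_of_le (fun p => ?_) (fun p => ?_) h1
    · exact mul_nonneg (hsCoef_nonneg a Q _) (mul_pos (symb_pos hw _) (symb_pos hw _)).le
    · have := mul_le_mul_of_nonneg_left (symb_le (a := a) hw (p.1 + p.2))
        (mul_nonneg (hsCoef_nonneg a Q p.2) (symb_pos (a := a) hw p.1).le)
      calc _ = hsCoef a Q p.2 * symb a (k ^ 2) p.1 * symb a (k ^ 2) (p.1 + p.2) := by ring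
        _ ≤ _ := this
        _ = _ := by ring
  have h2 := ((Equiv.prodComm ℤ ℤ).hasSum_iff.2 hs.hasSum)
  have h3 := h2.prod_fiberwise (g := fun l => hsCoef a Q l * (cothPi (a * k) *
      (2 * Real.pi * a / k) * resolventSymbol a (-k ^ 2) l + if l = 0 then
        a ^ 4 * expTail (a * k) - (cothPi (a * k) - 1) * (2 * Real.pi * a / k) *
          resolventSymbol a (-k ^ 2) 0 else 0)) fun l => by
    simp only [Function.comp, Equiv.prodComm_apply, Prod.swap_prod_mk]
    refine HasSum.mul_left _ ?_
    by_cases hl : l = 0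
    · subst hl
      refine HasSum.of_eq (hasSum_symb_sq ha hk) ?_ fun n => ?_
      · rw [if_pos rfl]
        ring
      · rw [add_zero, ← sq]
    · rw [if_neg hl, add_zero]
      exact hasSum_symb_mul_shift ha hk hl
  have h4 : HasSum (fun l => hsCoef a Q l * (cothPi (a * k) *
      (2 * Real.pi * a / k) * resolventSymbol a (-k ^ 2) l + if l = 0 then
        a ^ 4 * expTail (a * k) - (cothPi (a * k) - 1) * (2 * Real.pi * a / k) *
          resolventSymbol a (-k ^ 2) 0 else 0)) (cothPi (a * k) * (2 * Real.pi * a / k) *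
      secondSum a k Q + hsCoef a Q 0 * (a ^ 4 * expTail (a * k) - (cothPi (a * k) - 1) *
        (2 * Real.pi * a / k) * resolventSymbol a (-k ^ 2) 0)) := by
    refine (((summable_resolventSymbol_mul ha hk hQ).hasSum.mul_left (cothPi (a * k) *
      (2 * Real.pi * a / k))).add (hasSum_ite_eq 0 (hsCoef a Q 0 * (a ^ 4 * expTail (a * k) -
        (cothPi (a * k) - 1) * (2 * Real.pi * a / k) * resolventSymbol a (-k ^ 2) 0)))).congr_fun
      fun l => ?_
    by_cases hl : l = 0
    · subst hl
      simp only [if_true]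
      ring
    · simp only [hl, if_false]
      ring
  refine HasSum.of_eq hs.hasSum ?_ fun _ => rfl
  rw [h3.unique h4]
  ring

theorem secondSum_bounds {k : ℝ} (ha : 0 < a) (hk : 0 < k) (hQ : IsPotential a Q) :
    resolventSymbol a (-k ^ 2) 0 * hsCoef a Q 0 ≤ secondSum a k Q ∧
      secondSum a k Q ≤ (4 * k ^ 2)⁻¹ * ∑' n, hsCoef a Q n := by
  have hl : -k ^ 2 < 0 := neg_lt_zero.2 (by positivity)
  have h := summable_resolventSymbol_mul ha hk hQ
  refine ⟨h.le_tsum 0 fun n _ => mul_nonneg (resolventSymbol_pos hl a n).le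
    (hsCoef_nonneg a Q n), ?_⟩
  rw [← tsum_mul_left]
  refine h.tsum_le_tsum (fun n => mul_le_mul_of_nonneg_right ?_ (hsCoef_nonneg a Q n))
    ((summable_hsCoef ha hQ).mul_left _)
  have := resolventSymbol_le hl a n
  rwa [mul_neg, neg_mul, neg_neg] at this

theorem secondSum_const_smul (k ε : ℝ) :
    secondSum a k (fun x => (ε : ℂ) • Q x) = ε ^ 2 * secondSum a k Q := by
  simp only [secondSum, hsCoef_const_smul]
  rw [← tsum_mul_left]
  exact tsum_congr fun n => by ring

theorem freeTrace_sq {k : ℝ} (hk : 0 < k) :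
    freeTrace a (k ^ 2) = Real.pi * a / k * cothPi (a * k) := by
  rw [freeTrace, Real.sqrt_sq hk.le]

section

variable [hT : Fact (0 < 2 * Real.pi * a)]

/-- Integration in `t` turns `∑ g_n²` into `freeTrace` and the second-order trace into half of the
pair sum, both at `w = k²`; the pointwise remainder is integrated in the same way. -/
theorem exists_integral_expansion {k v : ℝ} (hQ : IsPotential a Q) (hk : 0 < k)
    (hv : ‖potOp hQ‖ ≤ v) (hvm : v ≤ k ^ 2 / 2) : ∃ J : ℝ,
    ∫ t in Set.Ioi (0 : ℝ), ((traceRes a Q (k ^ 2 + t) : ℂ) - N * freeTrace a (k ^ 2 + t)) = J ∧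
    |J + (fourierCoef a Q 0).trace.re * freeTrace a (k ^ 2) -
      (Real.pi * a / k * (cothPi (a * k) * secondSum a k Q -
        (cothPi (a * k) - 1) * (resolventSymbol a (-k ^ 2) 0 * hsCoef a Q 0)) +
        a ^ 4 * expTail (a * k) * hsCoef a Q 0 / 2)| ≤
      N * (2 * v ^ 3 * ((k ^ 2)⁻¹) ^ 2) * freeTrace a (k ^ 2) := by
  have ha := pos_of_fact hT
  have hm : 0 < k ^ 2 := by positivity
  have hd := decay_traceRes_sub hQ (hv.trans hvm) hm
  have hi : IntegrableOn (fun t => ((traceRes a Q (k ^ 2 + t) : ℂ) -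
      N * freeTrace a (k ^ 2 + t))) (Set.Ioi 0) := by
    have h := hd.mellinConvergent (u := 1) (by simp) (by norm_num)
    refine IntegrableOn.congr_fun h (fun t _ => ?_) measurableSet_Ioi
    simp
  have e : ∀ t : ℝ, ((traceRes a Q (k ^ 2 + t) : ℂ) - N * freeTrace a (k ^ 2 + t)) =
      ((traceRes a Q (k ^ 2 + t) - N * freeTrace a (k ^ 2 + t) : ℝ) : ℂ) := fun t => by
    push_cast
    rfl
  have hir : IntegrableOn (fun t => traceRes a Q (k ^ 2 + t) - N * freeTrace a (k ^ 2 + t))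
      (Set.Ioi 0) := by
    refine IntegrableOn.congr_fun hi.re (fun t _ => ?_) measurableSet_Ioi
    simp only [e]
    exact ofReal_re _
  refine ⟨∫ t in Set.Ioi (0 : ℝ), (traceRes a Q (k ^ 2 + t) - N * freeTrace a (k ^ 2 + t)), ?_, ?_⟩
  · simp only [e]
    exact integral_ofReal
  · obtain ⟨s1, s2⟩ := integral_symb_sq ha hm
    obtain ⟨r1, r2⟩ := integral_secondTrace ha hQ hm (hasSum_pair_symb ha hk hQ)
    have h := abs_integral_expansion_le (c := (fourierCoef a Q 0).trace.re)
      (K := N * (2 * v ^ 3 * ((k ^ 2)⁻¹) ^ 2)) hir s1 r1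
      ((ae_restrict_iff' measurableSet_Ioi).2 (Eventually.of_forall fun t ht => by
        have ht' : (0 : ℝ) < t := ht
        exact abs_traceRes_second_order_le hQ hv hvm (by positivity) (by linarith) hm))
    rw [s2, r2] at h
    convert h using 3
    ring

end

/-- The corrections of order `ε ^ j`. -/
def expCorrection (a k : ℝ) (Q : ℝ → Matrix (Fin N) (Fin N) ℂ) : Fin 3 → ℝ :=
  ![N * (2 * Real.log (1 - Real.exp (-(2 * Real.pi * (a * k))))),
    Real.pi * a / k * (cothPi (a * k) - 1) * (fourierCoef a Q 0).trace.re,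
    -(Real.pi * a / k * (cothPi (a * k) - 1) *
      (secondSum a k Q - resolventSymbol a (-k ^ 2) 0 * hsCoef a Q 0)) -
      a ^ 4 * expTail (a * k) * hsCoef a Q 0 / 2]

theorem exp_neg_two_pi_le_half {y : ℝ} (hy : 1 ≤ y) : Real.exp (-(2 * Real.pi * y)) ≤ 1 / 2 := by
  have h1 : 1 ≤ 2 * Real.pi * y := by nlinarith [Real.pi_gt_three]
  have h2 := Real.add_one_le_exp (2 * Real.pi * y)
  rw [Real.exp_neg, one_div]
  exact inv_anti₀ (by norm_num) (by linarith)

theorem cothPi_sub_one_le {y : ℝ} (hy : 1 ≤ y) :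
    cothPi y - 1 ≤ 4 * Real.exp (-(2 * Real.pi * y)) := by
  have h1 := exp_neg_two_pi_le_half hy
  have h2 := Real.exp_pos (-(2 * Real.pi * y))
  rw [cothPi_sub_one (by linarith), div_le_iff₀ (by linarith)]
  nlinarith

theorem expTail_bounds {y : ℝ} (hy : 1 ≤ y) :
    0 ≤ expTail y ∧ y ^ 2 * expTail y ≤ 88 * Real.exp (-(2 * Real.pi * y)) := by
  have h1 := exp_neg_two_pi_le_half hy
  rw [expTail]
  set q := Real.exp (-(2 * Real.pi * y)) with hq
  have h2 : 0 < q := Real.exp_pos _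
  have hp := Real.pi_pos
  have hp' := Real.pi_lt_d2
  have hy0 : 0 < y := by linarith
  have h3 : 0 < 1 - q := by linarith
  refine ⟨by positivity, ?_⟩
  -- Here `(1 - q)² ≥ 1/4` and `2π ≤ 26/4`. The final constant `88` is an upper bound for `π (26 +
  -- 2)`.
  have e1 : 2 * Real.pi * q / (1 - q) ^ 2 ≤ 26 * q := by
    rw [div_le_iff₀ (by positivity)]
    have : (1 / 4 : ℝ) ≤ (1 - q) ^ 2 := by nlinarith
    have : 26 * q * (1 / 4) ≤ 26 * q * (1 - q) ^ 2 := by gcongr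
    nlinarith
  have e2 : q / (1 - q) / y ≤ 2 * q := by
    rw [div_div, div_le_iff₀ (by positivity)]
    have : 1 / 2 * 1 ≤ (1 - q) * y := by
      apply mul_le_mul <;> linarith
    nlinarith
  calc _ = Real.pi * (2 * Real.pi * q / (1 - q) ^ 2 + q / (1 - q) / y) := by
        field_simp
    _ ≤ 3.142 * (26 * q + 2 * q) := by
        have : 2 * Real.pi * q / (1 - q) ^ 2 + q / (1 - q) / y ≤ 26 * q + 2 * q := by linarith
        apply mul_le_mul _ this (by positivity) (by norm_num)
        have := Real.pi_lt_d4
        linarith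
    _ ≤ _ := by linarith

theorem abs_expCorrection_le {k : ℝ} (ha : 0 < a) (hk : 0 < k) (hR : 1 ≤ a * k)
    (hQ : IsPotential a Q)
    (hn : ∀ x, ‖Matrix.toEuclideanCLM (n := Fin N) (𝕜 := ℂ) (Q x)‖ ≤ k ^ 2) (j : Fin 3) :
    |expCorrection a k Q j| ≤
      100 * N * (a * k) ^ (j : ℕ) * Real.exp (-(2 * Real.pi * (a * k))) := by
  have : Fact (0 < 2 * Real.pi * a) := ⟨by positivity⟩
  have hv := norm_potOp_le hQ (sq_nonneg k) hn
  have b1 := trace_fourierCoef_re_le hQ hv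
  have b2 := tsum_hsCoef_le hQ hv
  have hq := exp_neg_two_pi_le_half hR
  have hc := cothPi_sub_one_le hR
  have hc0 : 0 ≤ cothPi (a * k) - 1 := by linarith [one_le_cothPi (by linarith : 0 < a * k)]
  obtain ⟨t0, t1⟩ := expTail_bounds hR
  have hq0 := Real.exp_pos (-(2 * Real.pi * (a * k)))
  have hlog := neg_log_one_sub_le hq0.le hq
  obtain ⟨s0, s1⟩ := secondSum_bounds ha hk hQ
  have hl : -k ^ 2 < 0 := neg_lt_zero.2 (by positivity)
  have s2 : 0 ≤ resolventSymbol a (-k ^ 2) 0 * hsCoef a Q 0 :=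
    mul_nonneg (resolventSymbol_pos hl a 0).le (hsCoef_nonneg a Q 0)
  have h0 : hsCoef a Q 0 ≤ ∑' n, hsCoef a Q n :=
    (summable_hsCoef ha hQ).le_tsum 0 fun n _ => hsCoef_nonneg a Q n
  have h00 := hsCoef_nonneg a Q 0
  have hp := Real.pi_pos
  have hp' := Real.pi_lt_d2
  have hN : (0 : ℝ) ≤ N := Nat.cast_nonneg N
  set q := Real.exp (-(2 * Real.pi * (a * k)))
  have hR0 : 0 < a * k := by linarith
  have hNq : 0 ≤ N * q := by positivity
  fin_cases j
  · simp only [expCorrection, Matrix.cons_val_zero, Fin.zero_eta, pow_zero, mul_one]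
    rw [abs_mul, abs_of_nonneg hN]
    calc _ ≤ N * (4 * q) := by gcongr
      _ ≤ _ := by linarith
  · simp only [expCorrection, Fin.mk_one, Matrix.cons_val_one, Matrix.cons_val_zero,
      pow_one]
    rw [abs_mul, abs_of_nonneg (by positivity : 0 ≤ Real.pi * a / k * (cothPi (a * k) - 1))]
    calc _ ≤ Real.pi * a / k * (4 * q) * (N * k ^ 2) := by gcongr
      _ = Real.pi * 4 * (N * (a * k) * q) := by field_simp
      _ ≤ 100 * (N * (a * k) * q) := by gcongr; linarith
      _ = _ := by ring
  · simp only [expCorrection, Fin.reduceFinMk, Matrix.cons_val]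
    have u1 : 0 ≤ Real.pi * a / k * (cothPi (a * k) - 1) *
        (secondSum a k Q - resolventSymbol a (-k ^ 2) 0 * hsCoef a Q 0) :=
      mul_nonneg (by positivity) (by linarith)
    have u2 : 0 ≤ a ^ 4 * expTail (a * k) * hsCoef a Q 0 / 2 := by positivity
    have u3 : Real.pi * a / k * (cothPi (a * k) - 1) *
        (secondSum a k Q - resolventSymbol a (-k ^ 2) 0 * hsCoef a Q 0) ≤
        4 * (N * (a * k) ^ 2 * q) :=
      calc _ ≤ Real.pi * a / k * (4 * q) * ((4 * k ^ 2)⁻¹ * (N * (k ^ 2) ^ 2)) := by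
            gcongr
            have : (4 * k ^ 2)⁻¹ * ∑' n, hsCoef a Q n ≤ (4 * k ^ 2)⁻¹ * (N * (k ^ 2) ^ 2) := by
              gcongr
            linarith
        _ = Real.pi * (N * ((a * k) * 1) * q) := by field_simp
        -- This term is only of order `a k`; `1 ≤ a k` raises it to the quadratic order of the bound
        -- for the `expTail` term.
        _ ≤ 4 * (N * ((a * k) * (a * k)) * q) := by gcongr; linarith
        _ = _ := by ring
    have u4 : a ^ 4 * expTail (a * k) * hsCoef a Q 0 / 2 ≤ 44 * (N * (a * k) ^ 2 * q) :=
      calc _ ≤ a ^ 4 * expTail (a * k) * (N * (k ^ 2) ^ 2) / 2 := by gcongr; linarith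
        _ = N * (a * k) ^ 2 * ((a * k) ^ 2 * expTail (a * k)) / 2 := by ring
        _ ≤ N * (a * k) ^ 2 * (88 * q) / 2 := by gcongr
        _ = _ := by ring
    have u5 : 0 ≤ N * (a * k) ^ 2 * q := by positivity
    rw [abs_le]
    constructor <;> linarith

/-- The remainder is used with `v = |ε| k²`, which gives `2 |ε|³ N (ak) π coth(πak)`. The terms of
order one and two are homogeneous in `ε`, so the corrections can be computed from `Q` alone. -/
theorem logDet_expansion {k ε : ℝ} (ha : 0 < a) (hk : 0 < k) (hR : 1 ≤ a * k)
    (hQ : IsPotential a Q)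
    (hn : ∀ x, ‖Matrix.toEuclideanCLM (n := Fin N) (𝕜 := ℂ) (Q x)‖ ≤ k ^ 2) (hε : |ε| ≤ 1 / 2) :
    (∀ μ : ℝ, eigenspace a (fun x => (ε : ℂ) • Q x) μ ≠ ⊥ → -k ^ 2 < μ) ∧
    IsSpectralZeta a (fun x => (ε : ℂ) • Q x) (-k ^ 2)
      (spectralZeta a (fun x => (ε : ℂ) • Q x) (-k ^ 2)) ∧
    ‖logDet a (fun x => (ε : ℂ) • Q x) (-k ^ 2) - ((2 * Real.pi * a * N * k : ℝ) +
        (Real.pi * a / k : ℂ) * ((fourierCoef a (fun x => (ε : ℂ) • Q x) 0).trace -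
          (secondSum a k (fun x => (ε : ℂ) • Q x) : ℂ))) -
        ((∑ j : Fin 3, expCorrection a k Q j * ε ^ (j : ℕ) : ℝ) : ℂ)‖ ≤
      100 * N * (a * k) * |ε| ^ 3 := by
  have hT : Fact (0 < 2 * Real.pi * a) := ⟨by positivity⟩
  have hm : 0 < k ^ 2 := by positivity
  have hW := hQ.const_smul ε
  have hv := norm_potOp_le hW (by positivity) (norm_const_smul_le hn)
  have hvm : |ε| * k ^ 2 ≤ k ^ 2 / 2 := by nlinarith
  obtain ⟨Z, hZ, hZ0⟩ := exists_spectralZeta hW (hv.trans hvm) hm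
  obtain ⟨hz1, hz2⟩ := logDet_eq hZ
  obtain ⟨J, hJ1, hJ2⟩ := exists_integral_expansion hW hk hv hvm
  refine ⟨fun μ hμ => ?_, hz1, ?_⟩
  · have := specSpace_pos hW (hv.trans hvm) (mt (specSpace_eq_bot_iff μ).1 hμ)
    linarith
  rw [hz2, hZ0, hJ1, trace_fourierCoef_eq_re hW]
  rw [freeTrace_sq hk] at hJ2
  have ht : (fourierCoef a (fun x => (ε : ℂ) • Q x) 0).trace.re =
      ε * (fourierCoef a Q 0).trace.re := by
    rw [fourierCoef_const_smul, Matrix.trace_smul, smul_eq_mul, re_ofReal_mul]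
  rw [ht, secondSum_const_smul, hsCoef_const_smul] at hJ2
  rw [ht, secondSum_const_smul]
  rw [Real.sqrt_sq hk.le]
  norm_cast
  rw [Real.norm_eq_abs, abs_sub_comm]
  refine le_trans (le_of_eq ?_) (hJ2.trans ?_)
  -- Splitting `coth = 1 + (coth - 1)` separates each coefficient into its share of `γ` and an entry
  -- of `expCorrection`; the identity is exact.
  · congr 1
    simp only [expCorrection, Fin.sum_univ_three, Fin.val_zero, Fin.val_one, Fin.val_two,
      Matrix.cons_val_zero, Matrix.cons_val_one, Matrix.cons_val, pow_zero, pow_one]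
    ring
  · have hc := cothPi_sub_one_le hR
    have hq := exp_neg_two_pi_le_half hR
    have hc3 : cothPi (a * k) ≤ 3 := by linarith
    calc _ = 2 * |ε| ^ 3 * N * (a * k) * (Real.pi * cothPi (a * k)) := by field_simp
      _ ≤ 2 * |ε| ^ 3 * N * (a * k) * (4 * 3) := by
          gcongr
          · linarith [one_le_cothPi (by linarith : 0 < a * k)]
          · exact Real.pi_le_four
      _ ≤ _ := by
          have : 0 ≤ |ε| ^ 3 * N * (a * k) := by positivity
          push_cast
          linarith

end

end CircleDet

end

/-! ### The main theorem. -/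

theorem mainTheorem6 :
    (∀ z : ℝ, -4 < z → CircleDet.fFun (-3 / 2) z = 4 / (z + 4)) ∧
    (∀ (N : ℕ) (a lam : ℝ) (Q : ℝ → Matrix (Fin N) (Fin N) ℂ),
      0 < a → lam < 0 → CircleDet.IsPotential a Q →
      (∃! P, CircleDet.IsFreeResolvent a lam Q P) ∧
      ∀ P, CircleDet.IsFreeResolvent a lam Q P →
        CircleDet.gammaFun a Q lam =
          1 / (2 * ((-lam) ^ (1 / 2 : ℝ) : ℝ) : ℂ) *
              (∫ x in (0 : ℝ)..(2 * Real.pi * a), (Q x).trace)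
            - 1 / (2 * ((-lam) ^ (1 / 2 : ℝ) : ℝ) : ℂ) *
              (∫ x in (0 : ℝ)..(2 * Real.pi * a), (Q x * P x).trace)) ∧
    ∃ C : ℝ, 0 < C ∧
      ∀ (N : ℕ) (a lam : ℝ) (Q : ℝ → Matrix (Fin N) (Fin N) ℂ),
        0 < a → lam < 0 → 1 ≤ a * (-lam) ^ (1 / 2 : ℝ) →
        CircleDet.IsPotential a Q →
        (∀ x, ‖Matrix.toEuclideanCLM (n := Fin N) (𝕜 := ℂ) (Q x)‖ ≤ -lam) →
        ∃ d : Fin 3 → ℝ,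
          (∀ j, |d j| ≤ C * N * (a * (-lam) ^ (1 / 2 : ℝ)) ^ (j : ℕ) *
            Real.exp (-(2 * Real.pi * (a * (-lam) ^ (1 / 2 : ℝ))))) ∧
          ∀ ε : ℝ, |ε| ≤ 1 / 2 →
            (∀ μ : ℝ, CircleDet.eigenspace a (fun x => (ε : ℂ) • Q x) μ ≠ ⊥ → lam < μ) ∧
            CircleDet.IsSpectralZeta a (fun x => (ε : ℂ) • Q x) lam
              (CircleDet.spectralZeta a (fun x => (ε : ℂ) • Q x) lam) ∧
            ‖CircleDet.logDet a (fun x => (ε : ℂ) • Q x) lam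
                - ((2 * Real.pi * a * N * (-lam) ^ (1 / 2 : ℝ) : ℝ)
                  + CircleDet.gammaFun a (fun x => (ε : ℂ) • Q x) lam)
                - ((∑ j : Fin 3, d j * ε ^ (j : ℕ) : ℝ) : ℂ)‖
              ≤ C * N * (a * (-lam) ^ (1 / 2 : ℝ)) * |ε| ^ 3 := by
  refine ⟨CircleDet.fFun_neg_three_halves, fun N a lam Q ha hl hQ =>
    ⟨CircleDet.existsUnique_isFreeResolvent ha hl hQ, fun P hP =>
      CircleDet.gammaFun_eq_of_isFreeResolvent ha hl hQ hP⟩, 100, by norm_num,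
    fun N a lam Q ha hl hR hQ hn => ?_⟩
  have hk : (0 : ℝ) < (-lam) ^ (1 / 2 : ℝ) := Real.rpow_pos_of_pos (by linarith) _
  have hγ : ∀ ε : ℝ, CircleDet.gammaFun a (fun x => (ε : ℂ) • Q x) lam = _ := fun ε =>
    CircleDet.gammaFun_eq_tsum ha hl (hQ.const_smul ε)
  simp only [hγ]
  have hlam : lam = -((-lam) ^ (1 / 2 : ℝ)) ^ 2 := by
    rw [← Real.sqrt_eq_rpow, Real.sq_sqrt (by linarith), neg_neg]
  have hm : -lam = ((-lam) ^ (1 / 2 : ℝ)) ^ 2 := by linarith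
  rw [hm] at hn
  generalize (-lam) ^ (1 / 2 : ℝ) = k at *
  subst hlam
  exact ⟨CircleDet.expCorrection a k Q, CircleDet.abs_expCorrection_le ha hk hR hQ hn,
    fun ε hε => CircleDet.logDet_expansion ha hk hR hQ hn hε⟩
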